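/- Let $n\ge 2$, let $M$ be a compact smooth $n$-dimensional manifold (without boundary), and let $h$ be a smooth Riemannian metric on $M$ with Levi-Civita connection $\tilde\nabla$, Ricci tensor $\widetilde{\mathrm{Ric}}$ and volume measure $\mu_h$; norms of tensors and Sobolev norms on $M$ are taken with respect to $h$. For a Riemannian metric $g\in C^0\cap W^{1,n}(M)$ and $u\in C^\infty(M)$ the distributional scalar curvature is $$\langle R_g,u\rangle:=\int_M\Big(-V\cdot\tilde\nabla\Big(u\,\frac{d\mu_g}{d\mu_h}\Big)+F\,u\,\frac{d\mu_g}{d\mu_h}\Big)\,d\mu_h,$$ where, with weak covariant derivatives, $$\Gamma_{ij}^k=\tfrac12 g^{kl}\big(\tilde\nabla_i g_{jl}+\tilde\nabla_j g_{il}-\tilde\nabla_l g_{ij}\big),\qquad V^k=g^{ij}\Gamma^k_{ij}-g^{ik}\Gamma^j_{ji},$$ $$F=\mathrm{tr}_g\widetilde{\mathrm{Ric}}-\tilde\nabla_k g^{ij}\,\Gamma^k_{ij}+\tilde\nabla_k g^{ik}\,\Gamma^j_{ji}+g^{ij}\big(\Gamma^k_{kl}\Gamma^l_{ij}-\Gamma^k_{jl}\Gamma^l_{ik}\big).$$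 Let $g$ be a $C^0\cap W^{1,n}$ Riemannian metric on $M$ and let $(g_\delta)_{\delta>0}$ be any family of smooth Riemannian metrics on $M$ that converges to $g$ both in the $C^0$-norm and in the $W^{1,n}$-norm as $\delta\to0^+$ (for instance, mollifications of $g$). Then the pairings $\langle R_g,u\rangle$ and $\langle R_{g_\delta},u\rangle$ are well defined for all $u\in C^\infty(M)$ and $\delta>0$ (the weak derivatives exist and the integrals converge absolutely), and for every $\varepsilon>0$ there is $\delta_0>0$ such that $$|\langle R_{g_\delta},u\rangle-\langle R_g,u\rangle|\le\varepsilon\,\|u\|_{W^{1,\frac{n}{n-1}}(M)}\qquad\text{for all }u\in C^\infty(M)\text{ and all }\delta\in(0,\delta_0).$$ -/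

import Mathlib

open MeasureTheory Set Filter Topology
open scoped Manifold ContDiff ENNReal

set_option maxSynthPendingDepth 3

noncomputable section

namespace WeakScalar

/-- The model space `ℝⁿ`. -/
abbrev E (n : ℕ) : Type := EuclideanSpace ℝ (Fin n)

/-- Fields `S` of bilinear forms on the tangent spaces: `(0,2)`-tensor fields, without regularity. -/
abbrev Tensor2 (n : ℕ) (M : Type*) [TopologicalSpace M] [ChartedSpace (E n) M] : Type _ :=
  ∀ x : M, TangentSpace (𝓡 n) x →L[ℝ] TangentSpace (𝓡 n) x →L[ℝ] ℝ

/-- `(0,3)`-tensor fields, without regularity. -/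
abbrev Tensor3 (n : ℕ) (M : Type*) [TopologicalSpace M] [ChartedSpace (E n) M] : Type _ :=
  ∀ x : M, TangentSpace (𝓡 n) x →ₗ[ℝ] TangentSpace (𝓡 n) x →ₗ[ℝ] TangentSpace (𝓡 n) x →ₗ[ℝ] ℝ

/-- Tensor fields of type `(2,1)`: one vector argument, followed by two covector arguments. -/
abbrev Tensor21 (n : ℕ) (M : Type*) [TopologicalSpace M] [ChartedSpace (E n) M] : Type _ :=
  ∀ x : M, TangentSpace (𝓡 n) x →ₗ[ℝ] (TangentSpace (𝓡 n) x →L[ℝ] ℝ) →ₗ[ℝ]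
    (TangentSpace (𝓡 n) x →L[ℝ] ℝ) →ₗ[ℝ] ℝ

/-- Fields of covectors (`1`-forms), without regularity. -/
abbrev Covector (n : ℕ) (M : Type*) [TopologicalSpace M] [ChartedSpace (E n) M] : Type _ :=
  ∀ x : M, TangentSpace (𝓡 n) x →L[ℝ] ℝ

/-- The smooth Riemannian metrics on `M`. -/
abbrev SmoothMetric (n : ℕ) (M : Type*) [TopologicalSpace M] [ChartedSpace (E n) M]
    [IsManifold (𝓡 n) ∞ M] : Type _ :=
  Bundle.ContMDiffRiemannianMetric (𝓡 n) ∞ (E n) (fun x : M => TangentSpace (𝓡 n) x)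

/-- The continuous Riemannian metrics on `M`. -/
abbrev ContMetric (n : ℕ) (M : Type*) [TopologicalSpace M] [ChartedSpace (E n) M]
    [IsManifold (𝓡 n) ∞ M] : Type _ :=
  Bundle.ContinuousRiemannianMetric (E n) (fun x : M => TangentSpace (𝓡 n) x)

/-! ### Partial derivatives on `ℝⁿ` -/

/-- The classical partial derivative `∂_k f`. -/
def pd {n : ℕ} (k : Fin n) (f : E n → ℝ) (z : E n) : ℝ :=
  fderiv ℝ f z (EuclideanSpace.single k 1)

/-- `D` is the weak partial derivative `∂_k f` on the open set `Ω`. -/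
def HasWeakPartial {n : ℕ} (Ω : Set (E n)) (k : Fin n) (f D : E n → ℝ) : Prop :=
  LocallyIntegrableOn f Ω ∧ LocallyIntegrableOn D Ω ∧
    ∀ ψ : E n → ℝ, ContDiff ℝ ∞ ψ → HasCompactSupport ψ → tsupport ψ ⊆ Ω →
      ∫ z in Ω, f z * pd k ψ z = -∫ z in Ω, D z * ψ z

section Charts

variable {n : ℕ} {M : Type*} [TopologicalSpace M] [ChartedSpace (E n) M]

/-! ### Components in a chart `φ`, at the point `z` of its target -/

/-- The coordinate vector `∂_k` of the chart `φ` at the point `φ⁻¹ z`. -/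
def frame (φ : OpenPartialHomeomorph M (E n)) (z : E n) (k : Fin n) :
    TangentSpace (𝓡 n) (φ.symm z) :=
  mfderiv (𝓡 n) (𝓡 n) φ.symm z (EuclideanSpace.single k (1 : ℝ) : E n)

/-- The coordinate covector `dx^k` of the chart `φ` at the point `φ⁻¹ z`. -/
def coframe (φ : OpenPartialHomeomorph M (E n)) (z : E n) (k : Fin n) :
    TangentSpace (𝓡 n) (φ.symm z) →L[ℝ] ℝ :=
  (EuclideanSpace.proj k : E n →L[ℝ] ℝ).comp
    (mfderiv (𝓡 n) (𝓡 n) φ (φ.symm z) : TangentSpace (𝓡 n) (φ.symm z) →L[ℝ] E n)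

/-- The matrix of components `S_ij`. -/
def gram (φ : OpenPartialHomeomorph M (E n)) (S : Tensor2 n M) (z : E n) :
    Matrix (Fin n) (Fin n) ℝ :=
  Matrix.of fun i j => S (φ.symm z) (frame φ z i) (frame φ z j)

/-- The components `T_kij`. -/
def comp3 (φ : OpenPartialHomeomorph M (E n)) (T : Tensor3 n M) (z : E n) (k i j : Fin n) : ℝ :=
  T (φ.symm z) (frame φ z k) (frame φ z i) (frame φ z j)

/-- The components `P_k^{ij}`. -/
def comp21 (φ : OpenPartialHomeomorph M (E n)) (P : Tensor21 n M) (z : E n) (k i j : Fin n) : ℝ :=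
  P (φ.symm z) (frame φ z k) (coframe φ z i) (coframe φ z j)

/-- The components `α_k`. -/
def comp1 (φ : OpenPartialHomeomorph M (E n)) (α : Covector n M) (z : E n) (k : Fin n) : ℝ :=
  α (φ.symm z) (frame φ z k)

/-- The Christoffel symbol `Γ̃^k_ij` of the smooth metric `h`. -/
def christoffel (φ : OpenPartialHomeomorph M (E n)) (h : Tensor2 n M) (k i j : Fin n) (z : E n) :
    ℝ :=
  (1 / 2) * ∑ l, (gram φ h z)⁻¹ k l *
    (pd i (fun w => gram φ h w j l) z + pd j (fun w => gram φ h w i l) z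
      - pd l (fun w => gram φ h w i j) z)

/-- The component `R̃_ij` of the Ricci tensor of the smooth metric `h`. -/
def ricci (φ : OpenPartialHomeomorph M (E n)) (h : Tensor2 n M) (i j : Fin n) (z : E n) : ℝ :=
  ∑ k, pd k (christoffel φ h k i j) z - ∑ k, pd j (christoffel φ h k i k) z
    + ∑ k, ∑ l, (christoffel φ h k k l z * christoffel φ h l i j z
        - christoffel φ h k j l z * christoffel φ h l i k z)

/-- The value at `x` of a function given in charts, computed in the preferred chart at `x`. It is
only applied to scalars that do not depend on the chart. -/
def atPoint (f : OpenPartialHomeomorph M (E n) → E n → ℝ) (x : M) : ℝ :=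
  f (chartAt (E n) x) (chartAt (E n) x x)

/-! ### The volume measure, the volume ratio and the pointwise norms of a metric `h` -/

/-- The Riemannian volume of `h` on the domain of the chart `φ`: the image of
`√(det h_ij) dz` under `φ⁻¹`. -/
def chartVol [MeasurableSpace M] (h : Tensor2 n M) (φ : OpenPartialHomeomorph M (E n)) :
    Measure M :=
  Measure.map φ.symm ((volume.restrict φ.target).withDensity
    fun z => ENNReal.ofReal (√(gram φ h z).det))

/-- The Riemannian volume measure `μ_h`: the least measure that dominates its pieces `chartVol h φ`.
As these pieces agree on the overlaps of the charts, `μ_h` restricts to `chartVol h φ` on the domain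
of each chart `φ` of the atlas. -/
def vol [MeasurableSpace M] (h : Tensor2 n M) : Measure M :=
  ⨆ φ ∈ atlas (E n) M, chartVol h φ

/-- The density `dμ_g / dμ_h`. -/
def volRatio (h g : Tensor2 n M) : M → ℝ :=
  atPoint fun φ z => √((gram φ g z).det / (gram φ h z).det)

/-- `|S|_h` for a `(0,2)`-tensor field `S`. -/
def norm2 (h S : Tensor2 n M) : M → ℝ :=
  atPoint fun φ z => √(∑ i, ∑ j, ∑ a, ∑ b,
    (gram φ h z)⁻¹ i a * (gram φ h z)⁻¹ j b * gram φ S z i j * gram φ S z a b)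

/-- `|T|_h` for a `(0,3)`-tensor field `T`. -/
def norm3 (h : Tensor2 n M) (T : Tensor3 n M) : M → ℝ :=
  atPoint fun φ z => √(∑ k, ∑ i, ∑ j, ∑ c, ∑ a, ∑ b,
    (gram φ h z)⁻¹ k c * (gram φ h z)⁻¹ i a * (gram φ h z)⁻¹ j b
      * comp3 φ T z k i j * comp3 φ T z c a b)

/-- `|∇̃u|_h` for a differentiable function `u`. -/
def normGrad (h : Tensor2 n M) (u : M → ℝ) : M → ℝ :=
  atPoint fun φ z => √(∑ i, ∑ j,
    (gram φ h z)⁻¹ i j * pd i (u ∘ φ.symm) z * pd j (u ∘ φ.symm) z)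

/-! ### Weak derivatives of tensor fields, with respect to the Levi-Civita connection `∇̃` of `h` -/

/-- `T` is the weak covariant derivative `∇̃S` of the `(0,2)`-tensor field `S`: in every chart
`∂_k S_ij = T_kij + Γ̃^l_ki S_lj + Γ̃^l_kj S_il` weakly. -/
def HasWeakCovDeriv (h S : Tensor2 n M) (T : Tensor3 n M) : Prop :=
  ∀ φ ∈ atlas (E n) M, ∀ k i j : Fin n,
    HasWeakPartial φ.target k (fun z => gram φ S z i j)
      (fun z => comp3 φ T z k i j
        + ∑ l, christoffel φ h l k i z * gram φ S z l j
        + ∑ l, christoffel φ h l k j z * gram φ S z i l)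

/-- `P` is the weak covariant derivative `∇̃_k g^{ij}` of the inverse of the metric `g`: in every
chart `∂_k g^{ij} = P_k^{ij} - Γ̃^i_kl g^{lj} - Γ̃^j_kl g^{il}` weakly. -/
def HasWeakCovDerivInv (h g : Tensor2 n M) (P : Tensor21 n M) : Prop :=
  ∀ φ ∈ atlas (E n) M, ∀ k i j : Fin n,
    HasWeakPartial φ.target k (fun z => (gram φ g z)⁻¹ i j)
      (fun z => comp21 φ P z k i j
        - ∑ l, christoffel φ h i k l z * (gram φ g z)⁻¹ l j
        - ∑ l, christoffel φ h j k l z * (gram φ g z)⁻¹ i l)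

/-- `α` is the weak differential of the function `f`. -/
def HasWeakDiff (f : M → ℝ) (α : Covector n M) : Prop :=
  ∀ φ ∈ atlas (E n) M, ∀ k : Fin n,
    HasWeakPartial φ.target k (f ∘ φ.symm) (fun z => comp1 φ α z k)

open Classical in
/-- The weak covariant derivative `∇̃S` (unique up to null sets; zero if there is none). -/
def weakCovDeriv (h S : Tensor2 n M) : Tensor3 n M :=
  if H : ∃ T, HasWeakCovDeriv h S T then H.choose else 0

open Classical in
/-- The weak covariant derivative of the inverse of `g` (zero if there is none). -/
def weakCovDerivInv (h g : Tensor2 n M) : Tensor21 n M :=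
  if H : ∃ P, HasWeakCovDerivInv h g P then H.choose else 0

open Classical in
/-- The weak differential of `f` (zero if there is none). -/
def weakDiff (f : M → ℝ) : Covector n M :=
  if H : ∃ α : Covector n M, HasWeakDiff f α then H.choose else 0

/-! ### Sobolev spaces -/

/-- The tensor field `S` belongs to `W^{1,p}(M)`. -/
def MemW1 [MeasurableSpace M] (h : Tensor2 n M) (p : ℝ≥0∞) (S : Tensor2 n M) : Prop :=
  (∃ T, HasWeakCovDeriv h S T) ∧ MemLp (norm2 h S) p (vol h) ∧
    MemLp (norm3 h (weakCovDeriv h S)) p (vol h)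

/-- The distance of two tensor fields in the `C⁰`-norm. -/
def distC0 (h S S' : Tensor2 n M) : ℝ≥0∞ :=
  ⨆ x, ENNReal.ofReal (norm2 h (S - S') x)

/-- The distance of two tensor fields in the `W^{1,p}`-norm. -/
def distW1 [MeasurableSpace M] (h : Tensor2 n M) (p : ℝ≥0∞) (S S' : Tensor2 n M) : ℝ≥0∞ :=
  eLpNorm (norm2 h (S - S')) p (vol h)
    + eLpNorm (norm3 h (weakCovDeriv h S - weakCovDeriv h S')) p (vol h)

/-- The `W^{1,p}`-norm of a smooth function. -/
def normW1 [MeasurableSpace M] (h : Tensor2 n M) (p : ℝ≥0∞) (u : M → ℝ) : ℝ :=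
  (eLpNorm u p (vol h) + eLpNorm (normGrad h u) p (vol h)).toReal

/-! ### The distributional scalar curvature of `g`, computed with the background metric `h` -/

/-- `Γ^k_ij = ½ g^{kl} (∇̃_i g_jl + ∇̃_j g_il - ∇̃_l g_ij)`. -/
def Gam (φ : OpenPartialHomeomorph M (E n)) (h g : Tensor2 n M) (k i j : Fin n) (z : E n) : ℝ :=
  (1 / 2) * ∑ l, (gram φ g z)⁻¹ k l *
    (comp3 φ (weakCovDeriv h g) z i j l + comp3 φ (weakCovDeriv h g) z j i l
      - comp3 φ (weakCovDeriv h g) z l i j)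

/-- `V^k = g^{ij} Γ^k_ij - g^{ik} Γ^j_ji`. -/
def V (φ : OpenPartialHomeomorph M (E n)) (h g : Tensor2 n M) (k : Fin n) (z : E n) : ℝ :=
  ∑ i, ∑ j, (gram φ g z)⁻¹ i j * Gam φ h g k i j z
    - ∑ i, ∑ j, (gram φ g z)⁻¹ i k * Gam φ h g j j i z

/-- `F = tr_g Ric(h) - ∇̃_k g^{ij} Γ^k_ij + ∇̃_k g^{ik} Γ^j_ji
  + g^{ij} (Γ^k_kl Γ^l_ij - Γ^k_jl Γ^l_ik)`. -/
def F (φ : OpenPartialHomeomorph M (E n)) (h g : Tensor2 n M) (z : E n) : ℝ :=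
  ∑ i, ∑ j, (gram φ g z)⁻¹ i j * ricci φ h i j z
    - ∑ k, ∑ i, ∑ j, comp21 φ (weakCovDerivInv h g) z k i j * Gam φ h g k i j z
    + ∑ k, ∑ i, ∑ j, comp21 φ (weakCovDerivInv h g) z k i k * Gam φ h g j j i z
    + ∑ i, ∑ j, (gram φ g z)⁻¹ i j * ∑ k, ∑ l,
        (Gam φ h g k k l z * Gam φ h g l i j z - Gam φ h g k j l z * Gam φ h g l i k z)

/-- The function `-V · ∇̃(u dμ_g/dμ_h) + F u dμ_g/dμ_h`. The product `V · ∇̃f` is `V^k ∂_k f`. -/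
def scalIntegrand (h g : Tensor2 n M) (u : M → ℝ) (x : M) : ℝ :=
  atPoint (fun φ z =>
    -∑ k, V φ h g k z * comp1 φ (weakDiff fun y => u y * volRatio h g y) z k) x
    + atPoint (fun φ z => F φ h g z) x * (u x * volRatio h g x)

/-- The pairing `⟨R_g, u⟩`. -/
def scalPairing [MeasurableSpace M] (h g : Tensor2 n M) (u : M → ℝ) : ℝ :=
  ∫ x, scalIntegrand h g u x ∂(vol h)

/-- `⟨R_g, u⟩` is well defined: the weak derivatives in its definition exist and its integral
converges. -/
def PairingDefined [MeasurableSpace M] (h g : Tensor2 n M) (u : M → ℝ) : Prop :=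
  (∃ T, HasWeakCovDeriv h g T) ∧ (∃ P, HasWeakCovDerivInv h g P) ∧
    (∃ α : Covector n M, HasWeakDiff (fun y => u y * volRatio h g y) α) ∧
    Integrable (scalIntegrand h g u) (vol h)

end Charts

end WeakScalar

end

noncomputable section

namespace WeakScalar

/-! ### Frames, dual frames and index raising on ℝⁿ. -/

section Algebra

variable {n : ℕ}

/-! In a chart the integrand of the pairing, multiplied by the volume density of `h`, has the form
`A^k ∂_k u + B u` (`scalIntegrand_ae`). Write `T = ∇̃g`. Then `A` is linear in `T` with locally
bounded coefficients, hence locally in `L^n`, while `B` is a bounded term plus terms quadratic in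
`T`, hence locally in `L^{n/2}`. The coefficients are continuous expressions in `g`, its inverse,
the volume densities and the smooth background, so C⁰ convergence makes them converge uniformly on
compact sets. As `T` converges in `L^n`, Hölder's inequality gives `A_δ → A` in `L^n` and `B_δ → B`
in `L^{n/2}` (`coefAConv`, `coefBConv`).

For `n ≥ 3` this suffices: `∂u` lies in `L^{n/(n-1)}`, the dual of `L^n`, and the Sobolev inequality
bounds a compactly supported `u` in `L^{n/(n-2)}`, the dual of `L^{n/2}`
(`localEstimate_of_three_le`).

For `n = 2` the coefficient `B` is only in `L¹`, and `W^{1,2}` does not embed into `L^∞`. The way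
out is that curvature in dimension two is a divergence. For a smooth metric, `B` times the density
of `h` equals the divergence of a field of order zero in `g` (`bgField`) minus an expression
quadratic in the Christoffel symbols of `g`, and that expression is the Jacobian determinant of
`g₀₀/√det g` and `g₀₁/g₀₀`, again a divergence (`dens_mul_coefB`, `two_dim_jacobian`). Integration
by parts turns the pairing into `∫ X^k ∂_k u`, where `X` converges in `L²` along with the metrics.
The formula passes to the limit metric, and Hölder's inequality with exponents 2 and 2 concludes
(`localEstimate_two`).

Weak derivatives of the inverse metric and of `u dμ_g/dμ_h` exist because weak differentiation is
closed under `L¹_loc` limits (`HasWeakPartial.of_tendsto`) and the classical formulas hold for the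
approximating metrics. A smooth metric is approximated by the constant family (`Approx.const`), so
whatever is proved for the limit also holds for each `gδ`.

To globalize, the pointwise quantities have to be independent of the chart, including the Ricci
tensor, which is given by a coordinate formula (`ricci_transition`); the chosen weak derivatives are
determined almost everywhere; and a finite partition of unity splits `u` into functions supported in
charts, whose gradient norms are bounded by the global Sobolev norm. -/

lemma map_sum_smul_of_isLinearMap {V ι : Type*} [AddCommGroup V] [Module ℝ V] [Fintype ι]
    {f : V → ℝ} (hf : IsLinearMap ℝ f) (c : ι → ℝ) (x : ι → V) :
    f (∑ k, c k • x k) = ∑ k, c k * f (x k) := by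
  have := map_sum hf.mk' (fun k => c k • x k) Finset.univ
  simp only [IsLinearMap.mk'_apply, hf.map_smul, smul_eq_mul] at this
  exact this

/-- `e` is a basis of `ℝⁿ` with dual basis `θ`. -/
structure IsFrame (e : Fin n → E n) (θ : Fin n → (E n →L[ℝ] ℝ)) : Prop where
  dual : ∀ i j, θ i (e j) = if i = j then 1 else 0
  expand : ∀ v, ∑ k, θ k v • e k = v

namespace IsFrame

variable {e e' : Fin n → E n} {θ θ' : Fin n → (E n →L[ℝ] ℝ)}

lemma coexpand (h : IsFrame e θ) (α : E n →L[ℝ] ℝ) : ∑ k, α (e k) • θ k = α := by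
  ext v
  conv_rhs => rw [← h.expand v]
  simp [mul_comm]

/-- A full contraction does not depend on the basis. -/
lemma contract_eq (h : IsFrame e θ) (h' : IsFrame e' θ') (f : E n → (E n →L[ℝ] ℝ) → ℝ)
    (h1 : ∀ ξ, IsLinearMap ℝ fun v => f v ξ) (h2 : ∀ v, IsLinearMap ℝ fun ξ => f v ξ) :
    ∑ k, f (e k) (θ k) = ∑ k, f (e' k) (θ' k) := by
  have a1 : ∀ k, f (e k) (θ k) = ∑ j, θ' j (e k) * f (e' j) (θ k) := by
    intro k
    conv_lhs => rw [← h'.expand (e k)]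
    exact map_sum_smul_of_isLinearMap (h1 (θ k)) _ _
  have a2 : ∀ j, f (e' j) (θ' j) = ∑ k, θ' j (e k) * f (e' j) (θ k) := by
    intro j
    conv_lhs => rw [← h.coexpand (θ' j)]
    exact map_sum_smul_of_isLinearMap (h2 (e' j)) _ _
  simp only [a1, a2]
  exact Finset.sum_comm

lemma map_expand (h : IsFrame e θ) {f : E n → ℝ} (hf : IsLinearMap ℝ f) (v : E n) :
    ∑ k, θ k v * f (e k) = f v := by
  conv_rhs => rw [← h.expand v]
  exact (map_sum_smul_of_isLinearMap hf _ _).symm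

lemma map_coexpand (h : IsFrame e θ) {f : (E n →L[ℝ] ℝ) → ℝ} (hf : IsLinearMap ℝ f)
    (α : E n →L[ℝ] ℝ) : ∑ k, α (e k) * f (θ k) = f α := by
  conv_rhs => rw [← h.coexpand α]
  exact (map_sum_smul_of_isLinearMap hf _ _).symm

end IsFrame

lemma isLinearMap_coe {V : Type*} [AddCommGroup V] [Module ℝ V] (f : V →ₗ[ℝ] ℝ) :
    IsLinearMap ℝ fun v => f v := ⟨f.map_add, f.map_smul⟩

/-- The components of a bilinear form in a basis. -/
def gramOf (B : E n →L[ℝ] E n →L[ℝ] ℝ) (e : Fin n → E n) : Matrix (Fin n) (Fin n) ℝ :=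
  Matrix.of fun i j => B (e i) (e j)

/-- `s` raises indices with respect to the bilinear form `B`. -/
structure IsSharp (B : E n →L[ℝ] E n →L[ℝ] ℝ) (s : (E n →L[ℝ] ℝ) →ₗ[ℝ] E n) : Prop where
  symm : ∀ v w, B v w = B w v
  left : ∀ α v, B (s α) v = α v

/-- Expanding `s (θ j)` in the frame turns row `i` of the Gram matrix times column `j` of the
candidate into `B (e i) (s (θ j)) = θ j (e i)`. Inverse Gram matrices thus become components of one
frame-independent map, and chart independence reduces to multilinearity. -/
lemma IsSharp.inv_gramOf {B : E n →L[ℝ] E n →L[ℝ] ℝ} {s : (E n →L[ℝ] ℝ) →ₗ[ℝ] E n}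
    (hs : IsSharp B s) {e : Fin n → E n} {θ : Fin n → (E n →L[ℝ] ℝ)} (h : IsFrame e θ)
    (i j : Fin n) : (gramOf B e)⁻¹ i j = θ i (s (θ j)) := by
  have : (gramOf B e)⁻¹ = Matrix.of fun i j => θ i (s (θ j)) := by
    apply Matrix.inv_eq_right_inv
    ext i j
    simp only [Matrix.mul_apply, gramOf, Matrix.of_apply, Matrix.one_apply]
    have := h.map_expand (f := fun v => B (e i) v) (isLinearMap_coe (B (e i)).toLinearMap)
      (s (θ j))
    simp only [mul_comm] at this ⊢
    rw [this, hs.symm, hs.left, h.dual]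
    simp [eq_comm]
  rw [this]; rfl

/-- Positivity makes `B` injective as a map into the dual space, and equality of dimensions makes it
invertible. -/
lemma exists_isSharp {B : E n →L[ℝ] E n →L[ℝ] ℝ} (hB : ∀ v w, B v w = B w v)
    (hpos : ∀ v, v ≠ 0 → 0 < B v v) : ∃ s, IsSharp B s := by
  have hinj : Function.Injective B.toLinearMap := by
    rw [← LinearMap.ker_eq_bot, LinearMap.ker_eq_bot']
    intro v hv
    by_contra h
    have := hpos v h
    rw [show B v = 0 from hv] at this
    simp at this
  have hdim : Module.finrank ℝ (E n) = Module.finrank ℝ (E n →L[ℝ] ℝ) := by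
    rw [← (LinearMap.toContinuousLinearMap (𝕜 := ℝ) (E := E n) (F' := ℝ)).finrank_eq]
    exact (Subspace.dual_finrank_eq (K := ℝ) (V := E n)).symm
  let L := LinearMap.linearEquivOfInjective B.toLinearMap hinj hdim
  refine ⟨L.symm.toLinearMap, hB, fun α v => ?_⟩
  have : L (L.symm α) = α := L.apply_symm_apply α
  exact congrArg (fun f : E n →L[ℝ] ℝ => f v) this

end Algebra

/-! ### Linearity rules and frame independence of contractions. -/

section LinearCalculus

variable {V : Type*} [AddCommGroup V] [Module ℝ V]

lemma isLinearMap_sum {ι : Type*} [Fintype ι] {f : ι → V → ℝ} (hf : ∀ i, IsLinearMap ℝ (f i)) :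
    IsLinearMap ℝ fun v => ∑ i, f i v :=
  ⟨fun v w => by simp [(hf _).map_add, Finset.sum_add_distrib],
    fun c v => by simp [(hf _).map_smul, Finset.mul_sum]⟩

lemma isLinearMap_sub {f g : V → ℝ} (hf : IsLinearMap ℝ f) (hg : IsLinearMap ℝ g) :
    IsLinearMap ℝ fun v => f v - g v :=
  ⟨fun v w => by rw [hf.map_add, hg.map_add]; ring,
    fun c v => by rw [hf.map_smul, hg.map_smul, smul_sub]⟩

lemma isLinearMap_const_mul (c : ℝ) {f : V → ℝ} (hf : IsLinearMap ℝ f) :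
    IsLinearMap ℝ fun v => c * f v :=
  ⟨fun v w => by rw [hf.map_add]; ring, fun a v => by rw [hf.map_smul]; simp; ring⟩

lemma isLinearMap_mul_const {f : V → ℝ} (hf : IsLinearMap ℝ f) (c : ℝ) :
    IsLinearMap ℝ fun v => f v * c :=
  ⟨fun v w => by rw [hf.map_add]; ring, fun a v => by rw [hf.map_smul]; simp; ring⟩

end LinearCalculus

section Invariants

variable {n : ℕ}

/-- Frame-independence of a contraction whose summands are frame-independent. -/
lemma IsFrame.sum_invariant {e e' : Fin n → E n} {θ θ' : Fin n → (E n →L[ℝ] ℝ)}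
    (h : IsFrame e θ) (h' : IsFrame e' θ')
    (f : E n → (E n →L[ℝ] ℝ) → (Fin n → E n) → (Fin n → (E n →L[ℝ] ℝ)) → ℝ)
    (h1 : ∀ ξ, IsLinearMap ℝ fun v => f v ξ e θ) (h2 : ∀ v, IsLinearMap ℝ fun ξ => f v ξ e θ)
    (h3 : ∀ v ξ, f v ξ e θ = f v ξ e' θ') :
    ∑ k, f (e k) (θ k) e θ = ∑ k, f (e' k) (θ' k) e' θ' := by
  -- The outer slot changes frame first while the inner sums stay in `e`; `h3` then changes the
  -- inner ones at fixed arguments. Nesting this moves a multiple contraction one index pair at a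
  -- time.
  rw [h.contract_eq h' (fun v ξ => f v ξ e θ) h1 h2]
  exact Finset.sum_congr rfl fun k _ => h3 _ _

/-- The covector `½ (T(v, w, ·) + T(w, v, ·) - T(·, v, w))`. -/
def lowGam (T : E n →ₗ[ℝ] E n →ₗ[ℝ] E n →ₗ[ℝ] ℝ) (v w : E n) : E n →L[ℝ] ℝ :=
  LinearMap.toContinuousLinearMap ((1 / 2 : ℝ) • (T v w + T w v - (T.flip v).flip w))

lemma lowGam_apply (T : E n →ₗ[ℝ] E n →ₗ[ℝ] E n →ₗ[ℝ] ℝ) (v w l : E n) :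
    lowGam T v w l = (1 / 2) * (T v w l + T w v l - T l v w) := by
  simp [lowGam]

/-- The difference tensor of connections, as a vector valued bilinear map. -/
def upGam (s : (E n →L[ℝ] ℝ) →ₗ[ℝ] E n) (T : E n →ₗ[ℝ] E n →ₗ[ℝ] E n →ₗ[ℝ] ℝ) :
    E n →ₗ[ℝ] E n →ₗ[ℝ] E n :=
  LinearMap.mk₂ ℝ (fun v w => s (lowGam T v w))
    (fun v v' w => by
      rw [← map_add]; congr 1; ext l; simp [lowGam_apply]; ring)
    (fun c v w => by
      rw [← map_smul]; congr 1; ext l; simp [lowGam_apply]; ring)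
    (fun v w w' => by
      rw [← map_add]; congr 1; ext l; simp [lowGam_apply]; ring)
    (fun c v w => by
      rw [← map_smul]; congr 1; ext l; simp [lowGam_apply]; ring)

lemma upGam_apply (s : (E n →L[ℝ] ℝ) →ₗ[ℝ] E n) (T : E n →ₗ[ℝ] E n →ₗ[ℝ] E n →ₗ[ℝ] ℝ)
    (v w : E n) : upGam s T v w = s (lowGam T v w) := rfl

variable {e e' : Fin n → E n} {θ θ' : Fin n → (E n →L[ℝ] ℝ)}

lemma IsFrame.contract_metric_eq (h : IsFrame e θ) (h' : IsFrame e' θ')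
    (s : (E n →L[ℝ] ℝ) →ₗ[ℝ] E n) (β : E n → E n → ℝ)
    (h1 : ∀ w, IsLinearMap ℝ fun v => β v w) (h2 : ∀ v, IsLinearMap ℝ fun w => β v w) :
    ∑ i, ∑ j, θ i (s (θ j)) * β (e i) (e j) = ∑ i, ∑ j, θ' i (s (θ' j)) * β (e' i) (e' j) := by
  refine h.sum_invariant h' (fun v ξ e θ => ∑ j, ξ (s (θ j)) * β v (e j)) ?_ ?_ fun v ξ =>
    h.sum_invariant h' (fun w η e θ => ξ (s η) * β v w) ?_ ?_ fun w η => rfl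
  all_goals intro _
  · exact isLinearMap_sum fun _ => isLinearMap_const_mul _ (h1 _)
  · exact isLinearMap_sum fun _ => isLinearMap_mul_const ⟨by simp, by simp⟩ _
  · exact isLinearMap_const_mul _ (h2 _)
  · exact isLinearMap_mul_const ⟨by simp, by simp⟩ _

lemma IsFrame.norm2_invariant (h : IsFrame e θ) (h' : IsFrame e' θ')
    (s : (E n →L[ℝ] ℝ) →ₗ[ℝ] E n) (S : E n →L[ℝ] E n →L[ℝ] ℝ) :
    ∑ i, ∑ j, ∑ a, ∑ b, θ i (s (θ a)) * θ j (s (θ b)) * S (e i) (e j) * S (e a) (e b)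
      = ∑ i, ∑ j, ∑ a, ∑ b, θ' i (s (θ' a)) * θ' j (s (θ' b)) * S (e' i) (e' j)
        * S (e' a) (e' b) := by
  refine h.sum_invariant h' (fun v₁ ξ₁ e θ => ∑ j, ∑ a, ∑ b,
      ξ₁ (s (θ a)) * θ j (s (θ b)) * S v₁ (e j) * S (e a) (e b)) ?_ ?_ fun v₁ ξ₁ =>
    h.sum_invariant h' (fun v₂ ξ₂ e θ => ∑ a, ∑ b,
      ξ₁ (s (θ a)) * ξ₂ (s (θ b)) * S v₁ v₂ * S (e a) (e b)) ?_ ?_ fun v₂ ξ₂ =>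
    h.sum_invariant h' (fun v₃ ξ₃ e θ => ∑ b,
      ξ₁ (s ξ₃) * ξ₂ (s (θ b)) * S v₁ v₂ * S v₃ (e b)) ?_ ?_ fun v₃ ξ₃ =>
    h.sum_invariant h' (fun v₄ ξ₄ e θ =>
      ξ₁ (s ξ₃) * ξ₂ (s ξ₄) * S v₁ v₂ * S v₃ v₄) ?_ ?_ fun v₄ ξ₄ => rfl
  all_goals
    intro _
    repeat' first
      | refine isLinearMap_sum fun _ => ?_
      | refine isLinearMap_const_mul _ ?_
      | refine isLinearMap_mul_const ?_ _
      | exact ⟨by simp, by simp⟩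

lemma IsFrame.norm3_invariant (h : IsFrame e θ) (h' : IsFrame e' θ')
    (s : (E n →L[ℝ] ℝ) →ₗ[ℝ] E n) (T : E n →ₗ[ℝ] E n →ₗ[ℝ] E n →ₗ[ℝ] ℝ) :
    ∑ k, ∑ i, ∑ j, ∑ c, ∑ a, ∑ b, θ k (s (θ c)) * θ i (s (θ a)) * θ j (s (θ b))
        * T (e k) (e i) (e j) * T (e c) (e a) (e b)
      = ∑ k, ∑ i, ∑ j, ∑ c, ∑ a, ∑ b, θ' k (s (θ' c)) * θ' i (s (θ' a)) * θ' j (s (θ' b))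
        * T (e' k) (e' i) (e' j) * T (e' c) (e' a) (e' b) := by
  refine h.sum_invariant h' (fun v₁ ξ₁ e θ => ∑ i, ∑ j, ∑ c, ∑ a, ∑ b,
      ξ₁ (s (θ c)) * θ i (s (θ a)) * θ j (s (θ b)) * T v₁ (e i) (e j) * T (e c) (e a) (e b))
      ?_ ?_ fun v₁ ξ₁ =>
    h.sum_invariant h' (fun v₂ ξ₂ e θ => ∑ j, ∑ c, ∑ a, ∑ b,
      ξ₁ (s (θ c)) * ξ₂ (s (θ a)) * θ j (s (θ b)) * T v₁ v₂ (e j) * T (e c) (e a) (e b))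
      ?_ ?_ fun v₂ ξ₂ =>
    h.sum_invariant h' (fun v₃ ξ₃ e θ => ∑ c, ∑ a, ∑ b,
      ξ₁ (s (θ c)) * ξ₂ (s (θ a)) * ξ₃ (s (θ b)) * T v₁ v₂ v₃ * T (e c) (e a) (e b))
      ?_ ?_ fun v₃ ξ₃ =>
    h.sum_invariant h' (fun v₄ ξ₄ e θ => ∑ a, ∑ b,
      ξ₁ (s ξ₄) * ξ₂ (s (θ a)) * ξ₃ (s (θ b)) * T v₁ v₂ v₃ * T v₄ (e a) (e b))
      ?_ ?_ fun v₄ ξ₄ =>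
    h.sum_invariant h' (fun v₅ ξ₅ e θ => ∑ b,
      ξ₁ (s ξ₄) * ξ₂ (s ξ₅) * ξ₃ (s (θ b)) * T v₁ v₂ v₃ * T v₄ v₅ (e b))
      ?_ ?_ fun v₅ ξ₅ =>
    h.sum_invariant h' (fun v₆ ξ₆ e θ =>
      ξ₁ (s ξ₄) * ξ₂ (s ξ₅) * ξ₃ (s ξ₆) * T v₁ v₂ v₃ * T v₄ v₅ v₆) ?_ ?_ fun v₆ ξ₆ => rfl
  all_goals
    intro _
    repeat' first
      | refine isLinearMap_sum fun _ => ?_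
      | refine isLinearMap_const_mul _ ?_
      | refine isLinearMap_mul_const ?_ _
      | exact ⟨by simp, by simp⟩

lemma IsFrame.V_invariant (h : IsFrame e θ) (h' : IsFrame e' θ')
    (s : (E n →L[ℝ] ℝ) →ₗ[ℝ] E n) (Γ : E n →ₗ[ℝ] E n →ₗ[ℝ] E n) (α : E n →L[ℝ] ℝ) :
    ∑ k, (∑ i, ∑ j, θ i (s (θ j)) * θ k (Γ (e i) (e j))
        - ∑ i, ∑ j, θ i (s (θ k)) * θ j (Γ (e j) (e i))) * α (e k)
      = ∑ k, (∑ i, ∑ j, θ' i (s (θ' j)) * θ' k (Γ (e' i) (e' j))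
        - ∑ i, ∑ j, θ' i (s (θ' k)) * θ' j (Γ (e' j) (e' i))) * α (e' k) := by
  refine h.sum_invariant h' (fun v ξ e θ => (∑ i, ∑ j, θ i (s (θ j)) * ξ (Γ (e i) (e j))
        - ∑ i, ∑ j, θ i (s ξ) * θ j (Γ (e j) (e i))) * α v) ?_ ?_ fun v ξ =>
    congrArg (· * α v) (congrArg₂ (· - ·) ?_ ?_)
  rotate_left 2
  · exact h.contract_metric_eq h' s (fun v w => ξ (Γ v w)) (fun _ => ⟨by simp, by simp⟩)
      fun _ => ⟨by simp, by simp⟩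
  · refine h.sum_invariant h' (fun v₁ ξ₁ e θ => ∑ j, ξ₁ (s ξ) * θ j (Γ (e j) v₁)) ?_ ?_
      fun v₁ ξ₁ =>
      h.sum_invariant h' (fun v₂ ξ₂ e θ => ξ₁ (s ξ) * ξ₂ (Γ v₂ v₁)) ?_ ?_ fun v₂ ξ₂ => rfl
    all_goals
      intro _
      repeat' first
        | refine isLinearMap_sum fun _ => ?_
        | refine isLinearMap_const_mul _ ?_
        | refine isLinearMap_mul_const ?_ _
        | exact ⟨by simp, by simp⟩
  all_goals
    intro _
    repeat' first
      | refine isLinearMap_sum fun _ => ?_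
      | refine isLinearMap_const_mul _ ?_
      | refine isLinearMap_mul_const ?_ _
      | refine isLinearMap_sub ?_ ?_
      | exact ⟨by simp, by simp⟩

/-- Only the multilinearity of `s`, `Γ` and `P` enters. The Ricci term of `F` is left out here,
since its tensoriality needs an analytic argument. -/
lemma IsFrame.F_invariant (h : IsFrame e θ) (h' : IsFrame e' θ')
    (s : (E n →L[ℝ] ℝ) →ₗ[ℝ] E n) (Γ : E n →ₗ[ℝ] E n →ₗ[ℝ] E n)
    (P : E n →ₗ[ℝ] (E n →L[ℝ] ℝ) →ₗ[ℝ] (E n →L[ℝ] ℝ) →ₗ[ℝ] ℝ) :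
    - ∑ k, ∑ i, ∑ j, P (e k) (θ i) (θ j) * θ k (Γ (e i) (e j))
      + ∑ k, ∑ i, ∑ j, P (e k) (θ i) (θ k) * θ j (Γ (e j) (e i))
      + ∑ i, ∑ j, θ i (s (θ j)) * ∑ k, ∑ l, (θ k (Γ (e k) (e l)) * θ l (Γ (e i) (e j))
        - θ k (Γ (e j) (e l)) * θ l (Γ (e i) (e k)))
      = - ∑ k, ∑ i, ∑ j, P (e' k) (θ' i) (θ' j) * θ' k (Γ (e' i) (e' j))
      + ∑ k, ∑ i, ∑ j, P (e' k) (θ' i) (θ' k) * θ' j (Γ (e' j) (e' i))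
      + ∑ i, ∑ j, θ' i (s (θ' j)) * ∑ k, ∑ l, (θ' k (Γ (e' k) (e' l)) * θ' l (Γ (e' i) (e' j))
        - θ' k (Γ (e' j) (e' l)) * θ' l (Γ (e' i) (e' k))) := by
  -- The inner double trace is made frame independent with the two outer vectors frozen; afterwards
  -- it is a fixed bilinear form to be contracted with the metric.
  have key : ∀ v₁ v₂ : E n, ∑ k, ∑ l, (θ k (Γ (e k) (e l)) * θ l (Γ v₁ v₂)
        - θ k (Γ v₂ (e l)) * θ l (Γ v₁ (e k))) = ∑ k, ∑ l, (θ' k (Γ (e' k) (e' l)) * θ' l (Γ v₁ v₂)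
        - θ' k (Γ v₂ (e' l)) * θ' l (Γ v₁ (e' k))) := by
    intro v₁ v₂
    refine h.sum_invariant h' (fun v₃ ξ₃ e θ => ∑ l, (ξ₃ (Γ v₃ (e l)) * θ l (Γ v₁ v₂)
        - ξ₃ (Γ v₂ (e l)) * θ l (Γ v₁ v₃))) ?_ ?_ fun v₃ ξ₃ =>
      h.sum_invariant h' (fun v₄ ξ₄ e θ => (ξ₃ (Γ v₃ v₄) * ξ₄ (Γ v₁ v₂)
        - ξ₃ (Γ v₂ v₄) * ξ₄ (Γ v₁ v₃))) ?_ ?_ fun v₃ ξ₃ => rfl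
    all_goals
      intro _
      repeat' first
        | refine isLinearMap_sum fun _ => ?_
        | refine isLinearMap_const_mul _ ?_
        | refine isLinearMap_mul_const ?_ _
        | refine isLinearMap_sub ?_ ?_
        | exact ⟨by simp, by simp⟩
  refine congrArg₂ (· + ·) (congrArg₂ (fun a b => -a + b) ?_ ?_) ?_
  · refine h.sum_invariant h' (fun v₁ ξ₁ e θ => ∑ i, ∑ j, P v₁ (θ i) (θ j) * ξ₁ (Γ (e i) (e j)))
        ?_ ?_ fun v₁ ξ₁ =>
      h.sum_invariant h' (fun v₂ ξ₂ e θ => ∑ j, P v₁ ξ₂ (θ j) * ξ₁ (Γ v₂ (e j)))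
        ?_ ?_ fun v₂ ξ₂ =>
      h.sum_invariant h' (fun v₃ ξ₃ e θ => P v₁ ξ₂ ξ₃ * ξ₁ (Γ v₂ v₃)) ?_ ?_ fun v₃ ξ₃ => rfl
    all_goals
      intro _
      repeat' first
        | refine isLinearMap_sum fun _ => ?_
        | refine isLinearMap_const_mul _ ?_
        | refine isLinearMap_mul_const ?_ _
        | exact ⟨by simp, by simp⟩
  · refine h.sum_invariant h' (fun v₁ ξ₁ e θ => ∑ i, ∑ j, P v₁ (θ i) ξ₁ * θ j (Γ (e j) (e i)))
        ?_ ?_ fun v₁ ξ₁ =>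
      h.sum_invariant h' (fun v₂ ξ₂ e θ => ∑ j, P v₁ ξ₂ ξ₁ * θ j (Γ (e j) v₂))
        ?_ ?_ fun v₂ ξ₂ =>
      h.sum_invariant h' (fun v₃ ξ₃ e θ => P v₁ ξ₂ ξ₁ * ξ₃ (Γ v₃ v₂)) ?_ ?_ fun v₃ ξ₃ => rfl
    all_goals
      intro _
      repeat' first
        | refine isLinearMap_sum fun _ => ?_
        | refine isLinearMap_const_mul _ ?_
        | refine isLinearMap_mul_const ?_ _
        | exact ⟨by simp, by simp⟩
  · simp only [key]
    refine h.contract_metric_eq h' s (fun v w => ∑ k, ∑ l, (θ' k (Γ (e' k) (e' l)) * θ' l (Γ v w)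
        - θ' k (Γ w (e' l)) * θ' l (Γ v (e' k)))) ?_ ?_
    all_goals
      intro _
      repeat' first
        | refine isLinearMap_sum fun _ => ?_
        | refine isLinearMap_const_mul _ ?_
        | refine isLinearMap_mul_const ?_ _
        | refine isLinearMap_sub ?_ ?_
        | exact ⟨by simp, by simp⟩

end Invariants

/-! ### Transition maps and coordinate frames. -/

section Transition

variable {n : ℕ} {M : Type*} [TopologicalSpace M]

/-- The transition map between two charts. -/
def transition (φ φ' : OpenPartialHomeomorph M (E n)) (z : E n) : E n := φ (φ'.symm z)

/-- The open set where the transition map is defined. -/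
def overlap (φ φ' : OpenPartialHomeomorph M (E n)) : Set (E n) := φ'.target ∩ φ'.symm ⁻¹' φ.source

lemma isOpen_overlap {φ φ' : OpenPartialHomeomorph M (E n)} : IsOpen (overlap φ φ') :=
  φ'.symm.isOpen_inter_preimage φ.open_source

lemma symm_transition {φ φ' : OpenPartialHomeomorph M (E n)} {z : E n} (hz : z ∈ overlap φ φ') :
    φ.symm (transition φ φ' z) = φ'.symm z := φ.left_inv hz.2

lemma transition_mem {φ φ' : OpenPartialHomeomorph M (E n)} {z : E n} (hz : z ∈ overlap φ φ') : transition φ φ' z ∈ φ.target :=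
  φ.map_source hz.2

end Transition

section Frames

variable {n : ℕ} {M : Type*} [TopologicalSpace M] [ChartedSpace (E n) M]

/-- A `(0,2)`-tensor field, with the tangent spaces identified with `ℝⁿ`. -/
def bil (S : Tensor2 n M) (x : M) : E n →L[ℝ] E n →L[ℝ] ℝ := S x

/-- A `(0,3)`-tensor field, with the tangent spaces identified with `ℝⁿ`. -/
def tri (T : Tensor3 n M) (x : M) : E n →ₗ[ℝ] E n →ₗ[ℝ] E n →ₗ[ℝ] ℝ := T x

/-- A `(2,1)`-tensor field, with the tangent spaces identified with `ℝⁿ`. -/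
def tri21 (P : Tensor21 n M) (x : M) :
    E n →ₗ[ℝ] (E n →L[ℝ] ℝ) →ₗ[ℝ] (E n →L[ℝ] ℝ) →ₗ[ℝ] ℝ := P x

/-- A covector field, with the tangent spaces identified with `ℝⁿ`. -/
def covec (α : Covector n M) (x : M) : E n →L[ℝ] ℝ := α x

/-- The differential of the inverse of a chart, as a map of `ℝⁿ`. -/
def frameMap (φ : OpenPartialHomeomorph M (E n)) (z : E n) : E n →L[ℝ] E n :=
  mfderiv (𝓡 n) (𝓡 n) φ.symm z

/-- The differential of a chart, as a map of `ℝⁿ`. -/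
def coframeMap (φ : OpenPartialHomeomorph M (E n)) (z : E n) : E n →L[ℝ] E n :=
  mfderiv (𝓡 n) (𝓡 n) φ (φ.symm z)

/-- The coordinate frame, as vectors of `ℝⁿ`. -/
def frm (φ : OpenPartialHomeomorph M (E n)) (z : E n) (k : Fin n) : E n :=
  frameMap φ z (EuclideanSpace.single k (1 : ℝ))

/-- The coordinate coframe, as covectors on `ℝⁿ`. -/
def cofrm (φ : OpenPartialHomeomorph M (E n)) (z : E n) (k : Fin n) : E n →L[ℝ] ℝ :=
  (EuclideanSpace.proj k : E n →L[ℝ] ℝ).comp (coframeMap φ z)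

lemma gram_eq (φ : OpenPartialHomeomorph M (E n)) (S : Tensor2 n M) (z : E n) :
    gram φ S z = gramOf (bil S (φ.symm z)) (frm φ z) := rfl

lemma gram_apply (φ : OpenPartialHomeomorph M (E n)) (S : Tensor2 n M) (z : E n) (i j : Fin n) :
    gram φ S z i j = bil S (φ.symm z) (frm φ z i) (frm φ z j) := rfl

lemma comp3_eq (φ : OpenPartialHomeomorph M (E n)) (T : Tensor3 n M) (z : E n) (k i j : Fin n) :
    comp3 φ T z k i j = tri T (φ.symm z) (frm φ z k) (frm φ z i) (frm φ z j) := rfl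

lemma comp21_eq (φ : OpenPartialHomeomorph M (E n)) (P : Tensor21 n M) (z : E n)
    (k i j : Fin n) :
    comp21 φ P z k i j = tri21 P (φ.symm z) (frm φ z k) (cofrm φ z i) (cofrm φ z j) := rfl

lemma comp1_eq (φ : OpenPartialHomeomorph M (E n)) (α : Covector n M) (z : E n) (k : Fin n) :
    comp1 φ α z k = covec α (φ.symm z) (frm φ z k) := rfl

variable [IsManifold (𝓡 n) ∞ M] {φ φ' : OpenPartialHomeomorph M (E n)}

lemma coframeMap_comp_frameMap (hφ : φ ∈ atlas (E n) M) {z : E n} (hz : z ∈ φ.target) :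
    (coframeMap φ z).comp (frameMap φ z) = ContinuousLinearMap.id ℝ (E n) :=
  (mdifferentiable_of_mem_atlas (I := 𝓡 n) hφ).comp_symm_deriv hz

lemma frameMap_comp_coframeMap (hφ : φ ∈ atlas (E n) M) {z : E n} (hz : z ∈ φ.target) :
    (frameMap φ z).comp (coframeMap φ z) = ContinuousLinearMap.id ℝ (E n) := by
  have := (mdifferentiable_of_mem_atlas (I := 𝓡 n) hφ).symm_comp_deriv (φ.map_target hz)
  rw [φ.right_inv hz] at this
  exact this

lemma sum_smul_single (v : E n) : ∑ k, v k • EuclideanSpace.single k (1 : ℝ) = v := by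
  ext i; simp [Finset.sum_apply, Pi.single_apply]

lemma map_eq_sum_single {F : Type*} [AddCommGroup F] [Module ℝ F] [TopologicalSpace F]
    (f : E n →L[ℝ] F) (v : E n) :
    f v = ∑ k, v k • f (EuclideanSpace.single k (1 : ℝ)) := by
  conv_lhs => rw [← sum_smul_single v]
  simp

lemma isFrame_frm (hφ : φ ∈ atlas (E n) M) {z : E n} (hz : z ∈ φ.target) :
    IsFrame (frm φ z) (cofrm φ z) where
  dual i j := by
    have := DFunLike.congr_fun (coframeMap_comp_frameMap hφ hz) (EuclideanSpace.single j (1 : ℝ))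
    simp only [ContinuousLinearMap.comp_apply, ContinuousLinearMap.id_apply] at this
    simp [frm, cofrm, this]
  expand v := by
    have := DFunLike.congr_fun (frameMap_comp_coframeMap hφ hz) v
    simp only [ContinuousLinearMap.comp_apply, ContinuousLinearMap.id_apply] at this
    conv_rhs => rw [← this, map_eq_sum_single (frameMap φ z)]
    rfl

lemma contDiffOn_transition (hφ : φ ∈ atlas (E n) M) (hφ' : φ' ∈ atlas (E n) M) :
    ContDiffOn ℝ ∞ (transition φ φ') (overlap φ φ') := by
  have := (contDiffGroupoid ∞ (𝓡 n)).compatible hφ' hφ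
  rw [contDiffGroupoid, mem_groupoid_of_pregroupoid] at this
  have h1 := this.1
  simp only [contDiffPregroupoid] at h1
  refine (h1.congr ?_).mono ?_ <;> simp [transition, overlap]

/-- Chain rule for `φ'.symm = φ.symm ∘ transition φ φ'`, an identity valid near `z`. -/
lemma frameMap_eq_comp (hφ : φ ∈ atlas (E n) M) (hφ' : φ' ∈ atlas (E n) M) {z : E n}
    (hz : z ∈ overlap φ φ') :
    frameMap φ' z = (frameMap φ (transition φ φ' z)).comp (fderiv ℝ (transition φ φ') z) := by
  have ht : φ'.symm z ∈ φ.source := hz.2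
  have h1 : MDifferentiableAt (𝓡 n) (𝓡 n) φ.symm (transition φ φ' z) :=
    mdifferentiableAt_atlas_symm hφ (φ.map_source ht)
  have h2 : DifferentiableAt ℝ (transition φ φ') z :=
    ((contDiffOn_transition hφ hφ').contDiffAt (isOpen_overlap.mem_nhds hz)).differentiableAt
      (by simp)
  have h3 : φ'.symm =ᶠ[𝓝 z] φ.symm ∘ transition φ φ' := by
    filter_upwards [isOpen_overlap.mem_nhds hz] with w hw
    exact (φ.left_inv hw.2).symm
  have h4 := mfderiv_comp (I := 𝓡 n) (I' := 𝓡 n) (I'' := 𝓡 n) z h1 h2.mdifferentiableAt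
  rw [← mfderiv_eq_fderiv]
  rw [← h3.mfderiv_eq] at h4
  exact h4

end Frames

/-! ### Chart independence of norms, volume ratio and curvature integrand. -/

section ChartInvariance

variable {n : ℕ} {M : Type*} [TopologicalSpace M] [ChartedSpace (E n) M]

/-- A tensor field of positive definite symmetric bilinear forms. -/
structure IsMetric (g : Tensor2 n M) : Prop where
  symm : ∀ x v w, bil g x v w = bil g x w v
  pos : ∀ x v, v ≠ 0 → 0 < bil g x v v

/-- A function given in charts which does not depend on the chart. -/
def ChartInvariant (f : OpenPartialHomeomorph M (E n) → E n → ℝ) : Prop :=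
  ∀ φ ∈ atlas (E n) M, ∀ φ' ∈ atlas (E n) M, ∀ z ∈ φ.target, ∀ z' ∈ φ'.target,
    φ.symm z = φ'.symm z' → f φ z = f φ' z'

/-- Frees the pointwise definitions from the preferred chart: they can then be computed in any chart
of the atlas around the point. -/
lemma ChartInvariant.atPoint_eq {f : OpenPartialHomeomorph M (E n) → E n → ℝ}
    (hf : ChartInvariant f) {φ : OpenPartialHomeomorph M (E n)} (hφ : φ ∈ atlas (E n) M)
    {z : E n} (hz : z ∈ φ.target) : atPoint f (φ.symm z) = f φ z :=
  hf _ (chart_mem_atlas _ _) _ hφ _ (mem_chart_target _ _) _ hz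
    ((chartAt (E n) (φ.symm z)).left_inv (mem_chart_source _ _))

lemma IsMetric.exists_isSharp {g : Tensor2 n M} (hg : IsMetric g) (x : M) :
    ∃ s, IsSharp (bil g x) s :=
  WeakScalar.exists_isSharp (hg.symm x) (hg.pos x)

variable [IsManifold (𝓡 n) ∞ M]

/-- A single raising map at the common point computes the inverse Gram matrices of both charts, so
the two sums are one full contraction written in two frames. The same pattern serves the 3-tensor
norm, the gradient norm, `V` and `F`. -/
lemma chartInvariant_norm2 {h : Tensor2 n M} (hh : IsMetric h) (S : Tensor2 n M) :
    ChartInvariant fun φ z => √(∑ i, ∑ j, ∑ a, ∑ b,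
      (gram φ h z)⁻¹ i a * (gram φ h z)⁻¹ j b * gram φ S z i j * gram φ S z a b) := by
  intro φ hφ φ' hφ' z hz z' hz' hx
  obtain ⟨s, hs⟩ := hh.exists_isSharp (φ.symm z)
  have hs' := hs
  rw [hx] at hs'
  simp only [gram_eq, hs.inv_gramOf (isFrame_frm hφ hz), hs'.inv_gramOf (isFrame_frm hφ' hz')]
  rw [hx]
  exact congrArg _ ((isFrame_frm hφ hz).norm2_invariant (isFrame_frm hφ' hz') s _)

lemma chartInvariant_norm3 {h : Tensor2 n M} (hh : IsMetric h) (T : Tensor3 n M) :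
    ChartInvariant fun φ z => √(∑ k, ∑ i, ∑ j, ∑ c, ∑ a, ∑ b,
      (gram φ h z)⁻¹ k c * (gram φ h z)⁻¹ i a * (gram φ h z)⁻¹ j b
        * comp3 φ T z k i j * comp3 φ T z c a b) := by
  intro φ hφ φ' hφ' z hz z' hz' hx
  obtain ⟨s, hs⟩ := hh.exists_isSharp (φ.symm z)
  have hs' := hs
  rw [hx] at hs'
  simp only [gram_eq, comp3_eq, hs.inv_gramOf (isFrame_frm hφ hz),
    hs'.inv_gramOf (isFrame_frm hφ' hz')]
  rw [hx]
  exact congrArg _ ((isFrame_frm hφ hz).norm3_invariant (isFrame_frm hφ' hz') s _)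

/-- The differential of a function, as a covector field. -/
def dif (u : M → ℝ) (x : M) : E n →L[ℝ] ℝ := mfderiv (𝓡 n) 𝓘(ℝ, ℝ) u x

lemma pd_comp_symm {φ : OpenPartialHomeomorph M (E n)} (hφ : φ ∈ atlas (E n) M)
    {u : M → ℝ} (hu : ContMDiff (𝓡 n) 𝓘(ℝ, ℝ) ∞ u) {z : E n} (hz : z ∈ φ.target) (k : Fin n) :
    pd k (u ∘ φ.symm) z = dif u (φ.symm z) (frm φ z k) := by
  have h1 := mfderiv_comp z (hu.mdifferentiableAt (by simp))
    (mdifferentiableAt_atlas_symm (I := 𝓡 n) hφ hz)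
  rw [mfderiv_eq_fderiv] at h1
  exact congrArg (fun f : E n →L[ℝ] ℝ => f (EuclideanSpace.single k 1)) h1

lemma chartInvariant_normGrad {h : Tensor2 n M} (hh : IsMetric h) {u : M → ℝ}
    (hu : ContMDiff (𝓡 n) 𝓘(ℝ, ℝ) ∞ u) :
    ChartInvariant fun φ z => √(∑ i, ∑ j,
      (gram φ h z)⁻¹ i j * pd i (u ∘ φ.symm) z * pd j (u ∘ φ.symm) z) := by
  intro φ hφ φ' hφ' z hz z' hz' hx
  obtain ⟨s, hs⟩ := hh.exists_isSharp (φ.symm z)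
  have hs' := hs
  rw [hx] at hs'
  simp only [gram_eq, pd_comp_symm hφ hu hz, pd_comp_symm hφ' hu hz',
    hs.inv_gramOf (isFrame_frm hφ hz), hs'.inv_gramOf (isFrame_frm hφ' hz'), mul_assoc]
  rw [hx]
  exact congrArg _ ((isFrame_frm hφ hz).contract_metric_eq (isFrame_frm hφ' hz') s
    (fun v w => dif (n := n) u (φ'.symm z') v * dif u (φ'.symm z') w)
    (fun _ => isLinearMap_mul_const ⟨by simp, by simp⟩ _)
    (fun _ => isLinearMap_const_mul _ ⟨by simp, by simp⟩))

lemma IsFrame.gramOf_eq {e e' : Fin n → E n} {θ : Fin n → (E n →L[ℝ] ℝ)} (h : IsFrame e θ)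
    (B : E n →L[ℝ] E n →L[ℝ] ℝ) :
    gramOf B e' = (Matrix.of fun i j => θ i (e' j)).transpose * gramOf B e
      * Matrix.of fun i j => θ i (e' j) := by
  ext i j
  simp only [gramOf, Matrix.mul_apply, Matrix.transpose_apply, Matrix.of_apply, Finset.sum_mul]
  rw [Finset.sum_comm]
  have h1 := h.map_expand (isLinearMap_coe (B.flip (e' j)).toLinearMap) (e' i)
  simp only [ContinuousLinearMap.coe_coe, ContinuousLinearMap.flip_apply] at h1
  rw [← h1]
  refine Finset.sum_congr rfl fun k _ => ?_
  have h2 := h.map_expand (isLinearMap_coe (B (e k)).toLinearMap) (e' j)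
  simp only [ContinuousLinearMap.coe_coe] at h2
  rw [← h2, Finset.mul_sum]
  exact Finset.sum_congr rfl fun l _ => by ring

lemma posDef_gram {g : Tensor2 n M} (hg : IsMetric g) {φ : OpenPartialHomeomorph M (E n)}
    (hφ : φ ∈ atlas (E n) M) {z : E n} (hz : z ∈ φ.target) : (gram φ g z).PosDef := by
  have hF := isFrame_frm hφ hz
  refine Matrix.PosDef.of_dotProduct_mulVec_pos ?_ fun v hv => ?_
  · ext i j
    simp [gram_apply, hg.symm _ (frm φ z j)]
  · have : star v ⬝ᵥ (gram φ g z).mulVec v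
        = bil g (φ.symm z) (∑ i, v i • frm φ z i) (∑ i, v i • frm φ z i) := by
      simp only [dotProduct, Matrix.mulVec, gram_apply, map_sum, map_smul,
        sum_apply, smul_apply, Pi.star_apply,
        star_trivial, smul_eq_mul, Finset.mul_sum]
      rw [Finset.sum_comm]
      exact Finset.sum_congr rfl fun _ _ => Finset.sum_congr rfl fun _ _ => by ring
    rw [this]
    refine hg.pos _ _ fun h0 => hv ?_
    ext k
    have := congrArg (cofrm φ z k) h0
    simpa [hF.dual] using this

lemma det_gram_pos {g : Tensor2 n M} (hg : IsMetric g) {φ : OpenPartialHomeomorph M (E n)}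
    (hφ : φ ∈ atlas (E n) M) {z : E n} (hz : z ∈ φ.target) : 0 < (gram φ g z).det :=
  (posDef_gram hg hφ hz).det_pos

/-- Both determinants acquire the same factor, the square of the determinant of the change of frame,
and it cancels in the quotient. The factor is nonzero because `det h` is positive. -/
lemma chartInvariant_volRatio {h : Tensor2 n M} (hh : IsMetric h) (g : Tensor2 n M) :
    ChartInvariant fun φ z => √((gram φ g z).det / (gram φ h z).det) := by
  intro φ hφ φ' hφ' z hz z' hz' hx
  have h1 := (isFrame_frm hφ hz).gramOf_eq (e' := frm φ' z') (bil g (φ'.symm z'))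
  have h2 := (isFrame_frm hφ hz).gramOf_eq (e' := frm φ' z') (bil h (φ'.symm z'))
  have h3 := (det_gram_pos hh hφ' hz').ne'
  simp only [gram_eq] at h3 ⊢
  rw [h2] at h3
  rw [h1, h2, hx]
  simp only [Matrix.det_mul, Matrix.det_transpose] at h3 ⊢
  have h4 : (Matrix.of fun i j => cofrm φ z i (frm φ' z' j)).det ≠ 0 := by
    intro h0
    simp [h0] at h3
  rw [mul_right_comm, mul_right_comm _ (gramOf (bil h _) _).det, mul_div_mul_left _ _
    (mul_ne_zero h4 h4)]

lemma Gam_eq {h g : Tensor2 n M} {φ : OpenPartialHomeomorph M (E n)} (hφ : φ ∈ atlas (E n) M)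
    {z : E n} (hz : z ∈ φ.target) {s : (E n →L[ℝ] ℝ) →ₗ[ℝ] E n} (hs : IsSharp (bil g (φ.symm z)) s)
    (k i j : Fin n) :
    Gam φ h g k i j z
      = cofrm φ z k (upGam s (tri (weakCovDeriv h g) (φ.symm z)) (frm φ z i) (frm φ z j)) := by
  have hF := isFrame_frm hφ hz
  have := hF.map_coexpand (f := fun ξ => cofrm φ z k (s ξ)) ⟨by simp, by simp⟩
    (lowGam (tri (weakCovDeriv h g) (φ.symm z)) (frm φ z i) (frm φ z j))
  rw [upGam_apply, ← this, Gam, Finset.mul_sum]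
  refine Finset.sum_congr rfl fun l _ => ?_
  rw [gram_eq, hs.inv_gramOf hF, lowGam_apply]
  simp only [comp3_eq]
  ring

lemma chartInvariant_V {g : Tensor2 n M} (hg : IsMetric g) (h : Tensor2 n M)
    (α : Covector n M) :
    ChartInvariant fun φ z => -∑ k, V φ h g k z * comp1 φ α z k := by
  intro φ hφ φ' hφ' z hz z' hz' hx
  obtain ⟨s, hs⟩ := hg.exists_isSharp (φ.symm z)
  have hs' := hs
  rw [hx] at hs'
  simp only [V, comp1_eq, gram_eq, Gam_eq hφ hz hs, Gam_eq hφ' hz' hs',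
    hs.inv_gramOf (isFrame_frm hφ hz), hs'.inv_gramOf (isFrame_frm hφ' hz')]
  rw [hx]
  exact congrArg _ ((isFrame_frm hφ hz).V_invariant (isFrame_frm hφ' hz') s _ _)

/-- The Ricci components involve derivatives of the coordinate expression of `h`, so their
tensoriality is not a matter of algebra. It is isolated as `hR`, which `ricci_transition` later
supplies. -/
lemma chartInvariant_F {h g : Tensor2 n M} (hg : IsMetric g)
    (hR : ∀ φ ∈ atlas (E n) M, ∀ φ' ∈ atlas (E n) M, ∀ z ∈ φ.target, ∀ z' ∈ φ'.target,
      φ.symm z = φ'.symm z' → ∃ R : E n →ₗ[ℝ] E n →ₗ[ℝ] ℝ,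
      ∀ i j, ricci φ h i j z = R (frm φ z i) (frm φ z j) ∧
        ricci φ' h i j z' = R (frm φ' z' i) (frm φ' z' j)) :
    ChartInvariant fun φ z => F φ h g z := by
  intro φ hφ φ' hφ' z hz z' hz' hx
  obtain ⟨s, hs⟩ := hg.exists_isSharp (φ.symm z)
  have hs' := hs
  rw [hx] at hs'
  obtain ⟨R, hR⟩ := hR φ hφ φ' hφ' z hz z' hz' hx
  simp only [F, comp21_eq, gram_eq, Gam_eq hφ hz hs, Gam_eq hφ' hz' hs', fun i j => (hR i j).1,
    fun i j => (hR i j).2,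
    hs.inv_gramOf (isFrame_frm hφ hz), hs'.inv_gramOf (isFrame_frm hφ' hz')]
  rw [hx]
  have h1 := (isFrame_frm hφ hz).contract_metric_eq (isFrame_frm hφ' hz') s
    (fun v w => R v w) (fun _ => ⟨by simp, by simp⟩) fun _ => ⟨by simp, by simp⟩
  have h2 := (isFrame_frm hφ hz).F_invariant (isFrame_frm hφ' hz') s
    (upGam s (tri (weakCovDeriv h g) (φ'.symm z'))) (tri21 (weakCovDerivInv h g) (φ'.symm z'))
  linarith

end ChartInvariance

/-! ### Smoothness of metric components in charts. -/

section Smoothness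

variable {n : ℕ} {M : Type*} [TopologicalSpace M] [ChartedSpace (E n) M]
  [IsManifold (𝓡 n) ∞ M] {φ : OpenPartialHomeomorph M (E n)}

/-- The coordinate frame is the tangent map of `φ.symm` applied to a constant vector field, so its
smoothness is that of a tangent map. -/
lemma contMDiffOn_frm (hφ : φ ∈ atlas (E n) M) (k : Fin n) :
    ContMDiffOn (𝓡 n) (𝓡 n).tangent ∞
      (fun z => (Bundle.TotalSpace.mk' (E n) (φ.symm z) (frm φ z k) :
        Bundle.TotalSpace (E n) (TangentSpace (𝓡 n) : M → Type _))) φ.target := by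
  have h1 : ContMDiffOn (𝓡 n) (𝓡 n) ∞ φ.symm φ.target :=
    contMDiffOn_symm_of_mem_maximalAtlas (IsManifold.subset_maximalAtlas hφ)
  have h2 := h1.contMDiffOn_tangentMapWithin (m := ∞) (by simp) φ.open_target.uniqueMDiffOn
  have h3 := contMDiff_vectorSpace_iff_contDiff (𝕜 := ℝ) (E := E n) (n := ∞)
    (V := fun z : E n => (EuclideanSpace.single k (1 : ℝ) : E n)).2 contDiff_const
  refine (h2.comp h3.contMDiffOn (fun z hz => hz)).congr fun z hz => ?_
  simp only [Function.comp, tangentMapWithin]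
  rw [mfderivWithin_of_isOpen φ.open_target hz]
  rfl

lemma contDiffOn_gram_apply (hφ : φ ∈ atlas (E n) M) (S : SmoothMetric n M) (i j : Fin n) :
    ContDiffOn ℝ ∞ (fun z => gram φ S.inner z i j) φ.target := by
  have h1 : ContMDiffOn (𝓡 n) (𝓡 n) ∞ φ.symm φ.target :=
    contMDiffOn_symm_of_mem_maximalAtlas (IsManifold.subset_maximalAtlas hφ)
  have h2 := S.contMDiff.comp_contMDiffOn h1
  have h3 := ContMDiffOn.clm_bundle_apply₂ (F₁ := E n) (F₂ := E n) (F₃ := ℝ)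
    (E₃ := Bundle.Trivial M ℝ) h2 (contMDiffOn_frm hφ i) (contMDiffOn_frm hφ j)
  rw [← contMDiffOn_iff_contDiffOn]
  intro z hz
  exact ((Bundle.contMDiffWithinAt_totalSpace).1 (h3 z hz)).2

lemma continuousOn_gram_apply (hφ : φ ∈ atlas (E n) M) (S : ContMetric n M) (i j : Fin n) :
    ContinuousOn (fun z => gram φ S.inner z i j) φ.target := by
  have h1 : ContMDiffOn (𝓡 n) (𝓡 n) 0 φ.symm φ.target :=
    (contMDiffOn_symm_of_mem_maximalAtlas (n := ∞) (IsManifold.subset_maximalAtlas hφ)).of_le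
      (by simp)
  have h0 : ContMDiff (𝓡 n) ((𝓡 n).prod 𝓘(ℝ, E n →L[ℝ] E n →L[ℝ] ℝ)) 0
    (fun b : M ↦ Bundle.TotalSpace.mk' (E n →L[ℝ] E n →L[ℝ] ℝ)
      (E := fun x : M => TangentSpace (𝓡 n) x →L[ℝ] TangentSpace (𝓡 n) x →L[ℝ] ℝ) b (S.inner b)) :=
    contMDiff_zero_iff.2 S.continuous
  have h2 := h0.comp_contMDiffOn h1
  have h3 := ContMDiffOn.clm_bundle_apply₂ (F₁ := E n) (F₂ := E n) (F₃ := ℝ)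
    (E₃ := Bundle.Trivial M ℝ) h2 ((contMDiffOn_frm hφ i).of_le (by simp))
    ((contMDiffOn_frm hφ j).of_le (by simp))
  have h4 : ContMDiffOn (𝓡 n) 𝓘(ℝ, ℝ) 0 (fun z => gram φ S.inner z i j) φ.target := fun z hz =>
    ((Bundle.contMDiffWithinAt_totalSpace).1 (h3 z hz)).2
  exact h4.continuousOn

lemma isMetric_smooth (S : SmoothMetric n M) : IsMetric S.inner := ⟨S.symm, S.pos⟩

lemma isMetric_cont (S : ContMetric n M) : IsMetric S.inner := ⟨S.symm, S.pos⟩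

end Smoothness

/-! ### Transformation laws of Christoffel symbols and curvature under coordinate changes. -/

section LocalTransformation

variable {X : Type*} [NormedAddCommGroup X] [NormedSpace ℝ X]

lemma minSmoothness_two_le : minSmoothness ℝ 2 ≤ (∞ : ℕ∞ω) := by
  rw [minSmoothness_of_isRCLikeNormedField]
  exact WithTop.coe_le_coe.2 (le_top : (2 : ℕ∞) ≤ ⊤)

lemma fderiv_apply₂ {Y Z W : Type*} [NormedAddCommGroup Y] [NormedSpace ℝ Y]
    [NormedAddCommGroup Z] [NormedSpace ℝ Z] [NormedAddCommGroup W] [NormedSpace ℝ W]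
    {G : X → Y →L[ℝ] Z →L[ℝ] W} {z : X}
    (hG : DifferentiableAt ℝ G z) (u : X) (v : Y) (w : Z) :
    fderiv ℝ (fun y => G y v w) z u = fderiv ℝ G z u v w := by
  have h := (hG.hasFDerivAt.clm_apply (hasFDerivAt_const v z)).clm_apply (hasFDerivAt_const w z)
  rw [h.fderiv]
  simp

/-- Product rule: the derivative falls on `G ∘ τ` or on one of the two factors `Dτ`, and in the
latter cases produces a second derivative of `τ`. -/
lemma fderiv_pullback {τ : X → X} {z : X} {G G' : X → X →L[ℝ] X →L[ℝ] ℝ}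
    (hτ : ContDiffAt ℝ ∞ τ z) (hG : DifferentiableAt ℝ G (τ z)) (hG' : DifferentiableAt ℝ G' z)
    (h : ∀ᶠ y in 𝓝 z, ∀ v w, G' y v w = G (τ y) (fderiv ℝ τ y v) (fderiv ℝ τ y w))
    (u v w : X) :
    fderiv ℝ G' z u v w = fderiv ℝ G (τ z) (fderiv ℝ τ z u) (fderiv ℝ τ z v) (fderiv ℝ τ z w)
      + G (τ z) (fderiv ℝ (fderiv ℝ τ) z u v) (fderiv ℝ τ z w)
      + G (τ z) (fderiv ℝ τ z v) (fderiv ℝ (fderiv ℝ τ) z u w) := by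
  have hP : DifferentiableAt ℝ (fderiv ℝ τ) z :=
    (hτ.fderiv_right (m := ∞) (by simp)).differentiableAt (by simp)
  have h1 : HasFDerivAt τ (fderiv ℝ τ z) z := (hτ.differentiableAt (by simp)).hasFDerivAt
  have h2 := hG.hasFDerivAt.comp z h1
  have h3 := (h2.clm_apply (hP.hasFDerivAt.clm_apply (hasFDerivAt_const v z))).clm_apply
    (hP.hasFDerivAt.clm_apply (hasFDerivAt_const w z))
  rw [← fderiv_apply₂ hG', Filter.EventuallyEq.fderiv_eq (h.mono fun y hy => hy v w)]
  erw [h3.fderiv]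
  simp
  ring

/-- `Γ` is the bilinear map of Christoffel symbols of the metric `G`. -/
def IsChristoffel (G : X → X →L[ℝ] X →L[ℝ] ℝ) (Γ : X → X →L[ℝ] X →L[ℝ] X) (z : X) : Prop :=
  ∀ u v w, 2 * G z (Γ z u v) w = fderiv ℝ G z u v w + fderiv ℝ G z v u w - fderiv ℝ G z w u v

/-- Insert the differentiated pullback into the Koszul formula for `G'`. By symmetry of the second
derivative of `τ`, four of the six second-order terms cancel and the other two add up to `2 G
(D²τ(u, v)) (Dτ w)`. Nondegeneracy then removes the test vector `w`. -/
lemma christoffel_transformation {τ : X → X} {z : X} {G G' : X → X →L[ℝ] X →L[ℝ] ℝ}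
    {Γ Γ' : X → X →L[ℝ] X →L[ℝ] X}
    (hτ : ContDiffAt ℝ ∞ τ z) (hG : DifferentiableAt ℝ G (τ z)) (hG' : DifferentiableAt ℝ G' z)
    (h : ∀ᶠ y in 𝓝 z, ∀ v w, G' y v w = G (τ y) (fderiv ℝ τ y v) (fderiv ℝ τ y w))
    (hsymm : ∀ v w, G (τ z) v w = G (τ z) w v)
    (hnd : ∀ v, (∀ w, G (τ z) v (fderiv ℝ τ z w) = 0) → v = 0)
    (hΓ : IsChristoffel G Γ (τ z)) (hΓ' : IsChristoffel G' Γ' z) (u v : X) :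
    fderiv ℝ τ z (Γ' z u v) = Γ (τ z) (fderiv ℝ τ z u) (fderiv ℝ τ z v)
      + fderiv ℝ (fderiv ℝ τ) z u v := by
  have hs : IsSymmSndFDerivAt ℝ τ z := hτ.isSymmSndFDerivAt minSmoothness_two_le
  rw [← sub_eq_zero]
  refine hnd _ fun w => ?_
  have h1 := hΓ' u v w
  have h2 := hΓ (fderiv ℝ τ z u) (fderiv ℝ τ z v) (fderiv ℝ τ z w)
  rw [h.self_of_nhds, fderiv_pullback hτ hG hG' h, fderiv_pullback hτ hG hG' h,
    fderiv_pullback hτ hG hG' h] at h1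
  simp only [map_sub, map_add, sub_apply, add_apply]
  have e1 := hs.eq u v
  have e2 := hs.eq u w
  have e3 := hs.eq v w
  rw [← e1, e2, e3, hsymm (fderiv ℝ τ z u)] at h1
  rw [hsymm (fderiv ℝ τ z v) (fderiv ℝ (fderiv ℝ τ) z w u)] at h1
  linarith

/-- The curvature expression `(∂_u Γ)(w, v) - (∂_v Γ)(w, u) + Γ(u, Γ(w, v)) - Γ(v, Γ(w, u))`. -/
def curv (Γ : X → X →L[ℝ] X →L[ℝ] X) (z u v w : X) : X :=
  fderiv ℝ Γ z u w v - fderiv ℝ Γ z v w u + Γ z u (Γ z w v) - Γ z v (Γ z w u)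

/-- Differentiating the law for Christoffel symbols once more expresses the third derivative of `τ`
through `Γ`, `Γ'` and lower derivatives. The third derivative is symmetric, so antisymmetrizing the
expression eliminates it, and what is left is the tensor law for the curvature. -/
lemma curv_transformation {τ : X → X} {z : X} {Γ Γ' : X → X →L[ℝ] X →L[ℝ] X}
    (hτ : ∀ᶠ y in 𝓝 z, ContDiffAt ℝ ∞ τ y) (hΓ : DifferentiableAt ℝ Γ (τ z))
    (hΓ' : DifferentiableAt ℝ Γ' z) (hsymm : ∀ v w, Γ (τ z) v w = Γ (τ z) w v)
    (h : ∀ᶠ y in 𝓝 z, ∀ u v, fderiv ℝ τ y (Γ' y u v)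
      = Γ (τ y) (fderiv ℝ τ y u) (fderiv ℝ τ y v) + fderiv ℝ (fderiv ℝ τ) y u v) (u v w : X) :
    fderiv ℝ τ z (curv Γ' z u v w)
      = curv Γ (τ z) (fderiv ℝ τ z u) (fderiv ℝ τ z v) (fderiv ℝ τ z w) := by
  have hτz := hτ.self_of_nhds
  have hP' : ContDiffAt ℝ ∞ (fderiv ℝ τ) z := hτz.fderiv_right (by simp)
  have hP : DifferentiableAt ℝ (fderiv ℝ τ) z := hP'.differentiableAt (by simp)
  have hD : DifferentiableAt ℝ (fderiv ℝ (fderiv ℝ τ)) z :=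
    (hP'.fderiv_right (m := ∞) (by simp)).differentiableAt (by simp)
  have h1 : HasFDerivAt τ (fderiv ℝ τ z) z := (hτz.differentiableAt (by simp)).hasFDerivAt
  have h2 := hΓ.hasFDerivAt.comp z h1
  have s2 : ∀ᶠ y in 𝓝 z, ∀ a b, fderiv ℝ (fderiv ℝ τ) y a b = fderiv ℝ (fderiv ℝ τ) y b a := by
    filter_upwards [hτ] with y hy a b
    exact (hy.isSymmSndFDerivAt minSmoothness_two_le).eq a b
  have s3 : ∀ a b c, fderiv ℝ (fderiv ℝ (fderiv ℝ τ)) z a b c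
      = fderiv ℝ (fderiv ℝ (fderiv ℝ τ)) z b a c := fun a b c =>
    congrArg (fun f : X →L[ℝ] X => f c) ((hP'.isSymmSndFDerivAt minSmoothness_two_le).eq a b)
  have s4 : ∀ a b c, fderiv ℝ (fderiv ℝ (fderiv ℝ τ)) z a b c
      = fderiv ℝ (fderiv ℝ (fderiv ℝ τ)) z a c b := fun a b c => by
    rw [← fderiv_apply₂ hD, ← fderiv_apply₂ hD,
      Filter.EventuallyEq.fderiv_eq (s2.mono fun y hy => hy b c)]
  have key : ∀ a b c, fderiv ℝ (fderiv ℝ (fderiv ℝ τ)) z a b c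
      = fderiv ℝ (fderiv ℝ τ) z a (Γ' z b c) + fderiv ℝ τ z (fderiv ℝ Γ' z a b c)
        - (fderiv ℝ Γ (τ z) (fderiv ℝ τ z a) (fderiv ℝ τ z b) (fderiv ℝ τ z c)
          + Γ (τ z) (fderiv ℝ (fderiv ℝ τ) z a b) (fderiv ℝ τ z c)
          + Γ (τ z) (fderiv ℝ τ z b) (fderiv ℝ (fderiv ℝ τ) z a c)) := by
    intro a b c
    have h3 := (h2.clm_apply (hP.hasFDerivAt.clm_apply (hasFDerivAt_const b z))).clm_apply
      (hP.hasFDerivAt.clm_apply (hasFDerivAt_const c z))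
    have h4 := hP.hasFDerivAt.clm_apply ((hΓ'.hasFDerivAt.clm_apply
      (hasFDerivAt_const b z)).clm_apply (hasFDerivAt_const c z))
    have h5 := h4.sub h3
    have h6 : (fun y => fderiv ℝ (fderiv ℝ τ) y b c) =ᶠ[𝓝 z] fun y =>
        fderiv ℝ τ y (Γ' y b c) - Γ (τ y) (fderiv ℝ τ y b) (fderiv ℝ τ y c) := by
      filter_upwards [h] with y hy
      rw [hy]; abel
    rw [← fderiv_apply₂ hD, h6.fderiv_eq]
    erw [h5.fderiv]
    simp
    abel
  have k1 := key u w v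
  have k2 := key v w u
  -- Equality of these two third derivatives is the integrability condition; expanding both sides by
  -- `key` gives the claim once the remaining second derivatives are removed.
  have e : fderiv ℝ (fderiv ℝ (fderiv ℝ τ)) z u w v = fderiv ℝ (fderiv ℝ (fderiv ℝ τ)) z v w u := by
    rw [s4 u w v, s3 u v w, s4 v u w]
  have t2 := fun a b => s2.self_of_nhds a b
  -- The law for Christoffel symbols is read backwards to replace the second derivatives that
  -- survive by products of `Γ` and `Γ'`.
  have d : ∀ a b, fderiv ℝ (fderiv ℝ τ) z a b
      = fderiv ℝ τ z (Γ' z a b) - Γ (τ z) (fderiv ℝ τ z a) (fderiv ℝ τ z b) := fun a b => by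
    rw [h.self_of_nhds]; abel
  rw [k1, k2, t2 u w, t2 v w, t2 v u, hsymm _ (fderiv ℝ τ z v), hsymm _ (fderiv ℝ τ z u),
    d u (Γ' z w v), d v (Γ' z w u), d w u, d w v] at e
  simp only [map_sub] at e
  simp only [curv, map_sub, map_add]
  rw [← sub_eq_zero] at e ⊢
  rw [← e]
  abel

end LocalTransformation

/-! ### Smoothness of determinants and inverses; multilinear maps determined on a basis. -/

section MatrixSmoothness

variable {X : Type*} [NormedAddCommGroup X] [NormedSpace ℝ X] {m : ℕ∞ω} {s : Set X}

lemma contDiffOn_det {ι : Type*} [Fintype ι] [DecidableEq ι] {A : X → Matrix ι ι ℝ}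
    (hA : ∀ i j, ContDiffOn ℝ m (fun z => A z i j) s) : ContDiffOn ℝ m (fun z => (A z).det) s := by
  simp only [Matrix.det_apply']
  exact ContDiffOn.sum fun σ _ => contDiffOn_const.mul (contDiffOn_prod fun i _ => hA _ _)

lemma contDiffOn_inv_apply {ι : Type*} [Fintype ι] [DecidableEq ι] {A : X → Matrix ι ι ℝ}
    (hA : ∀ i j, ContDiffOn ℝ m (fun z => A z i j) s) (hdet : ∀ z ∈ s, (A z).det ≠ 0) (i j : ι) :
    ContDiffOn ℝ m (fun z => (A z)⁻¹ i j) s := by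
  simp only [Matrix.inv_def, Ring.inverse_eq_inv', Matrix.smul_apply, smul_eq_mul,
    Matrix.adjugate_apply]
  refine ((contDiffOn_det hA).inv hdet).mul (contDiffOn_det fun a b => ?_)
  simp only [Matrix.updateRow_apply]
  split_ifs
  · exact contDiffOn_const
  · exact hA a b

lemma contDiffOn_pd {n : ℕ} {Ω : Set (E n)} (hΩ : IsOpen Ω) {f : E n → ℝ}
    (hf : ContDiffOn ℝ ∞ f Ω) (k : Fin n) : ContDiffOn ℝ ∞ (pd k f) Ω :=
  (hf.fderiv_of_isOpen hΩ (m := ∞) (by simp)).clm_apply contDiffOn_const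

end MatrixSmoothness

section Extension

variable {n : ℕ}

lemma isFrame_single : IsFrame (fun k : Fin n => (EuclideanSpace.single k (1 : ℝ) : E n))
    (fun k => (EuclideanSpace.proj k : E n →L[ℝ] ℝ)) where
  dual i j := by simp
  expand v := sum_smul_single v

lemma bilinear_ext {Y : Type*} [NormedAddCommGroup Y] [NormedSpace ℝ Y]
    {A B : E n →L[ℝ] E n →L[ℝ] Y}
    (hAB : ∀ i j, A (EuclideanSpace.single i 1) (EuclideanSpace.single j 1)
      = B (EuclideanSpace.single i 1) (EuclideanSpace.single j 1)) : A = B := by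
  ext1 v
  rw [map_eq_sum_single A, map_eq_sum_single B]
  refine Finset.sum_congr rfl fun i _ => ?_
  congr 1
  ext1 w
  rw [map_eq_sum_single (A _), map_eq_sum_single (B _)]
  exact Finset.sum_congr rfl fun j _ => by rw [hAB]

lemma trilinear_ext {f g : E n → E n → E n → ℝ}
    (f1 : ∀ v w, IsLinearMap ℝ fun u => f u v w) (f2 : ∀ u w, IsLinearMap ℝ fun v => f u v w)
    (f3 : ∀ u v, IsLinearMap ℝ fun w => f u v w)
    (g1 : ∀ v w, IsLinearMap ℝ fun u => g u v w) (g2 : ∀ u w, IsLinearMap ℝ fun v => g u v w)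
    (g3 : ∀ u v, IsLinearMap ℝ fun w => g u v w)
    (hfg : ∀ i j k, f (EuclideanSpace.single i 1) (EuclideanSpace.single j 1)
      (EuclideanSpace.single k 1) = g (EuclideanSpace.single i 1) (EuclideanSpace.single j 1)
      (EuclideanSpace.single k 1)) (u v w : E n) : f u v w = g u v w := by
  have h := isFrame_single (n := n)
  rw [← h.map_expand (f1 v w) u, ← h.map_expand (g1 v w) u]
  refine Finset.sum_congr rfl fun i _ => congrArg _ ?_
  rw [← h.map_expand (f2 _ w) v, ← h.map_expand (g2 _ w) v]
  refine Finset.sum_congr rfl fun j _ => congrArg _ ?_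
  rw [← h.map_expand (f3 _ _) w, ← h.map_expand (g3 _ _) w]
  exact Finset.sum_congr rfl fun k _ => congrArg _ (hfg i j k)

end Extension

/-! ### Christoffel symbols, covariant derivative and Ricci tensor across charts. -/

section Christoffel

variable {n : ℕ} {M : Type*} [TopologicalSpace M] [ChartedSpace (E n) M]
  {φ φ' : OpenPartialHomeomorph M (E n)}

/-- The coordinate expression of a `(0,2)`-tensor field. -/
def bilMap (φ : OpenPartialHomeomorph M (E n)) (S : Tensor2 n M) (z : E n) :
    E n →L[ℝ] E n →L[ℝ] ℝ :=
  (bil S (φ.symm z)).bilinearComp (frameMap φ z) (frameMap φ z)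

/-- The Christoffel symbols of `h` as a bilinear map. -/
def chr (φ : OpenPartialHomeomorph M (E n)) (h : Tensor2 n M) (z : E n) :
    E n →L[ℝ] E n →L[ℝ] E n :=
  ∑ i, ∑ j, ∑ k, christoffel φ h k i j z • (EuclideanSpace.proj i : E n →L[ℝ] ℝ).smulRight
    ((EuclideanSpace.proj j : E n →L[ℝ] ℝ).smulRight (EuclideanSpace.single k (1 : ℝ)))

lemma bilMap_single (S : Tensor2 n M) (z : E n) (i j : Fin n) :
    bilMap φ S z (EuclideanSpace.single i 1) (EuclideanSpace.single j 1) = gram φ S z i j := rfl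

lemma bilMap_apply (S : Tensor2 n M) (z v w : E n) :
    bilMap φ S z v w = bil S (φ.symm z) (frameMap φ z v) (frameMap φ z w) := rfl

lemma chr_single (h : Tensor2 n M) (z : E n) (i j : Fin n) :
    chr φ h z (EuclideanSpace.single i 1) (EuclideanSpace.single j 1)
      = ∑ k, christoffel φ h k i j z • EuclideanSpace.single k (1 : ℝ) := by
  simp only [chr, sum_apply, smul_apply, ContinuousLinearMap.smulRight_apply,
    PiLp.proj_apply, PiLp.single_apply]
  rw [Finset.sum_eq_single i (by intro b _ hb; simp [hb]) (by simp),
    Finset.sum_eq_single j (by intro b _ hb; simp [hb]) (by simp)]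
  simp

lemma chr_single_apply (h : Tensor2 n M) (z : E n) (i j k : Fin n) :
    chr φ h z (EuclideanSpace.single i 1) (EuclideanSpace.single j 1) k
      = christoffel φ h k i j z := by
  rw [chr_single]
  simp [Pi.single_apply]

lemma bilMap_eq_sum (S : Tensor2 n M) (z : E n) :
    bilMap φ S z = ∑ i, ∑ j, gram φ S z i j • (EuclideanSpace.proj i : E n →L[ℝ] ℝ).smulRight
      (EuclideanSpace.proj j : E n →L[ℝ] ℝ) := by
  ext v w
  rw [map_eq_sum_single (bilMap φ S z) v]
  simp only [sum_apply, smul_apply, ContinuousLinearMap.smulRight_apply,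
    PiLp.proj_apply]
  refine Finset.sum_congr rfl fun i _ => ?_
  rw [map_eq_sum_single (bilMap φ S z _) w, Finset.smul_sum]
  refine Finset.sum_congr rfl fun j _ => ?_
  rw [bilMap_single]
  simp
  ring

lemma gram_symm {g : Tensor2 n M} (hg : IsMetric g) (z : E n) (i j : Fin n) :
    gram φ g z i j = gram φ g z j i := hg.symm _ _ _

lemma christoffel_symm {h : Tensor2 n M} (hh : IsMetric h) (z : E n) (k i j : Fin n) :
    christoffel φ h k i j z = christoffel φ h k j i z := by
  simp only [christoffel, gram_symm hh _ j i]
  congr 1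
  exact Finset.sum_congr rfl fun l _ => by ring

lemma chr_symm {h : Tensor2 n M} (hh : IsMetric h) (z v w : E n) :
    chr φ h z v w = chr φ h z w v := by
  have : chr φ h z = (chr φ h z).flip := bilinear_ext fun i j => by
    simp only [ContinuousLinearMap.flip_apply, chr_single, christoffel_symm hh _ _ i j]
  conv_lhs => rw [this]
  rfl

/-- The coordinate expression of the covariant derivative of a smooth `(0,2)`-tensor field. -/
def covD (φ : OpenPartialHomeomorph M (E n)) (h S : Tensor2 n M) (z u v w : E n) : ℝ :=
  fderiv ℝ (bilMap φ S) z u v w - bilMap φ S z (chr φ h z u v) w - bilMap φ S z v (chr φ h z u w)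

lemma covD_linear (φ : OpenPartialHomeomorph M (E n)) (h S : Tensor2 n M) (z : E n) :
    (∀ v w, IsLinearMap ℝ fun u => covD φ h S z u v w) ∧
    (∀ u w, IsLinearMap ℝ fun v => covD φ h S z u v w) ∧
    ∀ u v, IsLinearMap ℝ fun w => covD φ h S z u v w :=
  ⟨fun _ _ => ⟨fun a b => by simp [covD]; ring, fun c a => by simp [covD]; ring⟩,
    fun _ _ => ⟨fun a b => by simp [covD]; ring, fun c a => by simp [covD]; ring⟩,
    fun _ _ => ⟨fun a b => by simp [covD]; ring, fun c a => by simp [covD]; ring⟩⟩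

variable [IsManifold (𝓡 n) ∞ M]

lemma contDiffOn_bilMap (hφ : φ ∈ atlas (E n) M) (S : SmoothMetric n M) :
    ContDiffOn ℝ ∞ (bilMap φ S.inner) φ.target := by
  rw [show bilMap φ S.inner = _ from funext (bilMap_eq_sum S.inner)]
  exact ContDiffOn.sum fun i _ => ContDiffOn.sum fun j _ =>
    (contDiffOn_gram_apply hφ S i j).smul contDiffOn_const

lemma differentiableAt_bilMap (hφ : φ ∈ atlas (E n) M) (S : SmoothMetric n M) {z : E n}
    (hz : z ∈ φ.target) : DifferentiableAt ℝ (bilMap φ S.inner) z :=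
  ((contDiffOn_bilMap hφ S).contDiffAt (φ.open_target.mem_nhds hz)).differentiableAt (by simp)

lemma pd_gram (hφ : φ ∈ atlas (E n) M) (S : SmoothMetric n M) {z : E n} (hz : z ∈ φ.target)
    (k i j : Fin n) :
    pd k (fun w => gram φ S.inner w i j) z = fderiv ℝ (bilMap φ S.inner) z
      (EuclideanSpace.single k 1) (EuclideanSpace.single i 1) (EuclideanSpace.single j 1) := by
  rw [← fderiv_apply₂ (differentiableAt_bilMap hφ S hz)]
  rfl

lemma contDiffOn_gram_inv (hφ : φ ∈ atlas (E n) M) (S : SmoothMetric n M) (i j : Fin n) :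
    ContDiffOn ℝ ∞ (fun z => (gram φ S.inner z)⁻¹ i j) φ.target :=
  contDiffOn_inv_apply (contDiffOn_gram_apply hφ S)
    (fun _ hz => (det_gram_pos (isMetric_smooth S) hφ hz).ne') i j

lemma contDiffOn_christoffel (hφ : φ ∈ atlas (E n) M) (h : SmoothMetric n M) (k i j : Fin n) :
    ContDiffOn ℝ ∞ (christoffel φ h.inner k i j) φ.target := by
  have hp := fun a b c => contDiffOn_pd φ.open_target (contDiffOn_gram_apply hφ h b c) a
  exact contDiffOn_const.mul (ContDiffOn.sum fun l _ =>
    (contDiffOn_gram_inv hφ h k l).mul (((hp i j l).add (hp j i l)).sub (hp l i j)))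

lemma contDiffOn_chr (hφ : φ ∈ atlas (E n) M) (h : SmoothMetric n M) :
    ContDiffOn ℝ ∞ (chr φ h.inner) φ.target :=
  ContDiffOn.sum fun i _ => ContDiffOn.sum fun j _ => ContDiffOn.sum fun k _ =>
    (contDiffOn_christoffel hφ h k i j).smul contDiffOn_const

lemma differentiableAt_chr (hφ : φ ∈ atlas (E n) M) (h : SmoothMetric n M) {z : E n}
    (hz : z ∈ φ.target) : DifferentiableAt ℝ (chr φ h.inner) z :=
  ((contDiffOn_chr hφ h).contDiffAt (φ.open_target.mem_nhds hz)).differentiableAt (by simp)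

lemma sum_gram_mul_christoffel {h : Tensor2 n M} (hh : IsMetric h) (hφ : φ ∈ atlas (E n) M)
    {z : E n} (hz : z ∈ φ.target) (i j l : Fin n) :
    2 * ∑ k, gram φ h z l k * christoffel φ h k i j z
      = pd i (fun w => gram φ h w j l) z + pd j (fun w => gram φ h w i l) z
        - pd l (fun w => gram φ h w i j) z := by
  set q : Fin n → ℝ := fun l => pd i (fun w => gram φ h w j l) z + pd j (fun w => gram φ h w i l) z
        - pd l (fun w => gram φ h w i j) z with hq
  have h1 : ∀ k, christoffel φ h k i j z = (1 / 2) * ((gram φ h z)⁻¹.mulVec q) k := fun k => rfl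
  have h2 : (gram φ h z).mulVec ((gram φ h z)⁻¹.mulVec q) = q := by
    rw [Matrix.mulVec_mulVec, Matrix.mul_nonsing_inv _
      (isUnit_iff_ne_zero.2 (det_gram_pos hh hφ hz).ne'), Matrix.one_mulVec]
  have h3 := congrFun h2 l
  refine Eq.trans ?_ h3
  simp only [h1, Matrix.mulVec, dotProduct, Finset.mul_sum]
  exact Finset.sum_congr rfl fun k _ => Finset.sum_congr rfl fun _ _ => by ring

/-- By trilinearity it suffices to test basis vectors, where it is the definition of the Christoffel
symbols with the inverse matrix cleared (`sum_gram_mul_christoffel`). -/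
lemma isChristoffel_chr (hφ : φ ∈ atlas (E n) M) (h : SmoothMetric n M) {z : E n}
    (hz : z ∈ φ.target) : IsChristoffel (bilMap φ h.inner) (chr φ h.inner) z := by
  refine trilinear_ext (f := fun u v w => 2 * bilMap φ h.inner z (chr φ h.inner z u v) w)
    (g := fun u v w => fderiv ℝ (bilMap φ h.inner) z u v w + fderiv ℝ (bilMap φ h.inner) z v u w
      - fderiv ℝ (bilMap φ h.inner) z w u v) ?_ ?_ ?_ ?_ ?_ ?_ fun i j l => ?_
  iterate 6
    · intro a b
      exact ⟨fun x y => by simp; ring, fun c x => by simp; ring⟩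
  simp only [← pd_gram hφ h hz]
  rw [← sum_gram_mul_christoffel (isMetric_smooth h) hφ hz, chr_single]
  simp only [map_sum, map_smul, sum_apply, smul_apply, bilMap_single, smul_eq_mul,
    gram_symm (isMetric_smooth h) z l, mul_comm]

lemma contDiffAt_transition (hφ : φ ∈ atlas (E n) M) (hφ' : φ' ∈ atlas (E n) M) {z : E n}
    (hz : z ∈ overlap φ φ') : ContDiffAt ℝ ∞ (transition φ φ') z :=
  (contDiffOn_transition hφ hφ').contDiffAt (isOpen_overlap.mem_nhds hz)

lemma bilMap_transition (hφ : φ ∈ atlas (E n) M) (hφ' : φ' ∈ atlas (E n) M) (S : Tensor2 n M)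
    {z : E n} (hz : z ∈ overlap φ φ') (v w : E n) :
    bilMap φ' S z v w = bilMap φ S (transition φ φ' z) (fderiv ℝ (transition φ φ') z v)
      (fderiv ℝ (transition φ φ') z w) := by
  rw [bilMap_apply, bilMap_apply, frameMap_eq_comp hφ hφ' hz, symm_transition hz]
  rfl

lemma chr_transition (hφ : φ ∈ atlas (E n) M) (hφ' : φ' ∈ atlas (E n) M) (h : SmoothMetric n M)
    {z : E n} (hz : z ∈ overlap φ φ') (u v : E n) :
    fderiv ℝ (transition φ φ') z (chr φ' h.inner z u v)
      = chr φ h.inner (transition φ φ' z) (fderiv ℝ (transition φ φ') z u)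
          (fderiv ℝ (transition φ φ') z v)
        + fderiv ℝ (fderiv ℝ (transition φ φ')) z u v := by
  have ht := transition_mem hz
  refine christoffel_transformation (contDiffAt_transition hφ hφ' hz)
    (differentiableAt_bilMap hφ h ht) (differentiableAt_bilMap hφ' h hz.1) ?_
    (fun v w => (isMetric_smooth h).symm _ _ _) (fun v hv => ?_)
    (isChristoffel_chr hφ h ht) (isChristoffel_chr hφ' h hz.1) u v
  · filter_upwards [isOpen_overlap.mem_nhds hz] with y hy v w
    exact bilMap_transition hφ hφ' _ hy v w
  · by_contra h0
    have h1 : frameMap φ (transition φ φ' z) v ≠ 0 := by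
      intro h2
      have := DFunLike.congr_fun (coframeMap_comp_frameMap hφ ht) v
      simp only [ContinuousLinearMap.comp_apply, h2, map_zero, ContinuousLinearMap.id_apply] at this
      exact h0 this.symm
    have h3 := (isMetric_smooth h).pos (φ.symm (transition φ φ' z)) _ h1
    have h4 := hv (coframeMap φ' z (frameMap φ (transition φ φ' z) v))
    have h5 : frameMap φ (transition φ φ' z) (fderiv ℝ (transition φ φ') z
        (coframeMap φ' z (frameMap φ (transition φ φ' z) v))) = frameMap φ (transition φ φ' z) v :=
      (DFunLike.congr_fun (frameMap_eq_comp hφ hφ' hz) _).symm.trans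
        (DFunLike.congr_fun (frameMap_comp_coframeMap hφ' hz.1) _)
    rw [bilMap_apply, h5] at h4
    exact h3.ne' h4

/-- The second derivatives of the transition map that arise from differentiating the components are
cancelled by those in the transformation of the two Christoffel terms. -/
lemma covD_transition (hφ : φ ∈ atlas (E n) M) (hφ' : φ' ∈ atlas (E n) M) (h S : SmoothMetric n M)
    {z : E n} (hz : z ∈ overlap φ φ') (u v w : E n) :
    covD φ' h.inner S.inner z u v w = covD φ h.inner S.inner (transition φ φ' z)
      (fderiv ℝ (transition φ φ') z u) (fderiv ℝ (transition φ φ') z v)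
      (fderiv ℝ (transition φ φ') z w) := by
  have ht := transition_mem hz
  rw [covD, fderiv_pullback (contDiffAt_transition hφ hφ' hz) (differentiableAt_bilMap hφ S ht)
    (differentiableAt_bilMap hφ' S hz.1), bilMap_transition hφ hφ' _ hz,
    bilMap_transition hφ hφ' _ hz, chr_transition hφ hφ' h hz, chr_transition hφ hφ' h hz, covD]
  · simp
    ring
  · filter_upwards [isOpen_overlap.mem_nhds hz] with y hy v w
    exact bilMap_transition hφ hφ' _ hy v w

/-- Reads the coordinate formula as a trace of `curv` over its first slot, so that the
transformation law of the curvature applies. -/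
lemma ricci_eq_sum_curv (hφ : φ ∈ atlas (E n) M) (h : SmoothMetric n M) {z : E n}
    (hz : z ∈ φ.target) (i j : Fin n) :
    ricci φ h.inner i j z = ∑ k, curv (chr φ h.inner) z (EuclideanSpace.single k 1)
      (EuclideanSpace.single j 1) (EuclideanSpace.single i 1) k := by
  have hd : ∀ a b c k : Fin n, fderiv ℝ (chr φ h.inner) z (EuclideanSpace.single a 1)
      (EuclideanSpace.single b 1) (EuclideanSpace.single c 1) k
      = pd a (christoffel φ h.inner k b c) z := by
    intro a b c k
    rw [← fderiv_apply₂ (differentiableAt_chr hφ h hz), pd,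
      show christoffel φ h.inner k b c = fun y => (EuclideanSpace.proj k : E n →L[ℝ] ℝ)
        (chr φ h.inner y (EuclideanSpace.single b 1) (EuclideanSpace.single c 1)) from
        funext fun y => (chr_single_apply _ _ _ _ _).symm]
    have h1 : DifferentiableAt ℝ (fun y => chr φ h.inner y (EuclideanSpace.single b 1)
        (EuclideanSpace.single c 1)) z :=
      ((differentiableAt_chr hφ h hz).clm_apply (differentiableAt_const _)).clm_apply
        (differentiableAt_const _)
    have h2 := (EuclideanSpace.proj k : E n →L[ℝ] ℝ).hasFDerivAt.comp z h1.hasFDerivAt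
    erw [h2.fderiv]
    rfl
  have hg : ∀ a b c k : Fin n, chr φ h.inner z (EuclideanSpace.single a 1)
      (chr φ h.inner z (EuclideanSpace.single b 1) (EuclideanSpace.single c 1)) k
      = ∑ l, christoffel φ h.inner l b c z * christoffel φ h.inner k a l z := by
    intro a b c k
    rw [chr_single]
    simp [chr_single_apply]
  rw [ricci, ← Finset.sum_sub_distrib, ← Finset.sum_add_distrib]
  refine Finset.sum_congr rfl fun k _ => ?_
  simp only [curv, PiLp.add_apply, PiLp.sub_apply, hd, hg, Finset.sum_sub_distrib]
  simp only [mul_comm]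
  ring

lemma ricci_transition (hφ : φ ∈ atlas (E n) M) (hφ' : φ' ∈ atlas (E n) M) (h : SmoothMetric n M)
    {z : E n} (hz : z ∈ overlap φ φ') :
    ∃ R : E n →ₗ[ℝ] E n →ₗ[ℝ] ℝ, ∀ i j,
      ricci φ h.inner i j (transition φ φ' z)
        = R (frm φ (transition φ φ' z) i) (frm φ (transition φ φ' z) j) ∧
      ricci φ' h.inner i j z = R (frm φ' z i) (frm φ' z j) := by
  have ht := transition_mem hz
  set y := transition φ φ' z with hy
  have hlin1 : ∀ v w, IsLinearMap ℝ fun u => curv (chr φ h.inner) y u v w := fun v w =>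
    ⟨fun a b => by simp [curv]; abel, fun c a => by simp [curv, smul_sub, smul_add]⟩
  have hlin2 : ∀ u w, IsLinearMap ℝ fun v => curv (chr φ h.inner) y u v w := fun v w =>
    ⟨fun a b => by simp [curv]; abel, fun c a => by simp [curv, smul_sub, smul_add]⟩
  have hlin3 : ∀ u v, IsLinearMap ℝ fun w => curv (chr φ h.inner) y u v w := fun v w =>
    ⟨fun a b => by simp [curv]; abel, fun c a => by simp [curv, smul_sub, smul_add]⟩
  -- The tensor is built from the chart `φ`, so the first identity is immediate and the work lies in
  -- the chart `φ'`.
  let R : E n →ₗ[ℝ] E n →ₗ[ℝ] ℝ := LinearMap.mk₂ ℝ (fun a b => ∑ k,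
      curv (chr φ h.inner) y (EuclideanSpace.single k 1) (coframeMap φ y b) (coframeMap φ y a) k)
    (fun a a' b => by simp [(hlin3 _ _).map_add, Finset.sum_add_distrib])
    (fun c a b => by simp [(hlin3 _ _).map_smul, Finset.mul_sum])
    (fun a b b' => by simp [(hlin2 _ _).map_add, Finset.sum_add_distrib])
    (fun c a b => by simp [(hlin2 _ _).map_smul, Finset.mul_sum])
  have hC : ∀ v, coframeMap φ y (frameMap φ y v) = v := fun v =>
    DFunLike.congr_fun (coframeMap_comp_frameMap hφ ht) v
  have hC' : ∀ v, coframeMap φ' z (frameMap φ' z v) = v := fun v =>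
    DFunLike.congr_fun (coframeMap_comp_frameMap hφ' hz.1) v
  have hP : ∀ v, frameMap φ' z v = frameMap φ y (fderiv ℝ (transition φ φ') z v) := fun v =>
    DFunLike.congr_fun (frameMap_eq_comp hφ hφ' hz) v
  refine ⟨R, fun i j => ⟨?_, ?_⟩⟩
  · rw [ricci_eq_sum_curv hφ h ht]
    simp only [R, LinearMap.mk₂_apply, frm, hC]
  · rw [ricci_eq_sum_curv hφ' h hz.1]
    simp only [R, LinearMap.mk₂_apply, frm, hC, hP]
    set a := fderiv ℝ (transition φ φ') z (EuclideanSpace.single i 1)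
    set b := fderiv ℝ (transition φ φ') z (EuclideanSpace.single j 1)
    -- The trace over the first slot is moved to the frame of `φ'`; after that each summand is
    -- transported by `curv_transformation`.
    have h1 := (isFrame_frm hφ ht).contract_eq (isFrame_frm hφ' hz.1)
      (fun v ξ => ξ (frameMap φ y (curv (chr φ h.inner) y (coframeMap φ y v) b a)))
      (fun ξ => ⟨fun v w => by simp [(hlin1 _ _).map_add],
        fun c v => by simp [(hlin1 _ _).map_smul]⟩)
      (fun v => ⟨by simp, by simp⟩)
    simp only [frm, cofrm, hC, hP, ContinuousLinearMap.comp_apply, PiLp.proj_apply] at h1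
    rw [h1]
    refine Finset.sum_congr rfl fun k _ => ?_
    rw [← curv_transformation (Γ' := chr φ' h.inner), ← hP, hC']
    · filter_upwards [isOpen_overlap.mem_nhds hz] with w hw
      exact contDiffAt_transition hφ hφ' hw
    · exact differentiableAt_chr hφ h ht
    · exact differentiableAt_chr hφ' h hz.1
    · exact chr_symm (isMetric_smooth h) _
    · filter_upwards [isOpen_overlap.mem_nhds hz] with w hw
      exact chr_transition hφ hφ' h hw

end Christoffel

lemma measurableSet_target_inter {n : ℕ} {M : Type*} [TopologicalSpace M] [MeasurableSpace M]
    [BorelSpace M] (φ : OpenPartialHomeomorph M (E n)) {A : Set M}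
    (hA : MeasurableSet A) : MeasurableSet (φ.target ∩ φ.symm ⁻¹' A) := by
  have h1 := (continuousOn_iff_continuous_domRestrict.1 φ.continuousOn_symm).measurable hA
  have h2 := MeasurableSet.subtype_image φ.open_target.measurableSet h1
  convert h2 using 1
  ext z
  simp [and_comm]

/-! ### The Riemannian volume measure in charts. -/

section Volume

variable {n : ℕ} {M : Type*} [TopologicalSpace M] [ChartedSpace (E n) M]
  {φ φ' : OpenPartialHomeomorph M (E n)}

/-- The measure `√(det h_ij) dz` on the target of a chart. -/
def coordVol (φ : OpenPartialHomeomorph M (E n)) (h : Tensor2 n M) : Measure (E n) :=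
  (volume.restrict φ.target).withDensity fun z => ENNReal.ofReal (√(gram φ h z).det)

lemma coordVol_absolutelyContinuous (φ : OpenPartialHomeomorph M (E n)) (h : Tensor2 n M) :
    coordVol φ h ≪ volume.restrict φ.target := withDensity_absolutelyContinuous _ _

/-- The prescribed chart is put at index 0 so that, after disjointing the sources, the first piece
is the whole of `φ.source`. -/
lemma exists_seq_chart [CompactSpace M] (hφ : φ ∈ atlas (E n) M) :
    ∃ f : ℕ → OpenPartialHomeomorph M (E n), f 0 = φ ∧ (∀ i, f i ∈ atlas (E n) M) ∧
      ⋃ i, (f i).source = univ := by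
  obtain ⟨t, ht⟩ := CompactSpace.elim_nhds_subcover (fun x : M => (chartAt (E n) x).source)
    fun x => chart_source_mem_nhds _ x
  -- Inserting `φ` keeps the enumerated set nonempty even when the subcover is empty.
  obtain ⟨g, hg⟩ := ((t.finite_toSet.image (chartAt (E n))).insert φ).countable.exists_eq_range
    ⟨φ, mem_insert _ _⟩
  refine ⟨fun i => Nat.casesOn i φ g, rfl, fun i => ?_, ?_⟩
  · cases i with
    | zero => exact hφ
    | succ i =>
      have : g i ∈ insert φ (chartAt (E n) '' (t : Set M)) := hg ▸ mem_range_self i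
      change g i ∈ atlas (E n) M
      rcases this with h | ⟨x, _, h⟩
      · rwa [h]
      · rw [← h]
        exact chart_mem_atlas _ x
  · refine eq_univ_of_forall fun x => ?_
    have hx : x ∈ ⋃ y ∈ t, (chartAt (E n) y).source := ht ▸ mem_univ x
    obtain ⟨y, hy, hxy⟩ := mem_iUnion₂.1 hx
    have : chartAt (E n) y ∈ range g := hg ▸ mem_insert_of_mem _ (mem_image_of_mem _ hy)
    obtain ⟨i, hi⟩ := this
    exact mem_iUnion.2 ⟨i + 1, by simpa [hi] using hxy⟩

/-- The Gram matrix changes by congruence with the Jacobian matrix, whose determinant enters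
squared; the square root leaves its absolute value, the factor in the change of variables formula.
-/
lemma sqrt_det_gram_transition [IsManifold (𝓡 n) ∞ M] (hφ : φ ∈ atlas (E n) M) (hφ' : φ' ∈ atlas (E n) M)
    (h : Tensor2 n M) {z : E n} (hz : z ∈ overlap φ φ') :
    √(gram φ' h z).det
      = |(fderiv ℝ (transition φ φ') z).det| * √(gram φ h (transition φ φ' z)).det := by
  set P := fderiv ℝ (transition φ φ') z
  have h1 : gram φ' h z = gramOf (bilMap φ h (transition φ φ' z))
      (fun i => P (EuclideanSpace.single i 1)) := by
    ext i j
    rw [← bilMap_single, bilMap_transition hφ hφ' _ hz]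
    rfl
  have h2 : gram φ h (transition φ φ' z) = gramOf (bilMap φ h (transition φ φ' z))
      (fun i => EuclideanSpace.single i 1) := by
    rfl
  have h3 : (Matrix.of fun i j => (EuclideanSpace.proj i : E n →L[ℝ] ℝ)
      (P (EuclideanSpace.single j 1))).det = P.det := by
    rw [ContinuousLinearMap.det, ← LinearMap.det_toMatrix (EuclideanSpace.basisFun (Fin n) ℝ).toBasis]
    congr 1
  rw [h1, isFrame_single.gramOf_eq, ← h2, Matrix.det_mul, Matrix.det_mul, Matrix.det_transpose, h3,
    mul_right_comm, Real.sqrt_mul (mul_self_nonneg _), Real.sqrt_mul_self_eq_abs]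

variable [MeasurableSpace M]

lemma chartVol_le_vol (hφ : φ ∈ atlas (E n) M) (h : Tensor2 n M) : chartVol h φ ≤ vol h :=
  le_iSup₂ (f := fun φ (_ : φ ∈ atlas (E n) M) => chartVol h φ) φ hφ

variable [BorelSpace M]

lemma aemeasurable_chart (φ : OpenPartialHomeomorph M (E n)) (h : Tensor2 n M) :
    AEMeasurable φ ((vol h).restrict φ.source) :=
  φ.continuousOn.aemeasurable φ.open_source.measurableSet

lemma aemeasurable_symm (φ : OpenPartialHomeomorph M (E n)) (h : Tensor2 n M) :
    AEMeasurable φ.symm (coordVol φ h) :=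
  (φ.continuousOn_symm.aemeasurable φ.open_target.measurableSet).mono_ac
    (coordVol_absolutelyContinuous φ h)

lemma chartVol_apply (φ : OpenPartialHomeomorph M (E n)) (h : Tensor2 n M) {A : Set M}
    (hA : MeasurableSet A) :
    chartVol h φ A = ∫⁻ z in φ.target ∩ φ.symm ⁻¹' A, ENNReal.ofReal (√(gram φ h z).det) := by
  have h1 : chartVol h φ A = coordVol φ h (φ.symm ⁻¹' A) :=
    Measure.map_apply_of_aemeasurable (aemeasurable_symm φ h) hA
  have h2 : coordVol φ h (φ.symm ⁻¹' A) = coordVol φ h (φ.target ∩ φ.symm ⁻¹' A) := by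
    have h0 : ∀ᵐ z ∂coordVol φ h, z ∈ φ.target :=
      (coordVol_absolutelyContinuous φ h).ae_le (ae_restrict_mem φ.open_target.measurableSet)
    refine measure_congr ?_
    filter_upwards [h0] with z hz
    exact propext ⟨fun h => ⟨hz, h⟩, fun h => h.2⟩
  rw [h1, h2, coordVol, withDensity_apply _ (measurableSet_target_inter φ hA),
    Measure.restrict_restrict (measurableSet_target_inter φ hA)]
  congr 2
  ext z
  simp +contextual

lemma chartVol_restrict_source (φ : OpenPartialHomeomorph M (E n)) (h : Tensor2 n M) :
    (chartVol h φ).restrict φ.source = chartVol h φ := by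
  ext A hA
  rw [Measure.restrict_apply hA, chartVol_apply φ h (hA.inter φ.open_source.measurableSet),
    chartVol_apply φ h hA]
  congr 2
  ext z
  simp +contextual [φ.map_target]

variable [IsManifold (𝓡 n) ∞ M]

/-- Change of variables along the transition map: its Jacobian factor is the ratio of the two volume
densities. -/
lemma chartVol_eq_of_subset (hφ : φ ∈ atlas (E n) M) (hφ' : φ' ∈ atlas (E n) M)
    (h : Tensor2 n M) {A : Set M} (hA : MeasurableSet A) (h1 : A ⊆ φ.source) (h2 : A ⊆ φ'.source) :
    chartVol h φ A = chartVol h φ' A := by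
  rw [chartVol_apply φ h hA, chartVol_apply φ' h hA]
  set B := φ'.target ∩ φ'.symm ⁻¹' A with hB
  have hBo : B ⊆ overlap φ φ' := fun z hz => ⟨hz.1, h1 hz.2⟩
  have him : φ.target ∩ φ.symm ⁻¹' A = transition φ φ' '' B := by
    ext y
    constructor
    · rintro ⟨hy, hyA⟩
      refine ⟨φ' (φ.symm y), ⟨φ'.map_source (h2 hyA), ?_⟩, ?_⟩
      · simpa [φ'.left_inv (h2 hyA)] using hyA
      · simp [transition, φ'.left_inv (h2 hyA), φ.right_inv hy]
    · rintro ⟨z, hz, rfl⟩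
      refine ⟨transition_mem (hBo hz), ?_⟩
      rw [mem_preimage, symm_transition (hBo hz)]
      exact hz.2
  rw [him, lintegral_image_eq_lintegral_abs_det_fderiv_mul volume
    (measurableSet_target_inter φ' hA) (f' := fderiv ℝ (transition φ φ'))]
  · refine setLIntegral_congr_fun (measurableSet_target_inter φ' hA) fun z hz => ?_
    rw [sqrt_det_gram_transition hφ hφ' h (hBo hz), ENNReal.ofReal_mul (abs_nonneg _)]
  · intro z hz
    exact ((contDiffAt_transition hφ hφ' (hBo hz)).differentiableAt
      (by simp)).hasFDerivAt.hasFDerivWithinAt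
  · intro z hz w hw hzw
    have e1 := symm_transition (hBo hz)
    have e2 := symm_transition (hBo hw)
    rw [hzw] at e1
    exact φ'.symm.injOn hz.1 hw.1 (e1.symm.trans e2)

variable [CompactSpace M]

/-- Since `vol` is a supremum of measures, an upper bound is needed. Glue the chart volumes along a
countable partition of `M` into pieces of chart sources: the resulting `ν` dominates every chart
volume, because chart volumes agree on overlaps. As `φ.source` is itself one of the pieces, `ν`
equals `chartVol h φ` there. -/
lemma vol_restrict_source (hφ : φ ∈ atlas (E n) M) (h : Tensor2 n M) :
    (vol h).restrict φ.source = chartVol h φ := by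
  obtain ⟨f, hf0, hf, hcov⟩ := exists_seq_chart hφ
  set D := disjointed fun i => (f i).source with hD
  have hDm : ∀ i, MeasurableSet (D i) :=
    MeasurableSet.disjointed fun i => (f i).open_source.measurableSet
  have hDs : ∀ i, D i ⊆ (f i).source := fun i => disjointed_subset _ i
  have hDd : Pairwise (Function.onFun Disjoint D) := disjoint_disjointed _
  have hDu : ⋃ i, D i = univ := by rw [hD, iUnion_disjointed, hcov]
  have hD0 : D 0 = φ.source := by simp [hD, disjointed_zero, hf0]
  set ν : Measure M := Measure.sum fun i => (chartVol h (f i)).restrict (D i) with hν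
  have hle : vol h ≤ ν := by
    refine iSup₂_le fun ψ hψ => Measure.le_iff.2 fun A hA => ?_
    have e1 : chartVol h ψ A = ∑' i, chartVol h ψ (A ∩ D i) := by
      rw [← measure_iUnion (fun i j hij => (hDd hij).mono inter_subset_right inter_subset_right)
        fun i => hA.inter (hDm i), ← inter_iUnion, hDu, inter_univ]
    rw [e1, hν, Measure.sum_apply _ hA]
    refine ENNReal.tsum_le_tsum fun i => ?_
    rw [Measure.restrict_apply hA]
    conv_lhs => rw [← chartVol_restrict_source ψ h]
    rw [Measure.restrict_apply (hA.inter (hDm i)), chartVol_eq_of_subset hψ (hf i) h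
      ((hA.inter (hDm i)).inter ψ.open_source.measurableSet) inter_subset_right
      fun x hx => hDs i hx.1.2]
    exact measure_mono inter_subset_left
  have hν0 : ν.restrict φ.source = chartVol h φ := by
    ext A hA
    rw [Measure.restrict_apply hA, hν, Measure.sum_apply _ (hA.inter φ.open_source.measurableSet),
      tsum_eq_single 0]
    · rw [Measure.restrict_apply (hA.inter φ.open_source.measurableSet), hD0, hf0, inter_assoc,
        inter_self, ← Measure.restrict_apply hA, chartVol_restrict_source]
    · intro i hi
      rw [Measure.restrict_apply (hA.inter φ.open_source.measurableSet), inter_assoc, ← hD0,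
        (hDd hi.symm).inter_eq, inter_empty, measure_empty]
  refine le_antisymm ((Measure.restrict_mono le_rfl hle).trans hν0.le) ?_
  rw [← chartVol_restrict_source]
  exact Measure.restrict_mono le_rfl (chartVol_le_vol hφ h)

lemma map_vol_restrict_source (hφ : φ ∈ atlas (E n) M) (h : Tensor2 n M) :
    Measure.map φ ((vol h).restrict φ.source) = coordVol φ h := by
  have h1 := aemeasurable_chart φ h
  rw [vol_restrict_source hφ] at h1 ⊢
  have h2 : chartVol h φ = Measure.map φ.symm (coordVol φ h) := rfl
  rw [h2] at h1 ⊢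
  rw [AEMeasurable.map_map_of_aemeasurable h1 (aemeasurable_symm φ h)]
  have h3 : φ ∘ φ.symm =ᵐ[coordVol φ h] id := by
    have h0 : ∀ᵐ z ∂coordVol φ h, z ∈ φ.target :=
      (coordVol_absolutelyContinuous φ h).ae_le (ae_restrict_mem φ.open_target.measurableSet)
    filter_upwards [h0] with z hz using φ.right_inv hz
  rw [Measure.map_congr h3, Measure.map_id]

end Volume

/-! ### Convergence in `L^q` and its algebra. -/

section LpConvergence

variable {X : Type*} [MeasurableSpace X] {μ : Measure X} {p q r : ℝ≥0∞}
  {f f' g : ℝ → X → ℝ} {F F' G : X → ℝ}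

/-- The family `f δ` converges to `F` in `L^q(μ)` as `δ → 0⁺`. -/
structure LpConv (μ : Measure X) (q : ℝ≥0∞) (f : ℝ → X → ℝ) (F : X → ℝ) : Prop where
  memLp : MemLp F q μ
  aesm : ∀ᶠ δ in 𝓝[>] (0 : ℝ), AEStronglyMeasurable (f δ) μ
  tendsto : Tendsto (fun δ => eLpNorm (f δ - F) q μ) (𝓝[>] (0 : ℝ)) (𝓝 0)

namespace LpConv

lemma memLp_sub (hf : LpConv μ q f F) : ∀ᶠ δ in 𝓝[>] (0 : ℝ), MemLp (f δ - F) q μ := by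
  filter_upwards [hf.aesm, hf.tendsto.eventually_lt_const ENNReal.zero_lt_top] with δ h1 h2
  exact ⟨h1.sub hf.memLp.1, h2⟩

lemma memLp_eventually (hf : LpConv μ q f F) : ∀ᶠ δ in 𝓝[>] (0 : ℝ), MemLp (f δ) q μ := by
  filter_upwards [hf.memLp_sub] with δ h
  simpa using h.add hf.memLp

lemma const (hF : MemLp F q μ) : LpConv μ q (fun _ => F) F :=
  ⟨hF, Eventually.of_forall fun _ => hF.1, by simp⟩

lemma congr (hf : LpConv μ q f F) (h1 : ∀ᶠ δ in 𝓝[>] (0 : ℝ), f δ =ᵐ[μ] f' δ) (h2 : F =ᵐ[μ] F') :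
    LpConv μ q f' F' := by
  refine ⟨(memLp_congr_ae h2).1 hf.memLp, ?_, hf.tendsto.congr' ?_⟩
  · filter_upwards [hf.aesm, h1] with δ a b using a.congr b
  · filter_upwards [h1] with δ h using eLpNorm_congr_ae (h.sub h2)

lemma add (hq : 1 ≤ q) (hf : LpConv μ q f F) (hg : LpConv μ q g G) :
    LpConv μ q (fun δ x => f δ x + g δ x) fun x => F x + G x := by
  refine ⟨hf.memLp.add hg.memLp, ?_, ?_⟩
  · filter_upwards [hf.aesm, hg.aesm] with δ a b using a.add b
  · have h0 := hf.tendsto.add hg.tendsto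
    rw [add_zero] at h0
    refine tendsto_of_tendsto_of_tendsto_of_le_of_le' tendsto_const_nhds h0
      (Eventually.of_forall fun _ => zero_le) ?_
    filter_upwards [hf.memLp_sub, hg.memLp_sub] with δ a b
    have e : ((fun x => f δ x + g δ x) - fun x => F x + G x) = (f δ - F) + (g δ - G) := by
      ext x
      simp only [Pi.sub_apply, Pi.add_apply]
      ring
    rw [e]
    exact eLpNorm_add_le a.1 b.1 hq

lemma mul [hpqr : ENNReal.HolderTriple p q r] (hr : 1 ≤ r) (hf : LpConv μ p f F)
    (hg : LpConv μ q g G) : LpConv μ r (fun δ x => f δ x * g δ x) fun x => F x * G x := by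
  refine ⟨hg.memLp.mul hf.memLp, ?_, ?_⟩
  · filter_upwards [hf.aesm, hg.aesm] with δ a b using a.mul b
  · have h1 := ENNReal.Tendsto.mul hf.tendsto (Or.inr ENNReal.zero_ne_top) hg.tendsto
      (Or.inr ENNReal.zero_ne_top)
    have h2 := ENNReal.Tendsto.mul_const (b := eLpNorm G q μ) hf.tendsto
      (Or.inr hg.memLp.2.ne)
    have h3 := ENNReal.Tendsto.const_mul (a := eLpNorm F p μ) hg.tendsto
      (Or.inr hf.memLp.2.ne)
    have h0 := (h1.add h2).add h3
    simp only [zero_mul, mul_zero, add_zero] at h0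
    refine tendsto_of_tendsto_of_tendsto_of_le_of_le' tendsto_const_nhds h0
      (Eventually.of_forall fun _ => zero_le) ?_
    filter_upwards [hf.memLp_sub, hg.memLp_sub] with δ a b
    -- With `a = f δ - F` and `b = g δ - G`, the difference of products is `ab + aG + Fb`, and
    -- Hölder's inequality applies to each term.
    have e : ((fun x => f δ x * g δ x) - fun x => F x * G x)
        = ((f δ - F) • (g δ - G) + (f δ - F) • G) + F • (g δ - G) := by
      ext x
      simp only [Pi.sub_apply, Pi.add_apply, Pi.mul_apply, smul_eq_mul]
      ring
    rw [e]
    refine (eLpNorm_add_le ((a.1.smul b.1).add (a.1.smul hg.memLp.1))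
      (hf.memLp.1.smul b.1) hr).trans (add_le_add ?_ ?_)
    · exact (eLpNorm_add_le (a.1.smul b.1) (a.1.smul hg.memLp.1) hr).trans
        (add_le_add (eLpNorm_smul_le_mul_eLpNorm b.1 a.1)
          (eLpNorm_smul_le_mul_eLpNorm hg.memLp.1 a.1))
    · exact eLpNorm_smul_le_mul_eLpNorm b.1 hf.memLp.1

lemma const_mul (hf : LpConv μ q f F) (c : ℝ) :
    LpConv μ q (fun δ x => c * f δ x) fun x => c * F x := by
  refine ⟨hf.memLp.const_mul c, hf.aesm.mono fun δ h => h.const_mul c, ?_⟩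
  have h := ENNReal.Tendsto.const_mul (a := ‖c‖ₑ) hf.tendsto (Or.inr (by simp))
  rw [mul_zero] at h
  refine h.congr fun δ => ?_
  rw [← eLpNorm_const_smul]
  congr 1
  ext x
  simp [mul_sub]

lemma neg (hf : LpConv μ q f F) : LpConv μ q (fun δ x => -f δ x) fun x => -F x := by
  simpa using hf.const_mul (-1)

lemma sub (hq : 1 ≤ q) (hf : LpConv μ q f F) (hg : LpConv μ q g G) :
    LpConv μ q (fun δ x => f δ x - g δ x) fun x => F x - G x := by
  simpa [sub_eq_add_neg] using hf.add hq hg.neg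

lemma sum {ι : Type*} (s : Finset ι) (hq : 1 ≤ q) {f : ι → ℝ → X → ℝ} {F : ι → X → ℝ}
    (h : ∀ i, LpConv μ q (f i) (F i)) :
    LpConv μ q (fun δ x => ∑ i ∈ s, f i δ x) fun x => ∑ i ∈ s, F i x := by
  classical
  induction s using Finset.induction_on with
  | empty => simpa using const (μ := μ) (q := q) (F := fun _ => 0) MemLp.zero
  | insert i s hi ih => simpa [Finset.sum_insert hi] using (h i).add hq ih

lemma mono [IsFiniteMeasure μ] (hpq : p ≤ q) (hf : LpConv μ q f F) : LpConv μ p f F := by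
  -- For `p = 0` the exponent of `C` below could be negative, as `1 / 0 = 0`, and `C` could be
  -- infinite.
  by_cases hp : p = 0
  · subst hp
    exact ⟨⟨hf.memLp.1, by simp⟩, hf.aesm, by simp⟩
  refine ⟨hf.memLp.mono_exponent hpq, hf.aesm, ?_⟩
  set C := μ Set.univ ^ (1 / p.toReal - 1 / q.toReal)
  have hC : C ≠ ⊤ := by
    refine (ENNReal.rpow_lt_top_of_nonneg ?_ (measure_ne_top _ _)).ne
    by_cases hq : q = ⊤
    · simp [hq]
    · rw [sub_nonneg]
      exact one_div_le_one_div_of_le (ENNReal.toReal_pos hp (ne_top_of_le_ne_top hq hpq))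
        (ENNReal.toReal_mono hq hpq)
  have h0 := ENNReal.Tendsto.mul_const (b := C) hf.tendsto (Or.inr hC)
  rw [zero_mul] at h0
  refine tendsto_of_tendsto_of_tendsto_of_le_of_le' tendsto_const_nhds h0
    (Eventually.of_forall fun _ => zero_le) ?_
  filter_upwards [hf.memLp_sub] with δ h
  exact eLpNorm_le_eLpNorm_mul_rpow_measure_univ hpq h.1

lemma tendsto_integral (hf : LpConv μ 1 f F) :
    Tendsto (fun δ => ∫ x, f δ x ∂μ) (𝓝[>] (0 : ℝ)) (𝓝 (∫ x, F x ∂μ)) :=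
  tendsto_integral_of_L1' F hf.memLp.1
    (hf.memLp_eventually.mono fun _ h => memLp_one_iff_integrable.1 h) hf.tendsto

end LpConv

end LpConvergence

/-! ### Locally uniform convergence in the form of continuous convergence. -/

section ContinuousConvergence

variable {X Y Z : Type*} [TopologicalSpace X] [TopologicalSpace Y] [TopologicalSpace Z] {K : Set X}

/-- The family `f δ` converges to `F` as `δ → 0⁺`, locally uniformly on `K`, in the form of
continuous convergence. -/
structure ContConv (K : Set X) (f : ℝ → X → Y) (F : X → Y) : Prop where
  cont : ContinuousOn F K
  cont' : ∀ δ > (0 : ℝ), ContinuousOn (f δ) K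
  tendsto : ∀ z ∈ K, Tendsto (fun p : ℝ × X => f p.1 p.2) (𝓝[>] (0 : ℝ) ×ˢ 𝓝[K] z) (𝓝 (F z))

lemma ContConv.const {F : X → Y} (hF : ContinuousOn F K) : ContConv K (fun _ => F) F :=
  ⟨hF, fun _ _ => hF, fun z hz => (hF z hz).tendsto.comp tendsto_snd⟩

/-- The benefit of continuous convergence: it survives composition with a map continuous only at the
values taken, such as matrix inversion at invertible matrices, without uniform lower bounds on the
determinants. -/
lemma ContConv.comp {f : ℝ → X → Y} {F : X → Y} (hf : ContConv K f F) {Φ : Y → Z}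
    (h1 : ∀ z ∈ K, ContinuousAt Φ (F z)) (h2 : ∀ δ > (0 : ℝ), ∀ z ∈ K, ContinuousAt Φ (f δ z)) :
    ContConv K (fun δ z => Φ (f δ z)) fun z => Φ (F z) :=
  ⟨fun z hz => (h1 z hz).comp_continuousWithinAt (hf.cont z hz),
    fun δ hδ z hz => (h2 δ hδ z hz).comp_continuousWithinAt (hf.cont' δ hδ z hz),
    fun z hz => (h1 z hz).tendsto.comp (hf.tendsto z hz)⟩

lemma ContConv.prodMk {f : ℝ → X → Y} {F : X → Y} {g : ℝ → X → Z} {G : X → Z}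
    (hf : ContConv K f F) (hg : ContConv K g G) :
    ContConv K (fun δ z => (f δ z, g δ z)) fun z => (F z, G z) :=
  ⟨hf.cont.prodMk hg.cont, fun δ hδ => (hf.cont' δ hδ).prodMk (hg.cont' δ hδ),
    fun z hz => (hf.tendsto z hz).prodMk_nhds (hg.tendsto z hz)⟩

lemma ContConv.mul {f g : ℝ → X → ℝ} {F G : X → ℝ} (hf : ContConv K f F) (hg : ContConv K g G) :
    ContConv K (fun δ z => f δ z * g δ z) fun z => F z * G z :=
  (hf.prodMk hg).comp (Φ := fun p : ℝ × ℝ => p.1 * p.2)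
    (fun _ _ => continuous_mul.continuousAt) fun _ _ _ _ => continuous_mul.continuousAt

lemma ContConv.matrix {ι : Type*} {f : ℝ → X → Matrix ι ι ℝ} {F : X → Matrix ι ι ℝ}
    (h : ∀ i j, ContConv K (fun δ z => f δ z i j) fun z => F z i j) : ContConv K f F :=
  ⟨continuousOn_pi.2 fun i => continuousOn_pi.2 fun j => (h i j).cont,
    fun δ hδ => continuousOn_pi.2 fun i => continuousOn_pi.2 fun j => (h i j).cont' δ hδ,
    fun z hz => tendsto_pi_nhds.2 fun i => tendsto_pi_nhds.2 fun j => (h i j).tendsto z hz⟩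

lemma ContConv.det {ι : Type*} [Fintype ι] [DecidableEq ι] {f : ℝ → X → Matrix ι ι ℝ}
    {F : X → Matrix ι ι ℝ} (h : ContConv K f F) :
    ContConv K (fun δ z => (f δ z).det) fun z => (F z).det :=
  h.comp (fun _ _ => continuous_id.matrix_det.continuousAt)
    fun _ _ _ _ => continuous_id.matrix_det.continuousAt

lemma continuousAt_matrix_inv_apply {ι : Type*} [Fintype ι] [DecidableEq ι] {A : Matrix ι ι ℝ}
    (hA : A.det ≠ 0) (i j : ι) : ContinuousAt (fun B : Matrix ι ι ℝ => B⁻¹ i j) A := by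
  simp only [Matrix.inv_def, Ring.inverse_eq_inv', Matrix.smul_apply, smul_eq_mul]
  exact (continuous_id.matrix_det.continuousAt.inv₀ hA).mul
    (continuous_id.matrix_adjugate.matrix_elem i j).continuousAt

lemma ContConv.matrix_inv {ι : Type*} [Fintype ι] [DecidableEq ι] {f : ℝ → X → Matrix ι ι ℝ}
    {F : X → Matrix ι ι ℝ} (h : ContConv K f F) (h1 : ∀ z ∈ K, (F z).det ≠ 0)
    (h2 : ∀ δ > (0 : ℝ), ∀ z ∈ K, (f δ z).det ≠ 0) (i j : ι) :
    ContConv K (fun δ z => (f δ z)⁻¹ i j) fun z => (F z)⁻¹ i j :=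
  h.comp (fun z hz => continuousAt_matrix_inv_apply (h1 z hz) i j)
    fun δ hδ z hz => continuousAt_matrix_inv_apply (h2 δ hδ z hz) i j

lemma ContConv.of_uniform {f : ℝ → X → ℝ} {F : X → ℝ} (h1 : ContinuousOn F K)
    (h2 : ∀ δ > (0 : ℝ), ContinuousOn (f δ) K)
    (h3 : ∀ ε > 0, ∀ᶠ δ in 𝓝[>] (0 : ℝ), ∀ z ∈ K, |f δ z - F z| < ε) : ContConv K f F := by
  refine ⟨h1, h2, fun z hz => ?_⟩
  have a : Tendsto (fun p : ℝ × X => f p.1 p.2 - F p.2) (𝓝[>] (0 : ℝ) ×ˢ 𝓝[K] z) (𝓝 0) := by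
    rw [Metric.tendsto_nhds]
    intro ε hε
    filter_upwards [(h3 ε hε).prod_mk (self_mem_nhdsWithin (a := z) (s := K))] with p hp
    simpa using hp.1 p.2 hp.2
  simpa using a.add ((h1 z hz).tendsto.comp tendsto_snd)

/-- Near each point of `K` both `f δ` and `F` are close to the value at that point; compactness
reduces to finitely many neighbourhoods. -/
lemma ContConv.uniform {f : ℝ → X → ℝ} {F : X → ℝ} (hK : IsCompact K) (h : ContConv K f F)
    {ε : ℝ} (hε : 0 < ε) : ∀ᶠ δ in 𝓝[>] (0 : ℝ), ∀ z ∈ K, |f δ z - F z| < ε := by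
  refine hK.induction_on (p := fun s => ∀ᶠ δ in 𝓝[>] (0 : ℝ), ∀ z ∈ s, |f δ z - F z| < ε)
    (by simp) (fun s t hst ht => ht.mono fun δ h z hz => h z (hst hz))
    (fun s t hs ht => ?_) fun z hz => ?_
  · filter_upwards [hs, ht] with δ a b z hz
    exact hz.elim (a z) (b z)
  · have a : Tendsto (fun p : ℝ × X => f p.1 p.2 - F p.2) (𝓝[>] (0 : ℝ) ×ˢ 𝓝[K] z) (𝓝 0) := by
      simpa using (h.tendsto z hz).sub ((h.cont z hz).tendsto.comp tendsto_snd)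
    obtain ⟨pa, ha, pb, hb, hab⟩ := eventually_prod_iff.1 ((Metric.tendsto_nhds.1 a) ε hε)
    refine ⟨{y | pb y}, hb, ha.mono fun δ hδ y hy => ?_⟩
    simpa using hab hδ hy

lemma ContConv.lpConv_top [MeasurableSpace X] [OpensMeasurableSpace X]
    [SecondCountableTopology X] {μ : Measure X}
    {f : ℝ → X → ℝ} {F : X → ℝ} (hK : IsCompact K) (hKm : MeasurableSet K)
    (h : ContConv K f F) : LpConv (μ.restrict K) ∞ f F := by
  refine ⟨?_, ?_, ?_⟩
  · obtain ⟨C, hC⟩ := hK.exists_bound_of_continuousOn h.cont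
    exact memLp_top_of_bound (h.cont.aestronglyMeasurable hKm) C
      ((ae_restrict_mem hKm).mono fun z hz => hC z hz)
  · filter_upwards [self_mem_nhdsWithin] with δ hδ
    exact (h.cont' δ hδ).aestronglyMeasurable hKm
  · rw [ENNReal.tendsto_nhds_zero]
    intro ε hε
    by_cases htop : ε = ⊤
    · simp [htop]
    filter_upwards [h.uniform hK (ENNReal.toReal_pos hε.ne' htop)] with δ hδ
    rw [eLpNorm_exponent_top]
    refine (eLpNormEssSup_le_of_ae_bound (C := ε.toReal)
      ((ae_restrict_mem hKm).mono fun z hz => (hδ z hz).le)).trans ENNReal.ofReal_toReal_le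

end ContinuousConvergence

/-! ### Weak partial derivatives on open subsets of ℝⁿ. -/

section WeakPartial

variable {n : ℕ} {Ω : Set (E n)} {k : Fin n}

lemma pd_eq_zero_of_notMem_tsupport {ψ : E n → ℝ} {z : E n} (hz : z ∉ tsupport ψ) :
    pd k ψ z = 0 := by
  rw [pd, image_eq_zero_of_notMem_tsupport (f := fderiv ℝ ψ)
    fun h => hz (tsupport_fderiv_subset ℝ h)]
  rfl

lemma setIntegral_mul_test_eq {f ψ : E n → ℝ} (h : tsupport ψ ⊆ Ω) :
    ∫ z in Ω, f z * ψ z = ∫ z, f z * ψ z :=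
  setIntegral_eq_integral_of_forall_compl_eq_zero fun z hz => by
    rw [image_eq_zero_of_notMem_tsupport fun h' => hz (h h'), mul_zero]

lemma setIntegral_mul_test_eq' {f ψ : E n → ℝ} (h : tsupport ψ ⊆ Ω) :
    ∫ z in Ω, f z * ψ z = ∫ z in tsupport ψ, f z * ψ z := by
  rw [setIntegral_mul_test_eq h, setIntegral_mul_test_eq subset_rfl]

lemma tsupport_pd_subset (ψ : E n → ℝ) : tsupport (pd k ψ) ⊆ tsupport ψ :=
  closure_minimal (fun z hz => by
    by_contra h
    exact hz (pd_eq_zero_of_notMem_tsupport h)) (isClosed_tsupport ψ)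

lemma contDiff_pd {ψ : E n → ℝ} (hψ : ContDiff ℝ ∞ ψ) : ContDiff ℝ ∞ (pd k ψ) :=
  (hψ.fderiv_right (m := ∞) (by simp)).clm_apply contDiff_const

lemma integrable_mul_test (hΩ : IsOpen Ω) {f ψ : E n → ℝ} (hf : ContinuousOn f Ω)
    (hψ : Continuous ψ) (hc : HasCompactSupport ψ) (h : tsupport ψ ⊆ Ω) :
    Integrable (fun z => f z * ψ z) := by
  have hcont : Continuous fun z => f z * ψ z := by
    refine continuous_of_tsupport fun z hz => ?_
    have hz' : z ∈ Ω := h (tsupport_mul_subset_right hz)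
    exact (hf.continuousAt (hΩ.mem_nhds hz')).mul hψ.continuousAt
  exact hcont.integrable_of_hasCompactSupport hc.mul_left

lemma hasWeakPartial_of_contDiffOn (hΩ : IsOpen Ω) {f : E n → ℝ} (hf : ContDiffOn ℝ ∞ f Ω) :
    HasWeakPartial Ω k f (pd k f) := by
  have hpd := (contDiffOn_pd hΩ hf k).continuousOn
  refine ⟨hf.continuousOn.locallyIntegrableOn hΩ.measurableSet,
    hpd.locallyIntegrableOn hΩ.measurableSet, fun ψ hψ hc hs => ?_⟩
  rw [setIntegral_mul_test_eq ((tsupport_pd_subset ψ).trans hs), setIntegral_mul_test_eq hs]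
  exact integral_mul_fderiv_eq_neg_fderiv_mul_of_integrable
    (integrable_mul_test hΩ hpd hψ.continuous hc hs)
    (integrable_mul_test hΩ hf.continuousOn (contDiff_pd hψ).continuous
      (hc.of_isClosed_subset (isClosed_tsupport _) (tsupport_pd_subset ψ))
      ((tsupport_pd_subset ψ).trans hs))
    (integrable_mul_test hΩ hf.continuousOn hψ.continuous hc hs)
    (fun z hz => (hf.contDiffAt (hΩ.mem_nhds (hs hz))).differentiableAt (by simp))
    (fun z _ => (hψ.differentiable (by simp)) z)

lemma LocallyIntegrableOn.integrable_mul_test {D ψ : E n → ℝ} (hΩ : IsOpen Ω)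
    (hD : LocallyIntegrableOn D Ω) (hψ : Continuous ψ) (hc : HasCompactSupport ψ)
    (hs : tsupport ψ ⊆ Ω) : IntegrableOn (fun z => D z * ψ z) Ω := by
  have h1 : IntegrableOn D (tsupport ψ) :=
    (locallyIntegrableOn_iff hΩ.isLocallyClosed).1 hD _ hs hc
  have h2 : IntegrableOn (fun z => D z * ψ z) (tsupport ψ) := by
    refine IntegrableOn.mul_continuousOn h1 hψ.continuousOn hc
  refine (integrableOn_iff_integrable_of_support_subset (fun z hz => ?_)).1 h2 |>.integrableOn
  by_contra h
  exact hz (by simp [image_eq_zero_of_notMem_tsupport h])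

/-- The difference integrates to zero against every test function, so the fundamental lemma of the
calculus of variations applies. This is what makes the arbitrarily chosen weak derivatives
computable. -/
lemma HasWeakPartial.ae_unique (hΩ : IsOpen Ω) {f D D' : E n → ℝ} (h : HasWeakPartial Ω k f D)
    (h' : HasWeakPartial Ω k f D') : D =ᵐ[volume.restrict Ω] D' := by
  have h1 : LocallyIntegrableOn (fun z => D z - D' z) Ω := h.2.1.sub h'.2.1
  have h2 := hΩ.ae_eq_zero_of_integral_contDiff_smul_eq_zero h1 fun ψ hψ hc hs => by
    have e1 := h.2.2 ψ hψ hc hs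
    have e2 := h'.2.2 ψ hψ hc hs
    have i1 := LocallyIntegrableOn.integrable_mul_test hΩ h.2.1 hψ.continuous hc hs
    have i2 := LocallyIntegrableOn.integrable_mul_test hΩ h'.2.1 hψ.continuous hc hs
    have e3 : ∫ z in Ω, (D z - D' z) * ψ z = 0 := by
      simp only [sub_mul]
      rw [integral_sub i1 i2]
      linarith
    rw [setIntegral_mul_test_eq hs] at e3
    simpa [mul_comm] using e3
  rw [Filter.EventuallyEq, ae_restrict_iff' hΩ.measurableSet]
  filter_upwards [h2] with z hz hzΩ
  linarith [hz hzΩ]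

lemma LpConv.locallyIntegrableOn (hΩ : IsOpen Ω) {f : ℝ → E n → ℝ} {F : E n → ℝ}
    (h : ∀ K ⊆ Ω, IsCompact K → LpConv (volume.restrict K) 1 f F) : LocallyIntegrableOn F Ω :=
  (locallyIntegrableOn_iff hΩ.isLocallyClosed).2 fun K hK hc =>
    memLp_one_iff_integrable.1 (h K hK hc).memLp

lemma LpConv.mul_test {f : ℝ → E n → ℝ} {F ψ : E n → ℝ} (hψ : Continuous ψ)
    (hc : HasCompactSupport ψ) {q : ℝ≥0∞} (hq : 1 ≤ q) {μ : Measure (E n)}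
    (h : LpConv μ q f F) :
    LpConv μ q (fun δ z => f δ z * ψ z) fun z => F z * ψ z := by
  obtain ⟨C, hC⟩ := hψ.bounded_above_of_compact_support hc
  exact h.mul (q := ⊤) hq (LpConv.const (memLp_top_of_bound hψ.aestronglyMeasurable C
    (Eventually.of_forall hC)))

/-- Both sides of the integration by parts identity are continuous under `L¹` convergence on the
support of the test function. All weak derivative formulas for the nonsmooth metric are obtained by
this passage from smooth metrics. -/
lemma HasWeakPartial.of_tendsto (hΩ : IsOpen Ω) {f D : ℝ → E n → ℝ} {F D₀ : E n → ℝ}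
    (h : ∀ᶠ δ in 𝓝[>] (0 : ℝ), HasWeakPartial Ω k (f δ) (D δ))
    (h1 : ∀ K ⊆ Ω, IsCompact K → LpConv (volume.restrict K) 1 f F)
    (h2 : ∀ K ⊆ Ω, IsCompact K → LpConv (volume.restrict K) 1 D D₀) :
    HasWeakPartial Ω k F D₀ := by
  refine ⟨LpConv.locallyIntegrableOn hΩ h1, LpConv.locallyIntegrableOn hΩ h2,
    fun ψ hψ hc hs => ?_⟩
  have hs' := (tsupport_pd_subset (k := k) ψ).trans hs
  have hc' : HasCompactSupport (pd k ψ) :=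
    hc.of_isClosed_subset (isClosed_tsupport _) (tsupport_pd_subset ψ)
  have t1 := ((h1 _ hs' hc').mul_test (contDiff_pd hψ).continuous hc' le_rfl).tendsto_integral
  have t2 := ((h2 _ hs hc).mul_test hψ.continuous hc le_rfl).tendsto_integral.neg
  rw [setIntegral_mul_test_eq' hs, setIntegral_mul_test_eq' hs']
  refine tendsto_nhds_unique_of_eventuallyEq t1 t2 ?_
  filter_upwards [h] with δ hδ
  rw [← setIntegral_mul_test_eq' hs, ← setIntegral_mul_test_eq' hs']
  exact hδ.2.2 ψ hψ hc hs

lemma HasWeakPartial.congr_ae (hΩ : IsOpen Ω) {f D D' : E n → ℝ} (h : HasWeakPartial Ω k f D)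
    (h' : D =ᵐ[volume.restrict Ω] D') : HasWeakPartial Ω k f D' := by
  refine ⟨h.1, ?_, fun ψ hψ hc hs => ?_⟩
  · refine (locallyIntegrableOn_iff hΩ.isLocallyClosed).2 fun K hK hc => ?_
    exact ((locallyIntegrableOn_iff hΩ.isLocallyClosed).1 h.2.1 K hK hc).congr
      (ae_restrict_of_ae_restrict_of_subset hK h')
  · rw [h.2.2 ψ hψ hc hs]
    congr 1
    refine integral_congr_ae ?_
    filter_upwards [h'] with z hz
    rw [hz]

end WeakPartial

/-! ### Derivatives of inverses, determinants and densities. -/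

section MatrixCalculus

variable {n : ℕ} {z : E n} {k : Fin n}

lemma pd_mul {f g : E n → ℝ} (hf : DifferentiableAt ℝ f z) (hg : DifferentiableAt ℝ g z) :
    pd k (fun w => f w * g w) z = pd k f z * g z + f z * pd k g z := by
  simp only [pd]
  rw [fderiv_fun_mul hf hg]
  simp
  ring

lemma pd_sum {ι : Type*} (s : Finset ι) {f : ι → E n → ℝ}
    (hf : ∀ i, DifferentiableAt ℝ (f i) z) :
    pd k (fun w => ∑ i ∈ s, f i w) z = ∑ i ∈ s, pd k (f i) z := by
  simp only [pd]
  rw [fderiv_fun_sum fun i _ => hf i]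
  simp

/-- The matrix of the derivatives of the entries. -/
def pdMat {ι : Type*} (k : Fin n) (A : E n → Matrix ι ι ℝ) (z : E n) : Matrix ι ι ℝ :=
  Matrix.of fun i j => pd k (fun w => A w i j) z

variable {ι : Type*} [Fintype ι] {A : E n → Matrix ι ι ℝ}

lemma pdMat_mul {B : E n → Matrix ι ι ℝ} (hA : ∀ i j, DifferentiableAt ℝ (fun w => A w i j) z)
    (hB : ∀ i j, DifferentiableAt ℝ (fun w => B w i j) z) :
    pdMat k (fun w => A w * B w) z = pdMat k A z * B z + A z * pdMat k B z := by
  ext i j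
  simp only [pdMat, Matrix.of_apply, Matrix.mul_apply, Matrix.add_apply]
  rw [pd_sum _ fun l => (hA i l).fun_mul (hB l j), ← Finset.sum_add_distrib]
  exact Finset.sum_congr rfl fun l _ => pd_mul (hA i l) (hB l j)

variable [DecidableEq ι]

/-- Differentiate `A * A⁻¹ = 1`, which holds near `z`, and multiply by `A⁻¹` from the left. -/
lemma pdMat_inv (hA : ∀ i j, DifferentiableAt ℝ (fun w => A w i j) z)
    (hA' : ∀ i j, DifferentiableAt ℝ (fun w => (A w)⁻¹ i j) z)
    (hdet : ∀ᶠ w in 𝓝 z, (A w).det ≠ 0) :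
    pdMat k (fun w => (A w)⁻¹) z = -((A z)⁻¹ * pdMat k A z * (A z)⁻¹) := by
  have h0 := isUnit_iff_ne_zero.2 hdet.self_of_nhds
  have h1 := pdMat_mul (k := k) hA hA'
  have h2 : pdMat k (fun w => A w * (A w)⁻¹) z = 0 := by
    ext i j
    have : (fun w => (A w * (A w)⁻¹) i j) =ᶠ[𝓝 z] fun _ => (1 : Matrix ι ι ℝ) i j := by
      filter_upwards [hdet] with w hw
      rw [Matrix.mul_nonsing_inv _ (isUnit_iff_ne_zero.2 hw)]
    simp only [pdMat, Matrix.of_apply, pd]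
    rw [this.fderiv_eq]
    simp
  rw [h2] at h1
  have h3 := congrArg (fun B => (A z)⁻¹ * B) h1
  simp only [Matrix.mul_zero, Matrix.mul_add, ← Matrix.mul_assoc, Matrix.nonsing_inv_mul _ h0,
    Matrix.one_mul] at h3
  exact (neg_eq_of_add_eq_zero_right h3.symm).symm

/-- Jacobi's formula: on the line `B + rH` the determinant is `det B` times `det (1 + r B⁻¹H)`, and
the latter is `1 + r tr(B⁻¹H)` up to a multiple of `r²`. -/
lemma fderiv_det {B : ι → ι → ℝ} (hB : (Matrix.of B).det ≠ 0) (H : ι → ι → ℝ) :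
    fderiv ℝ (fun C : ι → ι → ℝ => (Matrix.of C).det) B H
      = (Matrix.of B).det * ((Matrix.of B)⁻¹ * Matrix.of H).trace := by
  have hd : DifferentiableAt ℝ (fun C : ι → ι → ℝ => (Matrix.of C).det) B := by
    have := contDiffOn_det (m := 1) (s := univ) (A := fun C : ι → ι → ℝ => Matrix.of C)
      fun i j => (contDiff_apply_apply ℝ ℝ i j).contDiffOn
    exact (contDiffOn_univ.1 this).differentiable (by simp) B
  have h1 : HasDerivAt (fun r : ℝ => B + r • H) H 0 := by
    simpa using ((hasDerivAt_id (0 : ℝ)).smul_const H).const_add B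
  have h0 : HasFDerivAt (fun C : ι → ι → ℝ => (Matrix.of C).det)
      (fderiv ℝ (fun C : ι → ι → ℝ => (Matrix.of C).det) B) (B + (0 : ℝ) • H) := by
    simpa using hd.hasFDerivAt
  have h2 := h0.comp_hasDerivAt (0 : ℝ) h1
  set Mx := (Matrix.of B)⁻¹ * Matrix.of H with hM
  have h3 : ∀ r : ℝ, (Matrix.of (B + r • H)).det = (Matrix.of B).det * (1 + r • Mx).det := by
    intro r
    rw [← Matrix.det_mul, Matrix.mul_add, Matrix.mul_smul, hM, ← Matrix.mul_assoc,
      Matrix.mul_nonsing_inv _ (isUnit_iff_ne_zero.2 hB)]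
    simp only [Matrix.mul_one, Matrix.one_mul]
    rfl
  have h4 : HasDerivAt (fun r : ℝ => (Matrix.of (B + r • H)).det)
      ((Matrix.of B).det * Mx.trace) 0 := by
    rw [show (fun r : ℝ => (Matrix.of (B + r • H)).det) = _ from
      funext fun r => (h3 r).trans (congrArg _ (Matrix.det_one_add_smul r Mx))]
    set p := ((1 + (Polynomial.X : Polynomial ℝ) • Mx.map Polynomial.C).det.divX.divX)
    have := (((hasDerivAt_id (0 : ℝ)).const_mul Mx.trace).const_add 1).add
      ((p.hasDerivAt 0).mul ((hasDerivAt_id (0 : ℝ)).pow 2))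
    refine (this.const_mul (Matrix.of B).det).congr_deriv ?_
    simp
  exact h2.unique h4

lemma pd_det (hA : ∀ i j, DifferentiableAt ℝ (fun w => A w i j) z) (hdet : (A z).det ≠ 0) :
    pd k (fun w => (A w).det) z = (A z).det * ((A z)⁻¹ * pdMat k A z).trace := by
  have hd : DifferentiableAt ℝ (fun C : ι → ι → ℝ => (Matrix.of C).det) (fun i j => A z i j) := by
    have := contDiffOn_det (m := 1) (s := univ) (A := fun C : ι → ι → ℝ => Matrix.of C)
      fun i j => (contDiff_apply_apply ℝ ℝ i j).contDiffOn
    exact (contDiffOn_univ.1 this).differentiable (by simp) _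
  have h1 : HasFDerivAt (fun w => fun i j => A w i j) (ContinuousLinearMap.pi fun i =>
      ContinuousLinearMap.pi fun j => fderiv ℝ (fun w => A w i j) z) z :=
    hasFDerivAt_pi.2 fun i => hasFDerivAt_pi.2 fun j => (hA i j).hasFDerivAt
  have h2 := hd.hasFDerivAt.comp z h1
  have h3 : pd k (fun w => (A w).det) z = _ :=
    congrArg (fun L : E n →L[ℝ] ℝ => L (EuclideanSpace.single k 1)) h2.fderiv
  rw [h3, ContinuousLinearMap.comp_apply, fderiv_det hdet]
  rfl

/-- The hypotheses give the derivatives in logarithmic form, matching Jacobi's formula; `f` and `g`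
will be the determinants of two metrics. -/
lemma pd_sqrt_div {f g : E n → ℝ} (hf : DifferentiableAt ℝ f z) (hg : DifferentiableAt ℝ g z)
    (hf0 : 0 < f z) (hg0 : 0 < g z) {a b : ℝ} (ha : pd k f z = f z * a) (hb : pd k g z = g z * b) :
    pd k (fun w => √(f w / g w)) z = 1 / 2 * √(f z / g z) * (a - b) := by
  have h1 : HasFDerivAt (fun w => f w / g w) _ z :=
    hf.hasFDerivAt.mul ((hasDerivAt_inv hg0.ne').comp_hasFDerivAt z hg.hasFDerivAt)
  have hpos : 0 < f z / g z := div_pos hf0 hg0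
  have h2 := h1.sqrt hpos.ne'
  have h3 : pd k (fun w => √(f w / g w)) z = _ :=
    congrArg (fun L : E n →L[ℝ] ℝ => L (EuclideanSpace.single k 1)) h2.fderiv
  rw [h3]
  simp only [pd] at ha hb
  simp only [smul_apply, add_apply, smul_eq_mul, ha, hb]
  have h4 : √(f z / g z) ≠ 0 := (Real.sqrt_pos.2 hpos).ne'
  have h5 : √(f z / g z) * √(f z / g z) = f z / g z := Real.mul_self_sqrt hpos.le
  have h7 := hg0.ne'
  have h8 : f z * (-(g z ^ 2)⁻¹ * (g z * b)) + (g z)⁻¹ * (f z * a) = (f z / g z) * (a - b) := by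
    field_simp
    ring
  rw [h8]
  generalize √(f z / g z) = q at *
  rw [← h5]
  field_simp

end MatrixCalculus

/-- A trilinear map from a function that is linear in each argument. -/
def trilinearMk {U V W : Type*} [AddCommGroup U] [Module ℝ U] [AddCommGroup V] [Module ℝ V]
    [AddCommGroup W] [Module ℝ W] (f : U → V → W → ℝ)
    (h1 : ∀ v w, IsLinearMap ℝ fun u => f u v w) (h2 : ∀ u w, IsLinearMap ℝ fun v => f u v w)
    (h3 : ∀ u v, IsLinearMap ℝ fun w => f u v w) : U →ₗ[ℝ] V →ₗ[ℝ] W →ₗ[ℝ] ℝ :=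
  LinearMap.mk₂ ℝ (fun u v => (h3 u v).mk')
    (fun u u' v => LinearMap.ext fun w => (h1 v w).map_add u u')
    (fun c u v => LinearMap.ext fun w => (h1 v w).map_smul c u)
    (fun u v v' => LinearMap.ext fun w => (h2 u w).map_add v v')
    (fun c u v => LinearMap.ext fun w => (h2 u w).map_smul c v)

/-! ### Classical formulas for smooth metrics. -/

section SmoothMetrics

variable {n : ℕ} {M : Type*} [TopologicalSpace M] [ChartedSpace (E n) M]
  {φ : OpenPartialHomeomorph M (E n)}

lemma gram_inv_symm {g : Tensor2 n M} (hg : IsMetric g) (z : E n) (i j : Fin n) :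
    (gram φ g z)⁻¹ i j = (gram φ g z)⁻¹ j i := by
  have h1 : (gram φ g z).transpose = gram φ g z := by
    ext a b
    exact gram_symm hg z b a
  conv_rhs => rw [← h1, ← Matrix.transpose_nonsing_inv]
  rfl

lemma weakCovDeriv_spec {h S : Tensor2 n M} (H : ∃ T, HasWeakCovDeriv h S T) :
    HasWeakCovDeriv h S (weakCovDeriv h S) := by
  rw [weakCovDeriv, dif_pos H]
  exact H.choose_spec

lemma weakCovDerivInv_spec {h g : Tensor2 n M} (H : ∃ P, HasWeakCovDerivInv h g P) :
    HasWeakCovDerivInv h g (weakCovDerivInv h g) := by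
  rw [weakCovDerivInv, dif_pos H]
  exact H.choose_spec

lemma weakDiff_spec {f : M → ℝ} (H : ∃ α : Covector n M, HasWeakDiff f α) :
    HasWeakDiff f (weakDiff f : Covector n M) := by
  rw [weakDiff, dif_pos H]
  exact H.choose_spec

variable [IsManifold (𝓡 n) ∞ M]

lemma isLinearMap_comp_clm {f : E n → ℝ} (hf : IsLinearMap ℝ f) (L : E n →L[ℝ] E n) :
    IsLinearMap ℝ fun v => f (L v) :=
  ⟨fun a b => by rw [map_add, hf.map_add], fun c a => by rw [map_smul, hf.map_smul]⟩

/-- The covariant derivative of a smooth `(0,2)`-tensor field. -/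
def covDTensor (h S : Tensor2 n M) : Tensor3 n M := fun x =>
  trilinearMk (U := E n) (V := E n) (W := E n) (fun u v w =>
      covD (chartAt (E n) x) h S (chartAt (E n) x x) (coframeMap (chartAt (E n) x) (chartAt (E n) x x) u)
        (coframeMap (chartAt (E n) x) (chartAt (E n) x x) v)
        (coframeMap (chartAt (E n) x) (chartAt (E n) x x) w))
    (fun _ _ => isLinearMap_comp_clm ((covD_linear _ h S _).1 _ _) _)
    (fun _ _ => isLinearMap_comp_clm ((covD_linear _ h S _).2.1 _ _) _)
    (fun _ _ => isLinearMap_comp_clm ((covD_linear _ h S _).2.2 _ _) _)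

/-- The tensor is defined through the preferred chart at each point, and `covD_transition` carries
its components to any other chart. -/
lemma comp3_covDTensor (hφ : φ ∈ atlas (E n) M) (h S : SmoothMetric n M) {z : E n}
    (hz : z ∈ φ.target) (k i j : Fin n) :
    comp3 φ (covDTensor h.inner S.inner) z k i j = covD φ h.inner S.inner z
      (EuclideanSpace.single k 1) (EuclideanSpace.single i 1) (EuclideanSpace.single j 1) := by
  set ψ := chartAt (E n) (φ.symm z) with hψ
  have hψa : ψ ∈ atlas (E n) M := chart_mem_atlas _ _
  have ho : z ∈ overlap ψ φ := ⟨hz, mem_chart_source _ _⟩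
  have hC : ∀ v, coframeMap ψ (transition ψ φ z) (frameMap φ z v)
      = fderiv ℝ (transition ψ φ) z v := fun v => by
    rw [frameMap_eq_comp hψa hφ ho]
    exact DFunLike.congr_fun (coframeMap_comp_frameMap hψa (transition_mem ho)) _
  rw [covD_transition hψa hφ h S ho, ← hC, ← hC, ← hC]
  rfl

lemma covD_single (hφ : φ ∈ atlas (E n) M) (h : Tensor2 n M) (S : SmoothMetric n M) {z : E n}
    (hz : z ∈ φ.target) (k i j : Fin n) :
    covD φ h S.inner z (EuclideanSpace.single k 1) (EuclideanSpace.single i 1)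
      (EuclideanSpace.single j 1) = pd k (fun w => gram φ S.inner w i j) z
        - ∑ l, christoffel φ h l k i z * gram φ S.inner z l j
        - ∑ l, christoffel φ h l k j z * gram φ S.inner z i l := by
  rw [pd_gram hφ S hz, covD, chr_single, chr_single]
  simp [bilMap_single]

lemma hasWeakCovDeriv_smooth (h S : SmoothMetric n M) :
    HasWeakCovDeriv h.inner S.inner (covDTensor h.inner S.inner) := by
  intro φ hφ k i j
  refine (hasWeakPartial_of_contDiffOn φ.open_target
    (contDiffOn_gram_apply hφ S i j)).congr_ae φ.open_target ?_
  filter_upwards [ae_restrict_mem φ.open_target.measurableSet] with z hz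
  rw [comp3_covDTensor hφ h S hz, covD_single hφ h.inner S hz]
  ring

/-- The definitions use some chosen weak derivative; by uniqueness it has the classical components
off a null set. -/
lemma comp3_weakCovDeriv_ae (hφ : φ ∈ atlas (E n) M) (h S : SmoothMetric n M) (k i j : Fin n) :
    (fun z => comp3 φ (weakCovDeriv h.inner S.inner) z k i j) =ᵐ[volume.restrict φ.target]
      fun z => covD φ h.inner S.inner z (EuclideanSpace.single k 1) (EuclideanSpace.single i 1)
        (EuclideanSpace.single j 1) := by
  have h1 := weakCovDeriv_spec ⟨_, hasWeakCovDeriv_smooth h S⟩ φ hφ k i j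
  have h2 := hasWeakCovDeriv_smooth h S φ hφ k i j
  filter_upwards [h1.ae_unique φ.open_target h2, ae_restrict_mem φ.open_target.measurableSet]
    with z hz hzt
  rw [← comp3_covDTensor hφ h S hzt]
  linarith

/-- The matrix of the covariant derivative in the direction `k`. -/
def covMat (φ : OpenPartialHomeomorph M (E n)) (h S : Tensor2 n M) (k : Fin n) (z : E n) :
    Matrix (Fin n) (Fin n) ℝ :=
  Matrix.of fun i j => covD φ h S z (EuclideanSpace.single k 1) (EuclideanSpace.single i 1)
    (EuclideanSpace.single j 1)

/-- The matrix `Γ^l_ki` of the Christoffel symbols in the direction `k`. -/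
def chrMat (φ : OpenPartialHomeomorph M (E n)) (h : Tensor2 n M) (k : Fin n) (z : E n) :
    Matrix (Fin n) (Fin n) ℝ :=
  Matrix.of fun l i => christoffel φ h l k i z

lemma differentiableAt_gram_apply (hφ : φ ∈ atlas (E n) M) (S : SmoothMetric n M) {z : E n}
    (hz : z ∈ φ.target) (i j : Fin n) : DifferentiableAt ℝ (fun w => gram φ S.inner w i j) z :=
  ((contDiffOn_gram_apply hφ S i j).contDiffAt (φ.open_target.mem_nhds hz)).differentiableAt
    (by simp)

lemma differentiableAt_gram_inv_apply (hφ : φ ∈ atlas (E n) M) (S : SmoothMetric n M) {z : E n}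
    (hz : z ∈ φ.target) (i j : Fin n) :
    DifferentiableAt ℝ (fun w => (gram φ S.inner w)⁻¹ i j) z :=
  ((contDiffOn_gram_inv hφ S i j).contDiffAt (φ.open_target.mem_nhds hz)).differentiableAt
    (by simp)

lemma differentiableAt_det_gram (hφ : φ ∈ atlas (E n) M) (S : SmoothMetric n M) {z : E n}
    (hz : z ∈ φ.target) : DifferentiableAt ℝ (fun w => (gram φ S.inner w).det) z :=
  ((contDiffOn_det (contDiffOn_gram_apply hφ S)).contDiffAt
    (φ.open_target.mem_nhds hz)).differentiableAt (by simp)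

/-- Matrix form of `∂_k g = ∇_k g + Cᵀ g + g C`, where the terms with `C` cancel or commute under
traces and conjugation by the inverse. -/
lemma pdMat_gram (hφ : φ ∈ atlas (E n) M) (h : Tensor2 n M) (S : SmoothMetric n M) {z : E n}
    (hz : z ∈ φ.target) (k : Fin n) :
    pdMat k (gram φ S.inner) z = covMat φ h S.inner k z
      + (chrMat φ h k z).transpose * gram φ S.inner z + gram φ S.inner z * chrMat φ h k z := by
  ext i j
  simp only [pdMat, covMat, chrMat, Matrix.of_apply, Matrix.add_apply, Matrix.mul_apply,
    Matrix.transpose_apply, covD_single hφ h S hz]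
  simp only [mul_comm]
  ring

/-- Metric compatibility of the Levi-Civita connection: the Christoffel formulas with the first two
or the outer two indices paired add up to `∂_k h_ij`. -/
lemma covMat_self (hφ : φ ∈ atlas (E n) M) (h : SmoothMetric n M) {z : E n}
    (hz : z ∈ φ.target) (k : Fin n) : covMat φ h.inner h.inner k z = 0 := by
  have hh := isMetric_smooth h
  ext i j
  simp only [covMat, Matrix.of_apply, covD_single hφ h.inner h hz, Matrix.zero_apply]
  have h1 := sum_gram_mul_christoffel hh hφ hz k i j
  have h2 := sum_gram_mul_christoffel hh hφ hz k j i
  simp only [gram_symm hh _ j i, gram_symm hh _ k i, gram_symm hh _ j] at h1 h2 ⊢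
  simp only [gram_symm hh _ i] at h1 h2 ⊢
  simp only [mul_comm] at h1 h2 ⊢
  linarith

/-- Conjugating the matrix form of `∂_k g` by `-g⁻¹` yields `-g⁻¹ (∇̃_k g) g⁻¹` together with
Christoffel terms for raised indices. The right side contains no derivative of the inverse, so it
can be passed to the limit. -/
lemma pd_gram_inv (hφ : φ ∈ atlas (E n) M) (h : Tensor2 n M) (S : SmoothMetric n M) {z : E n}
    (hz : z ∈ φ.target) (k i j : Fin n) :
    pd k (fun w => (gram φ S.inner w)⁻¹ i j) z
      = -∑ a, ∑ b, (gram φ S.inner z)⁻¹ i a * (gram φ S.inner z)⁻¹ j b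
          * covD φ h S.inner z (EuclideanSpace.single k 1) (EuclideanSpace.single a 1)
            (EuclideanSpace.single b 1)
        - ∑ l, christoffel φ h i k l z * (gram φ S.inner z)⁻¹ l j
        - ∑ l, christoffel φ h j k l z * (gram φ S.inner z)⁻¹ i l := by
  have hS := isMetric_smooth S
  have hu := isUnit_iff_ne_zero.2 (det_gram_pos hS hφ hz).ne'
  have h1 := pdMat_inv (k := k) (A := gram φ S.inner) (differentiableAt_gram_apply hφ S hz)
    (differentiableAt_gram_inv_apply hφ S hz) (by
      filter_upwards [φ.open_target.mem_nhds hz] with w hw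
      exact (det_gram_pos hS hφ hw).ne')
  rw [pdMat_gram hφ h S hz] at h1
  set G := gram φ S.inner z with hG
  set C := chrMat φ h k z with hC
  have h2 : -(G⁻¹ * (covMat φ h S.inner k z + C.transpose * G + G * C) * G⁻¹)
      = -(G⁻¹ * covMat φ h S.inner k z * G⁻¹) - C * G⁻¹ - G⁻¹ * C.transpose := by
    have e1 : G⁻¹ * (C.transpose * G) * G⁻¹ = G⁻¹ * C.transpose := by
      rw [← Matrix.mul_assoc, Matrix.mul_assoc, Matrix.mul_nonsing_inv _ hu, Matrix.mul_one]
    have e2 : G⁻¹ * (G * C) * G⁻¹ = C * G⁻¹ := by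
      rw [← Matrix.mul_assoc, Matrix.nonsing_inv_mul _ hu, Matrix.one_mul]
    rw [Matrix.mul_add, Matrix.mul_add, Matrix.add_mul, Matrix.add_mul, e1, e2]
    abel
  have h3 := congrFun (congrFun (h1.trans h2) i) j
  refine h3.trans ?_
  simp only [Matrix.sub_apply, Matrix.neg_apply, Matrix.mul_apply, Matrix.transpose_apply,
    Finset.sum_mul, C, chrMat, covMat, Matrix.of_apply]
  rw [Finset.sum_comm]
  refine congrArg₂ (· - ·) (congrArg₂ (· - ·) (congrArg Neg.neg ?_) rfl) ?_
  · refine Finset.sum_congr rfl fun a _ => Finset.sum_congr rfl fun b _ => ?_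
    rw [gram_inv_symm hS z j b]
    ring
  · exact Finset.sum_congr rfl fun l _ => mul_comm _ _

/-- Jacobi's formula for both determinants. The traces of the background Christoffel symbols are the
same for `S` and `h` and cancel, and `∇̃h = 0`, so only the trace of `∇̃S` is left. -/
lemma pd_volRatio (hφ : φ ∈ atlas (E n) M) (h S : SmoothMetric n M) {z : E n}
    (hz : z ∈ φ.target) (k : Fin n) :
    pd k (fun w => √((gram φ S.inner w).det / (gram φ h.inner w).det)) z
      = 1 / 2 * √((gram φ S.inner z).det / (gram φ h.inner z).det)
        * ∑ i, ∑ j, (gram φ S.inner z)⁻¹ i j * covD φ h.inner S.inner z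
          (EuclideanSpace.single k 1) (EuclideanSpace.single i 1) (EuclideanSpace.single j 1) := by
  have key : ∀ S : SmoothMetric n M,
      ((gram φ S.inner z)⁻¹ * pdMat k (gram φ S.inner) z).trace
        = ((gram φ S.inner z)⁻¹ * covMat φ h.inner S.inner k z).trace
          + 2 * (chrMat φ h.inner k z).trace := by
    intro S
    have hu := isUnit_iff_ne_zero.2 (det_gram_pos (isMetric_smooth S) hφ hz).ne'
    rw [pdMat_gram hφ h.inner S hz, Matrix.mul_add, Matrix.mul_add, Matrix.trace_add,
      Matrix.trace_add, ← Matrix.mul_assoc _ (gram φ S.inner z), Matrix.nonsing_inv_mul _ hu,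
      Matrix.one_mul, Matrix.trace_mul_comm _ (_ * gram φ S.inner z), Matrix.mul_assoc,
      Matrix.mul_nonsing_inv _ hu, Matrix.mul_one, Matrix.trace_transpose]
    ring
  have hS0 := det_gram_pos (isMetric_smooth S) hφ hz
  have hh0 := det_gram_pos (isMetric_smooth h) hφ hz
  rw [pd_sqrt_div (differentiableAt_det_gram hφ S hz) (differentiableAt_det_gram hφ h hz) hS0 hh0
    (pd_det (differentiableAt_gram_apply hφ S hz) hS0.ne')
    (pd_det (differentiableAt_gram_apply hφ h hz) hh0.ne'), key, key, covMat_self hφ h hz]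
  simp only [Matrix.mul_zero, Matrix.trace_zero, zero_add, add_sub_cancel_right]
  congr 1
  simp only [Matrix.trace, Matrix.diag, Matrix.mul_apply, covMat, Matrix.of_apply]
  rw [Finset.sum_comm]
  refine Finset.sum_congr rfl fun a _ => Finset.sum_congr rfl fun b _ => ?_
  rw [gram_inv_symm (isMetric_smooth S) z b a]

end SmoothMetrics

lemma isFiniteMeasure_restrict {X : Type*} [TopologicalSpace X] [MeasurableSpace X] {μ : Measure X}
    [IsFiniteMeasureOnCompacts μ] {K : Set X} (hK : IsCompact K) : IsFiniteMeasure (μ.restrict K) :=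
  ⟨by rw [Measure.restrict_apply_univ]; exact hK.measure_lt_top⟩

lemma HasWeakPartial.congr_fun {n : ℕ} {Ω : Set (E n)} {k : Fin n} (hΩ : IsOpen Ω)
    {f f' D : E n → ℝ} (h : HasWeakPartial Ω k f D) (hf : EqOn f f' Ω) :
    HasWeakPartial Ω k f' D := by
  refine ⟨?_, h.2.1, fun ψ hψ hc hs => ?_⟩
  · refine (locallyIntegrableOn_iff hΩ.isLocallyClosed).2 fun K hK hc => ?_
    exact ((locallyIntegrableOn_iff hΩ.isLocallyClosed).1 h.1 K hK hc).congr_fun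
      (fun z hz => hf (hK hz)) hc.measurableSet
  · rw [← h.2.2 ψ hψ hc hs]
    exact setIntegral_congr_fun hΩ.measurableSet fun z hz => by rw [hf hz]

/-! ### Approximation in charts and the inverse metric. -/

section Approximation

variable {n : ℕ} {M : Type*} [TopologicalSpace M] [ChartedSpace (E n) M]
  {φ : OpenPartialHomeomorph M (E n)}

/-- The density of `g` with respect to `h` in a chart. -/
def rho (φ : OpenPartialHomeomorph M (E n)) (h g : Tensor2 n M) (z : E n) : ℝ :=
  √((gram φ g z).det / (gram φ h z).det)

/-- The components of the chosen weak covariant derivative. -/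
def wcd (φ : OpenPartialHomeomorph M (E n)) (h g : Tensor2 n M) (z : E n) (k i j : Fin n) : ℝ :=
  comp3 φ (weakCovDeriv h g) z k i j

/-- The trace `g^{ij} ∇̃_k g_ij`. -/
def trT (φ : OpenPartialHomeomorph M (E n)) (h g : Tensor2 n M) (k : Fin n) (z : E n) : ℝ :=
  ∑ i, ∑ j, (gram φ g z)⁻¹ i j * wcd φ h g z k i j

variable [IsManifold (𝓡 n) ∞ M]

/-- The smooth metrics `gδ` approximate the metric `g` in `C⁰ ∩ W^{1,n}`, locally in charts. -/
structure Approx (h : SmoothMetric n M) (g : Tensor2 n M) (gδ : ℝ → SmoothMetric n M) : Prop where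
  metric : IsMetric g
  exT : ∃ T, HasWeakCovDeriv h.inner g T
  gramConv : ∀ φ ∈ atlas (E n) M, ∀ K ⊆ φ.target, IsCompact K → ∀ i j,
    ContConv K (fun δ z => gram φ (gδ δ).inner z i j) fun z => gram φ g z i j
  tConv : ∀ φ ∈ atlas (E n) M, ∀ K ⊆ φ.target, IsCompact K → ∀ k i j,
    LpConv (volume.restrict K) n (fun δ z => wcd φ h.inner (gδ δ).inner z k i j)
      fun z => wcd φ h.inner g z k i j

lemma contDiffOn_covD_single (hφ : φ ∈ atlas (E n) M) (h S : SmoothMetric n M) (k i j : Fin n) :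
    ContDiffOn ℝ ∞ (fun z => covD φ h.inner S.inner z (EuclideanSpace.single k 1)
      (EuclideanSpace.single i 1) (EuclideanSpace.single j 1)) φ.target := by
  refine ContDiffOn.congr ?_ fun z hz => covD_single hφ h.inner S hz k i j
  exact ((contDiffOn_pd φ.open_target (contDiffOn_gram_apply hφ S i j) k).sub
    (ContDiffOn.sum fun l _ => (contDiffOn_christoffel hφ h l k i).mul
      (contDiffOn_gram_apply hφ S l j))).sub
    (ContDiffOn.sum fun l _ => (contDiffOn_christoffel hφ h l k j).mul
      (contDiffOn_gram_apply hφ S i l))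

/-- A smooth metric approximates itself by a constant family, so every result about the limit metric
also applies to each `gδ`. -/
lemma Approx.const (h S : SmoothMetric n M) : Approx h S.inner fun _ => S where
  metric := isMetric_smooth S
  exT := ⟨_, hasWeakCovDeriv_smooth h S⟩
  gramConv φ hφ K hK _ i j :=
    ContConv.const ((contDiffOn_gram_apply hφ S i j).continuousOn.mono hK)
  tConv φ hφ K hK hc k i j := by
    refine LpConv.const ?_
    have := isFiniteMeasure_restrict (μ := (volume : Measure (E n))) hc
    have h1 := ((contDiffOn_covD_single hφ h S k i j).continuousOn.mono hK)
    obtain ⟨C, hC⟩ := hc.exists_bound_of_continuousOn h1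
    refine (memLp_congr_ae (ae_restrict_of_ae_restrict_of_subset hK
      (comp3_weakCovDeriv_ae hφ h S k i j))).2 (MemLp.of_bound
        (h1.aestronglyMeasurable hc.measurableSet) C ?_)
    exact (ae_restrict_mem hc.measurableSet).mono hC

namespace Approx

variable {h : SmoothMetric n M} {g : Tensor2 n M} {gδ : ℝ → SmoothMetric n M} {K : Set (E n)}

lemma invConv (H : Approx h g gδ) (hφ : φ ∈ atlas (E n) M) (hK : K ⊆ φ.target)
    (hc : IsCompact K) (i j : Fin n) :
    ContConv K (fun δ z => (gram φ (gδ δ).inner z)⁻¹ i j) fun z => (gram φ g z)⁻¹ i j :=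
  (ContConv.matrix (H.gramConv φ hφ K hK hc)).matrix_inv
    (fun _ hz => (det_gram_pos H.metric hφ (hK hz)).ne')
    (fun δ _ _ hz => (det_gram_pos (isMetric_smooth (gδ δ)) hφ (hK hz)).ne') i j

lemma rhoConv (H : Approx h g gδ) (hφ : φ ∈ atlas (E n) M) (hK : K ⊆ φ.target)
    (hc : IsCompact K) : ContConv K (fun δ => rho φ h.inner (gδ δ).inner) (rho φ h.inner g) := by
  have h1 : ContConv K (fun _ z => ((gram φ h.inner z).det)⁻¹)
      fun z => ((gram φ h.inner z).det)⁻¹ :=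
    ContConv.const (((contDiffOn_det (contDiffOn_gram_apply hφ h)).continuousOn.mono hK).inv₀
      fun z hz => (det_gram_pos (isMetric_smooth h) hφ (hK hz)).ne')
  exact ((ContConv.matrix (H.gramConv φ hφ K hK hc)).det.mul h1).comp (Φ := Real.sqrt)
    (fun _ _ => Real.continuous_sqrt.continuousAt)
    fun _ _ _ _ => Real.continuous_sqrt.continuousAt

lemma inv_top (H : Approx h g gδ) (hφ : φ ∈ atlas (E n) M) (hK : K ⊆ φ.target)
    (hc : IsCompact K) (i j : Fin n) : LpConv (volume.restrict K) ⊤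
      (fun δ z => (gram φ (gδ δ).inner z)⁻¹ i j) fun z => (gram φ g z)⁻¹ i j :=
  (H.invConv hφ hK hc i j).lpConv_top hc hc.measurableSet

lemma rho_top (H : Approx h g gδ) (hφ : φ ∈ atlas (E n) M) (hK : K ⊆ φ.target)
    (hc : IsCompact K) : LpConv (volume.restrict K) ⊤
      (fun δ => rho φ h.inner (gδ δ).inner) (rho φ h.inner g) :=
  (H.rhoConv hφ hK hc).lpConv_top hc hc.measurableSet

lemma trTConv (H : Approx h g gδ) (hn : 1 ≤ (n : ℝ≥0∞)) (hφ : φ ∈ atlas (E n) M)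
    (hK : K ⊆ φ.target) (hc : IsCompact K) (k : Fin n) :
    LpConv (volume.restrict K) n (fun δ => trT φ h.inner (gδ δ).inner k) (trT φ h.inner g k) :=
  LpConv.sum _ hn fun i => LpConv.sum _ hn fun j =>
    (H.inv_top hφ hK hc i j).mul hn (H.tConv φ hφ K hK hc k i j)

end Approx

lemma lpConv_const_of_continuousOn {K : Set (E n)} (hc : IsCompact K) {F : E n → ℝ}
    (hF : ContinuousOn F K) :
    LpConv (volume.restrict K) ⊤ (fun _ => F) F :=
  (ContConv.const hF).lpConv_top hc hc.measurableSet

/-- The formula for the components of the derivative of the inverse metric. -/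
def invD (φ : OpenPartialHomeomorph M (E n)) (h g : Tensor2 n M) (z : E n) (k i j : Fin n) : ℝ :=
  -∑ a, ∑ b, (gram φ g z)⁻¹ i a * (gram φ g z)⁻¹ j b * wcd φ h g z k a b

namespace Approx

variable {h : SmoothMetric n M} {g : Tensor2 n M} {gδ : ℝ → SmoothMetric n M} {K : Set (E n)}

lemma invDConv (H : Approx h g gδ) (hn : 1 ≤ (n : ℝ≥0∞)) (hφ : φ ∈ atlas (E n) M)
    (hK : K ⊆ φ.target) (hc : IsCompact K) (k i j : Fin n) :
    LpConv (volume.restrict K) n (fun δ z => invD φ h.inner (gδ δ).inner z k i j)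
      fun z => invD φ h.inner g z k i j :=
  (LpConv.sum _ hn fun a => LpConv.sum _ hn fun b =>
    (((H.inv_top hφ hK hc i a).mul (r := ⊤) le_top (H.inv_top hφ hK hc j b)).mul hn
      (H.tConv φ hφ K hK hc k a b))).neg

/-- The smooth formula `pd_gram_inv` holds almost everywhere for each approximating metric, and all
its terms converge in `L¹` on compact sets. -/
lemma hasWeakPartial_inv (H : Approx h g gδ) (hn : 1 ≤ (n : ℝ≥0∞)) (hφ : φ ∈ atlas (E n) M)
    (k i j : Fin n) :
    HasWeakPartial φ.target k (fun z => (gram φ g z)⁻¹ i j) (fun z => invD φ h.inner g z k i j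
        - ∑ l, christoffel φ h.inner i k l z * (gram φ g z)⁻¹ l j
        - ∑ l, christoffel φ h.inner j k l z * (gram φ g z)⁻¹ i l) := by
  refine HasWeakPartial.of_tendsto φ.open_target
    (f := fun δ z => (gram φ (gδ δ).inner z)⁻¹ i j) (D := fun δ z =>
      invD φ h.inner (gδ δ).inner z k i j
        - ∑ l, christoffel φ h.inner i k l z * (gram φ (gδ δ).inner z)⁻¹ l j
        - ∑ l, christoffel φ h.inner j k l z * (gram φ (gδ δ).inner z)⁻¹ i l)
    (Eventually.of_forall fun δ => ?_) (fun K hK hc => ?_) fun K hK hc => ?_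
  · refine (hasWeakPartial_of_contDiffOn φ.open_target
      (contDiffOn_gram_inv hφ (gδ δ) i j)).congr_ae φ.open_target ?_
    have hae := ae_all_iff.2 fun a => ae_all_iff.2 fun b =>
      comp3_weakCovDeriv_ae hφ h (gδ δ) k a b
    filter_upwards [hae, ae_restrict_mem φ.open_target.measurableSet] with z hz hzt
    rw [pd_gram_inv hφ h.inner (gδ δ) hzt]
    simp only [invD, wcd, hz]
  · have := isFiniteMeasure_restrict (μ := (volume : Measure (E n))) hc
    exact (H.inv_top hφ hK hc i j).mono le_top
  · have := isFiniteMeasure_restrict (μ := (volume : Measure (E n))) hc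
    have hΓ := fun a b c => lpConv_const_of_continuousOn hc
      ((contDiffOn_christoffel hφ h a b c).continuousOn.mono hK)
    refine (((H.invDConv hn hφ hK hc k i j).mono hn).sub le_rfl ?_).sub le_rfl ?_
    · exact LpConv.sum _ le_rfl fun l =>
        ((hΓ i k l).mul (r := ⊤) le_top (H.inv_top hφ hK hc l j)).mono le_top
    · exact LpConv.sum _ le_rfl fun l =>
        ((hΓ j k l).mul (r := ⊤) le_top (H.inv_top hφ hK hc i l)).mono le_top

lemma exP (H : Approx h g gδ) (hn : 1 ≤ (n : ℝ≥0∞)) :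
    ∃ P : Tensor21 n M, HasWeakCovDerivInv h.inner g P ∧ ∀ φ ∈ atlas (E n) M, ∀ z ∈ φ.target,
      ∀ k i j, comp21 φ P z k i j = invD φ h.inner g z k i j := by
  choose s hs using H.metric.exists_isSharp
  -- Invariant form of `-g^{ia} g^{jb} ∇̃_k g_ab`: both covector arguments are raised and inserted
  -- into `∇̃g`.
  let P : Tensor21 n M := fun x => trilinearMk (U := E n) (V := E n →L[ℝ] ℝ) (W := E n →L[ℝ] ℝ)
    (fun v α β => -tri (weakCovDeriv h.inner g) x v (s x α) (s x β))
    (fun _ _ => ⟨fun a b => by simp; ring, fun c a => by simp⟩)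
    (fun _ _ => ⟨fun a b => by simp; ring, fun c a => by simp⟩)
    (fun _ _ => ⟨fun a b => by simp; ring, fun c a => by simp⟩)
  have key : ∀ φ ∈ atlas (E n) M, ∀ z ∈ φ.target,
      ∀ k i j, comp21 φ P z k i j = invD φ h.inner g z k i j := by
    intro φ hφ z hz k i j
    have hF := isFrame_frm hφ hz
    have e1 : comp21 φ P z k i j = -tri (weakCovDeriv h.inner g) (φ.symm z) (frm φ z k)
      (s (φ.symm z) (cofrm φ z i)) (s (φ.symm z) (cofrm φ z j)) := rfl
    rw [e1, invD]
    congr 1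
    rw [← hF.map_expand (f := fun v => tri (weakCovDeriv h.inner g) (φ.symm z) (frm φ z k) v
      (s (φ.symm z) (cofrm φ z j))) ⟨by simp, by simp⟩]
    refine Finset.sum_congr rfl fun a _ => ?_
    rw [← hF.map_expand (f := fun v => tri (weakCovDeriv h.inner g) (φ.symm z) (frm φ z k)
      (frm φ z a) v) ⟨by simp, by simp⟩, Finset.mul_sum]
    refine Finset.sum_congr rfl fun b _ => ?_
    rw [gram_inv_symm H.metric z i a, gram_inv_symm H.metric z j b, gram_eq,
      (hs (φ.symm z)).inv_gramOf hF, (hs (φ.symm z)).inv_gramOf hF, mul_assoc]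
    rfl
  refine ⟨P, fun φ hφ k i j => ?_, key⟩
  refine (H.hasWeakPartial_inv hn hφ k i j).congr_ae φ.open_target ?_
  filter_upwards [ae_restrict_mem φ.open_target.measurableSet] with z hz
  rw [key φ hφ z hz]

lemma comp21_ae (H : Approx h g gδ) (hn : 1 ≤ (n : ℝ≥0∞)) (hφ : φ ∈ atlas (E n) M)
    (k i j : Fin n) : (fun z => comp21 φ (weakCovDerivInv h.inner g) z k i j)
      =ᵐ[volume.restrict φ.target] fun z => invD φ h.inner g z k i j := by
  obtain ⟨P, hP, -⟩ := H.exP hn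
  have h1 := weakCovDerivInv_spec ⟨P, hP⟩ φ hφ k i j
  filter_upwards [h1.ae_unique φ.open_target (H.hasWeakPartial_inv hn hφ k i j)] with z hz
  linarith

end Approx

end Approximation

/-! ### The weak differential of `u dμ_g/dμ_h`. -/

section Differential

variable {n : ℕ} {M : Type*} [TopologicalSpace M] [ChartedSpace (E n) M]
  [IsManifold (𝓡 n) ∞ M] {φ : OpenPartialHomeomorph M (E n)}

lemma contDiffOn_comp_symm (hφ : φ ∈ atlas (E n) M) {u : M → ℝ}
    (hu : ContMDiff (𝓡 n) 𝓘(ℝ, ℝ) ∞ u) : ContDiffOn ℝ ∞ (u ∘ φ.symm) φ.target :=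
  (hu.comp_contMDiffOn (contMDiffOn_symm_of_mem_maximalAtlas
    (IsManifold.subset_maximalAtlas hφ))).contDiffOn

lemma contDiffOn_rho (hφ : φ ∈ atlas (E n) M) (h S : SmoothMetric n M) :
    ContDiffOn ℝ ∞ (rho φ h.inner S.inner) φ.target := by
  have hd := fun S : SmoothMetric n M => contDiffOn_det (contDiffOn_gram_apply hφ S)
  have hp := fun (S : SmoothMetric n M) z hz => det_gram_pos (isMetric_smooth S) hφ (z := z) hz
  exact ((hd S).div (hd h) fun z hz => (hp h z hz).ne').sqrt
    fun z hz => (div_pos (hp S z hz) (hp h z hz)).ne'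

lemma volRatio_symm (hφ : φ ∈ atlas (E n) M) (h : SmoothMetric n M) (g : Tensor2 n M) {z : E n}
    (hz : z ∈ φ.target) : volRatio h.inner g (φ.symm z) = rho φ h.inner g z :=
  (chartInvariant_volRatio (isMetric_smooth h) g).atPoint_eq hφ hz

namespace Approx

variable {h : SmoothMetric n M} {g : Tensor2 n M} {gδ : ℝ → SmoothMetric n M} {K : Set (E n)}

/-- The formula for the components of the differential of the function `u dμ_g/dμ_h`. -/
lemma hasWeakPartial_mul_volRatio (H : Approx h g gδ) (hn : 1 ≤ (n : ℝ≥0∞))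
    (hφ : φ ∈ atlas (E n) M) {u : M → ℝ} (hu : ContMDiff (𝓡 n) 𝓘(ℝ, ℝ) ∞ u) (k : Fin n) :
    HasWeakPartial φ.target k ((fun y => u y * volRatio h.inner g y) ∘ φ.symm) fun z =>
      rho φ h.inner g z * pd k (u ∘ φ.symm) z
        + u (φ.symm z) * (1 / 2 * (rho φ h.inner g z * trT φ h.inner g k z)) := by
  have hu' := contDiffOn_comp_symm hφ hu
  have hpu := contDiffOn_pd φ.open_target hu' k
  suffices HasWeakPartial φ.target k (fun z => (u ∘ φ.symm) z * rho φ h.inner g z) _ from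
    this.congr_fun φ.open_target fun z hz => by simp [volRatio_symm hφ h g hz]
  refine HasWeakPartial.of_tendsto φ.open_target
    (f := fun δ z => (u ∘ φ.symm) z * rho φ h.inner (gδ δ).inner z) (D := fun δ z =>
      rho φ h.inner (gδ δ).inner z * pd k (u ∘ φ.symm) z
        + u (φ.symm z) * (1 / 2 * (rho φ h.inner (gδ δ).inner z
          * trT φ h.inner (gδ δ).inner k z)))
    (Eventually.of_forall fun δ => ?_) (fun K hK hc => ?_) fun K hK hc => ?_
  · have hr := contDiffOn_rho hφ h (gδ δ)
    refine (hasWeakPartial_of_contDiffOn φ.open_target (hu'.mul hr)).congr_ae φ.open_target ?_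
    have hae := ae_all_iff.2 fun a => ae_all_iff.2 fun b =>
      comp3_weakCovDeriv_ae hφ h (gδ δ) k a b
    filter_upwards [hae, ae_restrict_mem φ.open_target.measurableSet] with z hz hzt
    have d1 := (hu'.contDiffAt (φ.open_target.mem_nhds hzt)).differentiableAt (by simp)
    have d2 := (hr.contDiffAt (φ.open_target.mem_nhds hzt)).differentiableAt (by simp)
    have e : pd k (rho φ h.inner (gδ δ).inner) z
        = 1 / 2 * rho φ h.inner (gδ δ).inner z * trT φ h.inner (gδ δ).inner k z := by
      simp only [trT, wcd, hz]
      exact pd_volRatio hφ h (gδ δ) hzt k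
    rw [pd_mul d1 d2, e]
    simp only [Function.comp]
    ring
  · have := isFiniteMeasure_restrict (μ := (volume : Measure (E n))) hc
    exact ((lpConv_const_of_continuousOn hc (hu'.continuousOn.mono hK)).mul (r := ⊤) le_top
      (H.rho_top hφ hK hc)).mono le_top
  · have := isFiniteMeasure_restrict (μ := (volume : Measure (E n))) hc
    have hr := H.rho_top hφ hK hc
    refine ((hr.mul (r := ⊤) le_top (lpConv_const_of_continuousOn hc
      (hpu.continuousOn.mono hK))).mono le_top).add le_rfl (LpConv.mono hn ?_)
    exact (lpConv_const_of_continuousOn hc (hu'.continuousOn.mono hK)).mul hn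
      ((hr.mul hn (H.trTConv hn hφ hK hc k)).const_mul _)

lemma exDiff (H : Approx h g gδ) (hn : 1 ≤ (n : ℝ≥0∞)) {u : M → ℝ}
    (hu : ContMDiff (𝓡 n) 𝓘(ℝ, ℝ) ∞ u) :
    ∃ α : Covector n M, HasWeakDiff (fun y => u y * volRatio h.inner g y) α := by
  choose s hs using H.metric.exists_isSharp
  -- The product rule `ρ du + ½ u ρ tr_g ∇̃g`. A covector at each point must be given without a
  -- chart, so the trace is taken in the standard basis of the model space and later identified with
  -- the trace in coordinates.
  let α : Covector n M := fun x => (volRatio h.inner g x • dif u x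
    + (u x * (1 / 2 * volRatio h.inner g x)) • ∑ i : Fin n, ∑ j : Fin n,
      (EuclideanSpace.proj i : E n →L[ℝ] ℝ) (s x (EuclideanSpace.proj j)) •
        LinearMap.toContinuousLinearMap ((tri (weakCovDeriv h.inner g) x).flip
          (EuclideanSpace.single i 1) |>.flip (EuclideanSpace.single j 1)) : E n →L[ℝ] ℝ)
  refine ⟨α, fun φ hφ k => (H.hasWeakPartial_mul_volRatio hn hφ hu k).congr_ae φ.open_target ?_⟩
  filter_upwards [ae_restrict_mem φ.open_target.measurableSet] with z hz
  have hF := isFrame_frm hφ hz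
  have e := hF.contract_metric_eq isFrame_single (s (φ.symm z))
    (fun v w => tri (weakCovDeriv h.inner g) (φ.symm z) (frm φ z k) v w)
    (fun _ => ⟨by simp, by simp⟩) fun _ => ⟨by simp, by simp⟩
  rw [comp1_eq, pd_comp_symm hφ hu hz]
  simp only [covec, α, add_apply, smul_apply, sum_apply, smul_eq_mul, volRatio_symm hφ h g hz,
    LinearMap.coe_toContinuousLinearMap', LinearMap.flip_apply, ← e, trT, wcd, gram_eq,
    (hs (φ.symm z)).inv_gramOf hF, comp3_eq]
  ring

lemma comp1_weakDiff_ae (H : Approx h g gδ) (hn : 1 ≤ (n : ℝ≥0∞)) (hφ : φ ∈ atlas (E n) M)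
    {u : M → ℝ} (hu : ContMDiff (𝓡 n) 𝓘(ℝ, ℝ) ∞ u) (k : Fin n) :
    (fun z => comp1 φ (weakDiff fun y => u y * volRatio h.inner g y) z k)
      =ᵐ[volume.restrict φ.target] fun z => rho φ h.inner g z * pd k (u ∘ φ.symm) z
        + u (φ.symm z) * (1 / 2 * (rho φ h.inner g z * trT φ h.inner g k z)) :=
  (weakDiff_spec (H.exDiff hn hu) φ hφ k).ae_unique φ.open_target
    (H.hasWeakPartial_mul_volRatio hn hφ hu k)

end Approx

end Differential

/-! ### Coefficients of the pairing and their convergence. -/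

section Coefficients

variable {n : ℕ} {M : Type*} [TopologicalSpace M] [ChartedSpace (E n) M]
  {φ : OpenPartialHomeomorph M (E n)}

/-- The coefficient of `∂_k u` in the integrand of the pairing. -/
def coefA (φ : OpenPartialHomeomorph M (E n)) (h g : Tensor2 n M) (k : Fin n) (z : E n) : ℝ :=
  -(V φ h g k z * rho φ h g z)

/-- The coefficient of `u` in the integrand of the pairing. -/
def coefB (φ : OpenPartialHomeomorph M (E n)) (h g : Tensor2 n M) (z : E n) : ℝ :=
  F φ h g z * rho φ h g z - ∑ k, V φ h g k z * (1 / 2 * (rho φ h g z * trT φ h g k z))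

/-- The scalar `F`, with the derivative of the inverse metric expressed by that of the metric. -/
def invF (φ : OpenPartialHomeomorph M (E n)) (h g : Tensor2 n M) (z : E n) : ℝ :=
  ∑ i, ∑ j, (gram φ g z)⁻¹ i j * ricci φ h i j z
    - ∑ k, ∑ i, ∑ j, invD φ h g z k i j * Gam φ h g k i j z
    + ∑ k, ∑ i, ∑ j, invD φ h g z k i k * Gam φ h g j j i z
    + ∑ i, ∑ j, (gram φ g z)⁻¹ i j * ∑ k, ∑ l,
        (Gam φ h g k k l z * Gam φ h g l i j z - Gam φ h g k j l z * Gam φ h g l i k z)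

lemma holderTriple_half : ENNReal.HolderTriple n n ((n : ℝ≥0∞) / 2) := by
  refine ⟨?_⟩
  rw [ENNReal.inv_div (by simp) (by simp), ← two_mul, div_eq_mul_inv]

lemma one_le_half (hn : 2 ≤ n) : 1 ≤ (n : ℝ≥0∞) / 2 := by
  rw [ENNReal.le_div_iff_mul_le (by simp) (by simp), one_mul]
  exact_mod_cast hn

variable [IsManifold (𝓡 n) ∞ M]

lemma contDiffOn_ricci (hφ : φ ∈ atlas (E n) M) (h : SmoothMetric n M) (i j : Fin n) :
    ContDiffOn ℝ ∞ (ricci φ h.inner i j) φ.target := by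
  have hΓ := fun a b c => contDiffOn_christoffel hφ h a b c
  have hp := fun a b c d => contDiffOn_pd φ.open_target (hΓ a b c) d
  exact ((ContDiffOn.sum fun k _ => hp _ _ _ _).sub (ContDiffOn.sum fun k _ => hp _ _ _ _)).add
    (ContDiffOn.sum fun k _ => ContDiffOn.sum fun l _ =>
      ((hΓ _ _ _).mul (hΓ _ _ _)).sub ((hΓ _ _ _).mul (hΓ _ _ _)))

lemma F_symm {g : Tensor2 n M} (hg : IsMetric g) (hφ : φ ∈ atlas (E n) M) (h : SmoothMetric n M)
    {z : E n} (hz : z ∈ φ.target) :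
    atPoint (fun φ z => F φ h.inner g z) (φ.symm z) = F φ h.inner g z := by
  refine (chartInvariant_F hg ?_).atPoint_eq hφ hz
  intro ψ hψ ψ' hψ' w hw w' hw' hx
  have ho : w' ∈ overlap ψ ψ' := ⟨hw', by simpa [← hx] using ψ.map_target hw⟩
  have e : transition ψ ψ' w' = w := by rw [transition, ← hx, ψ.right_inv hw]
  simpa only [e] using ricci_transition hψ hψ' h ho

namespace Approx

variable {h : SmoothMetric n M} {g : Tensor2 n M} {gδ : ℝ → SmoothMetric n M} {K : Set (E n)}

lemma GamConv (H : Approx h g gδ) (hn : 1 ≤ (n : ℝ≥0∞)) (hφ : φ ∈ atlas (E n) M)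
    (hK : K ⊆ φ.target) (hc : IsCompact K) (k i j : Fin n) :
    LpConv (volume.restrict K) n (fun δ => Gam φ h.inner (gδ δ).inner k i j)
      (Gam φ h.inner g k i j) :=
  (LpConv.sum _ hn fun l => (H.inv_top hφ hK hc k l).mul hn
    (((H.tConv φ hφ K hK hc i j l).add hn (H.tConv φ hφ K hK hc j i l)).sub hn
      (H.tConv φ hφ K hK hc l i j))).const_mul _

lemma VConv (H : Approx h g gδ) (hn : 1 ≤ (n : ℝ≥0∞)) (hφ : φ ∈ atlas (E n) M)
    (hK : K ⊆ φ.target) (hc : IsCompact K) (k : Fin n) :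
    LpConv (volume.restrict K) n (fun δ => V φ h.inner (gδ δ).inner k) (V φ h.inner g k) :=
  (LpConv.sum _ hn fun i => LpConv.sum _ hn fun j =>
    (H.inv_top hφ hK hc i j).mul hn (H.GamConv hn hφ hK hc k i j)).sub hn
  (LpConv.sum _ hn fun i => LpConv.sum _ hn fun j =>
    (H.inv_top hφ hK hc i k).mul hn (H.GamConv hn hφ hK hc j j i))

lemma coefAConv (H : Approx h g gδ) (hn : 1 ≤ (n : ℝ≥0∞)) (hφ : φ ∈ atlas (E n) M)
    (hK : K ⊆ φ.target) (hc : IsCompact K) (k : Fin n) :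
    LpConv (volume.restrict K) n (fun δ => coefA φ h.inner (gδ δ).inner k)
      (coefA φ h.inner g k) :=
  ((H.VConv hn hφ hK hc k).mul hn (H.rho_top hφ hK hc)).neg

/-- The Ricci term converges in `L^∞`; every other term is a bounded coefficient times a product of
two factors converging in `L^n`, and `1/n + 1/n = 2/n`. -/
lemma invFConv (H : Approx h g gδ) (hn : 2 ≤ n) (hφ : φ ∈ atlas (E n) M)
    (hK : K ⊆ φ.target) (hc : IsCompact K) :
    LpConv (volume.restrict K) ((n : ℝ≥0∞) / 2) (fun δ => invF φ h.inner (gδ δ).inner)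
      (invF φ h.inner g) := by
  have hT := holderTriple_half (n := n)
  have h1 := one_le_half hn
  have hn1 : 1 ≤ (n : ℝ≥0∞) := by exact_mod_cast (by omega : 1 ≤ n)
  have := isFiniteMeasure_restrict (μ := (volume : Measure (E n))) hc
  have hI := fun i j => H.inv_top hφ hK hc i j
  have hΓ := fun k i j => H.GamConv hn1 hφ hK hc k i j
  have hD := fun k i j => H.invDConv hn1 hφ hK hc k i j
  have hR := fun i j => lpConv_const_of_continuousOn hc
    ((contDiffOn_ricci hφ h i j).continuousOn.mono hK)
  refine (((LpConv.sum _ h1 fun i => LpConv.sum _ h1 fun j => ?_).sub h1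
    (LpConv.sum _ h1 fun k => LpConv.sum _ h1 fun i => LpConv.sum _ h1 fun j => ?_)).add h1
    (LpConv.sum _ h1 fun k => LpConv.sum _ h1 fun i => LpConv.sum _ h1 fun j => ?_)).add h1
    (LpConv.sum _ h1 fun i => LpConv.sum _ h1 fun j => (hI i j).mul h1
      (LpConv.sum _ h1 fun k => LpConv.sum _ h1 fun l => LpConv.sub h1 ?_ ?_))
  · exact ((hI i j).mul (r := ⊤) le_top (hR i j)).mono le_top
  · exact (hD k i j).mul h1 (hΓ k i j)
  · exact (hD k i k).mul h1 (hΓ j j i)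
  · exact (hΓ k k l).mul h1 (hΓ l i j)
  · exact (hΓ k j l).mul h1 (hΓ l i k)

/-- No convergence is assumed for the chosen derivative of the inverse metric. It equals an
expression in `∇̃g` almost everywhere, and that expression is under control. -/
lemma F_ae (H : Approx h g gδ) (hn : 1 ≤ (n : ℝ≥0∞)) (hφ : φ ∈ atlas (E n) M) :
    F φ h.inner g =ᵐ[volume.restrict φ.target] invF φ h.inner g := by
  have hae := ae_all_iff.2 fun k => ae_all_iff.2 fun i => ae_all_iff.2 fun j =>
    H.comp21_ae hn hφ k i j
  filter_upwards [hae] with z hz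
  simp only [F, invF, hz]

lemma coefBConv (H : Approx h g gδ) (hn : 2 ≤ n) (hφ : φ ∈ atlas (E n) M)
    (hK : K ⊆ φ.target) (hc : IsCompact K) :
    LpConv (volume.restrict K) ((n : ℝ≥0∞) / 2) (fun δ => coefB φ h.inner (gδ δ).inner)
      (coefB φ h.inner g) := by
  have hT := holderTriple_half (n := n)
  have h1 := one_le_half hn
  have hn1 : 1 ≤ (n : ℝ≥0∞) := by exact_mod_cast (by omega : 1 ≤ n)
  have hF : LpConv (volume.restrict K) ((n : ℝ≥0∞) / 2) (fun δ => F φ h.inner (gδ δ).inner)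
      (F φ h.inner g) := (H.invFConv hn hφ hK hc).congr
    (Eventually.of_forall fun δ => ae_restrict_of_ae_restrict_of_subset hK
      ((Approx.const h (gδ δ)).F_ae hn1 hφ).symm)
    (ae_restrict_of_ae_restrict_of_subset hK (H.F_ae hn1 hφ).symm)
  exact (hF.mul h1 (H.rho_top hφ hK hc)).sub h1 (LpConv.sum _ h1 fun k =>
    (H.VConv hn1 hφ hK hc k).mul h1
      (((H.rho_top hφ hK hc).mul hn1 (H.trTConv hn1 hφ hK hc k)).const_mul _))

/-- Substitute the formula for the weak differential and sort by `∂_k u` and `u`. The term of `V`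
paired with the derivative of the density moves into the zeroth order coefficient. -/
lemma scalIntegrand_ae (H : Approx h g gδ) (hn : 1 ≤ (n : ℝ≥0∞)) (hφ : φ ∈ atlas (E n) M)
    {u : M → ℝ} (hu : ContMDiff (𝓡 n) 𝓘(ℝ, ℝ) ∞ u) :
    (fun z => scalIntegrand h.inner g u (φ.symm z)) =ᵐ[volume.restrict φ.target]
      fun z => ∑ k, coefA φ h.inner g k z * pd k (u ∘ φ.symm) z
        + coefB φ h.inner g z * u (φ.symm z) := by
  have hae := ae_all_iff.2 fun k => H.comp1_weakDiff_ae hn hφ hu k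
  filter_upwards [hae, ae_restrict_mem φ.open_target.measurableSet] with z hz hzt
  have e : scalIntegrand h.inner g u (φ.symm z) = -(∑ k, V φ h.inner g k z
      * comp1 φ (weakDiff fun y => u y * volRatio h.inner g y) z k)
      + F φ h.inner g z * (u (φ.symm z) * rho φ h.inner g z) := by
    rw [scalIntegrand, (chartInvariant_V H.metric h.inner _).atPoint_eq hφ hzt,
      F_symm H.metric hφ h hzt, volRatio_symm hφ h g hzt]
  simp only [e, hz, coefA, coefB, sub_mul, Finset.sum_mul, neg_mul, Finset.sum_neg_distrib,
    mul_add, Finset.sum_add_distrib]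
  have e1 : ∀ k, V φ h.inner g k z * (u (φ.symm z) * (1 / 2 * (rho φ h.inner g z
      * trT φ h.inner g k z))) = V φ h.inner g k z * (1 / 2 * (rho φ h.inner g z
      * trT φ h.inner g k z)) * u (φ.symm z) := fun k => by ring
  simp only [e1, mul_assoc]
  ring

end Approx

end Coefficients

/-! ### Transfer of integrals between the manifold and charts. -/

section Transfer

variable {n : ℕ} {M : Type*} [TopologicalSpace M] {φ : OpenPartialHomeomorph M (E n)}
  {K : Set (E n)}

lemma measurableSet_symm_image [MeasurableSpace M] [BorelSpace M] (hK : K ⊆ φ.target)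
    (hc : IsCompact K) : MeasurableSet (φ.symm '' K) := by
  rw [φ.symm_image_eq_source_inter_preimage hK]
  have := (continuousOn_iff_continuous_domRestrict.1 φ.continuousOn).measurable
    hc.measurableSet
  have := MeasurableSet.subtype_image φ.open_source.measurableSet this
  convert this using 1
  ext x
  simp [Set.domRestrict, and_comm]

variable [ChartedSpace (E n) M]

/-- The volume density of `h` in a chart. -/
def dens (φ : OpenPartialHomeomorph M (E n)) (h : Tensor2 n M) (z : E n) : ℝ := √(gram φ h z).det

lemma dens_nonneg (φ : OpenPartialHomeomorph M (E n)) (h : Tensor2 n M) (z : E n) :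
    0 ≤ dens φ h z := Real.sqrt_nonneg _

lemma aemeasurable_chart_image [MeasurableSpace M] [BorelSpace M] (hK : K ⊆ φ.target)
    (h : Tensor2 n M) : AEMeasurable φ ((vol h).restrict (φ.symm '' K)) :=
  (aemeasurable_chart φ h).mono_measure (Measure.restrict_mono
    (by rintro _ ⟨z, hz, rfl⟩; exact φ.map_target (hK hz)) le_rfl)

variable [IsManifold (𝓡 n) ∞ M]

lemma contDiffOn_dens (hφ : φ ∈ atlas (E n) M) (h : SmoothMetric n M) :
    ContDiffOn ℝ ∞ (dens φ h.inner) φ.target :=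
  (contDiffOn_det (contDiffOn_gram_apply hφ h)).sqrt
    fun _ hz => (det_gram_pos (isMetric_smooth h) hφ hz).ne'

lemma dens_pos (hφ : φ ∈ atlas (E n) M) (h : SmoothMetric n M) {z : E n} (hz : z ∈ φ.target) :
    0 < dens φ h.inner z :=
  Real.sqrt_pos.2 (det_gram_pos (isMetric_smooth h) hφ hz)

lemma aemeasurable_dens (hφ : φ ∈ atlas (E n) M) (h : SmoothMetric n M) (hK : K ⊆ φ.target)
    (hc : IsCompact K) :
    AEMeasurable (fun z => ENNReal.ofReal (dens φ h.inner z)) (volume.restrict K) :=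
  (((contDiffOn_dens hφ h).continuousOn.mono hK).aemeasurable hc.measurableSet).ennreal_ofReal

variable [CompactSpace M] [MeasurableSpace M] [BorelSpace M]

/-- Countably many charts cover `M`, and in each of them the volume is absolutely continuous with
respect to Lebesgue measure. -/
lemma ae_vol_of_charts (h : Tensor2 n M) {Q : M → Prop}
    (H : ∀ φ ∈ atlas (E n) M, ∀ᵐ z ∂volume.restrict φ.target, Q (φ.symm z)) :
    ∀ᵐ x ∂vol h, Q x := by
  rcases isEmpty_or_nonempty M with _ | ⟨⟨x₀⟩⟩
  · exact Eventually.of_forall fun x => isEmptyElim x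
  obtain ⟨f, -, hf, hcov⟩ := exists_seq_chart (chart_mem_atlas (E n) x₀)
  have key : ∀ i, ∀ᵐ x ∂(vol h).restrict (f i).source, Q x := fun i => by
    have h1 : ∀ᵐ z ∂Measure.map (f i) ((vol h).restrict (f i).source), Q ((f i).symm z) := by
      rw [map_vol_restrict_source (hf i)]
      exact (coordVol_absolutelyContinuous _ _).ae_le (H _ (hf i))
    filter_upwards [ae_of_ae_map (aemeasurable_chart (f i) h) h1,
      ae_restrict_mem (f i).open_source.measurableSet] with x hx hxs
    rwa [(f i).left_inv hxs] at hx
  have h2 := (ae_restrict_iUnion_iff (μ := vol h) (fun i => (f i).source) Q).2 key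
  rwa [hcov, Measure.restrict_univ] at h2

lemma map_vol_restrict_image (hφ : φ ∈ atlas (E n) M) (h : Tensor2 n M) (hK : K ⊆ φ.target)
    (hc : IsCompact K) : Measure.map φ ((vol h).restrict (φ.symm '' K))
      = (volume.restrict K).withDensity fun z => ENNReal.ofReal (dens φ h z) := by
  have h1 := Measure.restrict_map_of_aemeasurable (aemeasurable_chart φ h) hc.measurableSet
  rw [map_vol_restrict_source hφ, Measure.restrict_restrict' φ.open_source.measurableSet,
    inter_comm, ← φ.symm_image_eq_source_inter_preimage hK] at h1
  rw [← h1, coordVol, restrict_withDensity hc.measurableSet,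
    Measure.restrict_restrict_of_subset hK]
  rfl

/-- The chart carries `vol` on the compact piece to Lebesgue measure with density `dens`; the
integrand needs to be known only almost everywhere. -/
lemma integral_vol_image (hφ : φ ∈ atlas (E n) M) (h : SmoothMetric n M) (hK : K ⊆ φ.target)
    (hc : IsCompact K) {f : M → ℝ} {G : E n → ℝ}
    (hf : (fun z => f (φ.symm z)) =ᵐ[volume.restrict K] G)
    (hG : IntegrableOn (fun z => dens φ h.inner z * G z) K) :
    IntegrableOn f (φ.symm '' K) (vol h.inner) ∧
      ∫ x in φ.symm '' K, f x ∂vol h.inner = ∫ z in K, dens φ h.inner z * G z := by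
  have hm := aemeasurable_dens hφ h hK hc
  have hmap := map_vol_restrict_image hφ h.inner hK hc
  have hφm := aemeasurable_chart_image hK h.inner
  have htop : ∀ᵐ z ∂volume.restrict K, ENNReal.ofReal (dens φ h.inner z) < ⊤ :=
    Eventually.of_forall fun _ => ENNReal.ofReal_lt_top
  have e : (fun z => (ENNReal.ofReal (dens φ h.inner z)).toReal • G z)
      = fun z => dens φ h.inner z * G z := by
    ext z
    rw [ENNReal.toReal_ofReal (dens_nonneg _ _ _), smul_eq_mul]
  have hGi : Integrable G (Measure.map φ ((vol h.inner).restrict (φ.symm '' K))) := by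
    rw [hmap, integrable_withDensity_iff_integrable_smul₀' hm htop, e]
    exact hG
  have h1 : f =ᵐ[(vol h.inner).restrict (φ.symm '' K)] G ∘ φ := by
    have h2 : ∀ᵐ z ∂Measure.map φ ((vol h.inner).restrict (φ.symm '' K)),
        f (φ.symm z) = G z := by
      rw [hmap]
      exact (withDensity_absolutelyContinuous _ _).ae_le hf
    have hL := measurableSet_symm_image hK hc
    filter_upwards [ae_of_ae_map hφm h2, ae_restrict_mem hL] with x hx hxL
    obtain ⟨z, hz, rfl⟩ := hxL
    simpa only [φ.right_inv (hK hz), Function.comp] using hx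
  refine ⟨((integrable_map_measure hGi.1 hφm).1 hGi).congr h1.symm, ?_⟩
  rw [integral_congr_ae h1]
  have h3 := integral_map hφm hGi.1
  simp only [Function.comp]
  rw [← h3, hmap, integral_withDensity_eq_integral_toReal_smul₀ hm htop]
  simp only [ENNReal.toReal_ofReal (dens_nonneg _ _ _), smul_eq_mul]

end Transfer

/-! ### Localization of the pairing. -/

section Localization

variable {n : ℕ} {M : Type*} [TopologicalSpace M] [ChartedSpace (E n) M]
  [IsManifold (𝓡 n) ∞ M] {φ : OpenPartialHomeomorph M (E n)} {K : Set (E n)}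

/-- The pairing of `g` with a function `w` on `ℝⁿ`, in a chart. -/
def localIntegrand (φ : OpenPartialHomeomorph M (E n)) (h g : Tensor2 n M) (w : E n → ℝ)
    (z : E n) : ℝ :=
  ∑ k, coefA φ h g k z * pd k w z + coefB φ h g z * w z

lemma pd_sum_univ {ι : Type*} [Fintype ι] {f : ι → E n → ℝ} {z : E n}
    (hf : ∀ i, DifferentiableAt ℝ (f i) z) (k : Fin n) :
    pd k (fun w => ∑ i, f i w) z = ∑ i, pd k (f i) z := by
  simp only [pd]
  rw [fderiv_fun_sum fun i _ => hf i]
  simp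

lemma dens_top (hφ : φ ∈ atlas (E n) M) (h : SmoothMetric n M) (hK : K ⊆ φ.target)
    (hc : IsCompact K) :
    LpConv (volume.restrict K) ⊤ (fun _ => dens φ h.inner) (dens φ h.inner) :=
  lpConv_const_of_continuousOn hc ((contDiffOn_dens hφ h).continuousOn.mono hK)

/-- For a fixed smooth `w`, which is bounded with its derivatives on `K`, `L¹` convergence of the
coefficients is enough. It provides integrability and, in dimension two, the passage to the limit.
-/
lemma Approx.localConv {h : SmoothMetric n M} {g : Tensor2 n M} {gδ : ℝ → SmoothMetric n M}
    (H : Approx h g gδ) (hn : 2 ≤ n) (hφ : φ ∈ atlas (E n) M)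
    (hK : K ⊆ φ.target) (hc : IsCompact K) {w : E n → ℝ} (hw : ContDiffOn ℝ ∞ w φ.target) :
    LpConv (volume.restrict K) 1
      (fun δ z => dens φ h.inner z * localIntegrand φ h.inner (gδ δ).inner w z)
      fun z => dens φ h.inner z * localIntegrand φ h.inner g w z := by
  have := isFiniteMeasure_restrict (μ := (volume : Measure (E n))) hc
  have hn1 : 1 ≤ (n : ℝ≥0∞) := by exact_mod_cast (by omega : 1 ≤ n)
  have hd := dens_top hφ h hK hc
  have hw0 := lpConv_const_of_continuousOn hc (hw.continuousOn.mono hK)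
  have hw1 := fun k => lpConv_const_of_continuousOn hc
    ((contDiffOn_pd φ.open_target hw k).continuousOn.mono hK)
  exact hd.mul le_rfl ((LpConv.sum _ le_rfl fun k =>
    ((H.coefAConv hn1 hφ hK hc k).mono hn1).mul le_rfl (hw1 k)).add le_rfl
    (((H.coefBConv hn hφ hK hc).mono (one_le_half hn)).mul le_rfl hw0))

variable [CompactSpace M] [MeasurableSpace M] [BorelSpace M]

namespace Approx

variable {h : SmoothMetric n M} {g : Tensor2 n M} {gδ : ℝ → SmoothMetric n M}

/-- Linearity in `u` holds only almost everywhere, since the weak differential is chosen separately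
for every function. -/
lemma scalIntegrand_sum (H : Approx h g gδ) (hn : 1 ≤ (n : ℝ≥0∞)) {ι : Type*} [Fintype ι]
    {u : ι → M → ℝ} (hu : ∀ i, ContMDiff (𝓡 n) 𝓘(ℝ, ℝ) ∞ (u i)) :
    scalIntegrand h.inner g (fun x => ∑ i, u i x) =ᵐ[vol h.inner]
      fun x => ∑ i, scalIntegrand h.inner g (u i) x := by
  refine ae_vol_of_charts h.inner fun φ hφ => ?_
  have hs : ContMDiff (𝓡 n) 𝓘(ℝ, ℝ) ∞ fun x => ∑ i, u i x := contMDiff_finsetSum fun i _ => hu i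
  have hae := ae_all_iff.2 fun i => H.scalIntegrand_ae hn hφ (hu i)
  filter_upwards [hae, H.scalIntegrand_ae hn hφ hs,
    ae_restrict_mem φ.open_target.measurableSet] with z h1 h2 hz
  have h3 := fun k => pd_sum_univ (f := fun i => u i ∘ φ.symm) (fun i =>
    ((contDiffOn_comp_symm hφ (hu i)).contDiffAt (φ.open_target.mem_nhds hz)).differentiableAt
      (by simp)) k
  have h4 : ∀ k, pd k ((fun x => ∑ i, u i x) ∘ φ.symm) z = ∑ i, pd k (u i ∘ φ.symm) z := h3
  simp only [h1, h2, h4, Finset.sum_add_distrib, Finset.mul_sum]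
  rw [Finset.sum_comm]

/-- Off the closed support `u` vanishes near the point, so both `u` and its partial derivatives
vanish in the coordinate form of the integrand. -/
lemma scalIntegrand_off (H : Approx h g gδ) (hn : 1 ≤ (n : ℝ≥0∞))
    {u : M → ℝ} (hu : ContMDiff (𝓡 n) 𝓘(ℝ, ℝ) ∞ u) :
    ∀ᵐ x ∂vol h.inner, x ∉ tsupport u → scalIntegrand h.inner g u x = 0 := by
  refine ae_vol_of_charts h.inner fun φ hφ => ?_
  filter_upwards [H.scalIntegrand_ae hn hφ hu,
    ae_restrict_mem φ.open_target.measurableSet] with z h1 hz hzu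
  have h2 : u ∘ φ.symm =ᶠ[𝓝 z] fun _ => 0 :=
    (φ.continuousAt_symm hz).eventually (notMem_tsupport_iff_eventuallyEq.1 hzu)
  have h3 : ∀ k, pd k (u ∘ φ.symm) z = 0 := fun k => by
    rw [pd, h2.fderiv_eq]
    simp
  simp [h1, h3, image_eq_zero_of_notMem_tsupport hzu]

end Approx

end Localization

/-! ### Components bounded by invariant norms. -/

section QuadraticForms

open scoped Kronecker

/-- Cauchy–Schwarz for the form `H⁻¹`: with `w` the `i`-th column of `H`, one has `⟨w, v⟩ = v i` and
`⟨w, w⟩ = H i i`. The proof evaluates the form at `v - (v i / H i i) w`. -/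
lemma sq_apply_le_of_posDef {ι : Type*} [Fintype ι] [DecidableEq ι] {H : Matrix ι ι ℝ}
    (hH : H.PosDef) (v : ι → ℝ) (i : ι) :
    v i ^ 2 ≤ H i i * ∑ a, ∑ b, H⁻¹ a b * v a * v b := by
  have hu : IsUnit H.det := hH.det_pos.ne'.isUnit
  set w : ι → ℝ := fun a => H a i with hw
  have hsymm : ∀ a b, H a b = H b a := fun a b => by
    have := hH.1.apply b a
    simpa using this
  have h1 : H⁻¹.mulVec w = Pi.single i 1 := by
    ext a
    have := congrFun (congrFun (Matrix.nonsing_inv_mul H hu) a) i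
    rw [Matrix.mul_apply, Matrix.one_apply] at this
    simpa [Matrix.mulVec, dotProduct, hw, Pi.single_apply] using this
  have h2 : Matrix.vecMul w H⁻¹ = Pi.single i 1 := by
    ext a
    have := congrFun (congrFun (Matrix.mul_nonsing_inv H hu) i) a
    rw [Matrix.mul_apply, Matrix.one_apply] at this
    simpa [Matrix.vecMul, dotProduct, hw, Pi.single_apply, hsymm _ i, eq_comm] using this
  have hpos : 0 < H i i := hH.diag_pos
  have h3 := hH.inv.posSemidef.dotProduct_mulVec_nonneg (v - (v i / H i i) • w)
  have e : star (v - (v i / H i i) • w) = v - (v i / H i i) • w := by ext; simp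
  have h4 : w ⬝ᵥ H⁻¹.mulVec v = v i := by
    rw [Matrix.dotProduct_mulVec, h2]
    simp
  have h5 : v ⬝ᵥ H⁻¹.mulVec v = ∑ a, ∑ b, H⁻¹ a b * v a * v b := by
    simp only [dotProduct, Matrix.mulVec, Finset.mul_sum]
    exact Finset.sum_congr rfl fun a _ => Finset.sum_congr rfl fun b _ => by ring
  rw [e, Matrix.mulVec_sub, Matrix.mulVec_smul, h1, sub_dotProduct, dotProduct_sub,
    dotProduct_sub, smul_dotProduct, smul_dotProduct, h4, h5] at h3
  simp only [dotProduct_smul, dotProduct_single, smul_eq_mul, mul_one, hw] at h3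
  have h6 : H i i * ((∑ a, ∑ b, H⁻¹ a b * v a * v b) - v i / H i i * v i
      - (v i / H i i * v i - v i / H i i * (v i / H i i * H i i)))
      = H i i * (∑ a, ∑ b, H⁻¹ a b * v a * v b) - v i ^ 2 := by
    field_simp
    ring
  have := mul_nonneg hpos.le h3
  linarith

/-- The vector inequality for the positive definite Kronecker product `H ⊗ H`, with pairs of indices
as index set. -/
lemma sq_apply_le_of_posDef₂ {ι : Type*} [Fintype ι] [DecidableEq ι] {H : Matrix ι ι ℝ}
    (hH : H.PosDef) (v : ι → ι → ℝ) (i j : ι) :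
    v i j ^ 2 ≤ H i i * H j j
      * ∑ i, ∑ j, ∑ a, ∑ b, H⁻¹ i a * H⁻¹ j b * v i j * v a b := by
  have := sq_apply_le_of_posDef (hH.kronecker hH) (fun p => v p.1 p.2) (i, j)
  simpa [Fintype.sum_prod_type, Matrix.inv_kronecker] using this

lemma sq_apply_le_of_posDef₃ {ι : Type*} [Fintype ι] [DecidableEq ι] {H : Matrix ι ι ℝ}
    (hH : H.PosDef) (v : ι → ι → ι → ℝ) (k i j : ι) :
    v k i j ^ 2 ≤ H k k * (H i i * H j j)
      * ∑ k, ∑ i, ∑ j, ∑ c, ∑ a, ∑ b, H⁻¹ k c * H⁻¹ i a * H⁻¹ j b * v k i j * v c a b := by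
  have := sq_apply_le_of_posDef (hH.kronecker (hH.kronecker hH))
    (fun p => v p.1 p.2.1 p.2.2) (k, i, j)
  simpa [Fintype.sum_prod_type, Matrix.inv_kronecker, mul_assoc] using this

end QuadraticForms

/-! ### Local norms bounded by norms on the manifold. -/

section NormBounds

variable {n : ℕ} {M : Type*} [TopologicalSpace M] [ChartedSpace (E n) M]
  [IsManifold (𝓡 n) ∞ M] {φ : OpenPartialHomeomorph M (E n)} {K : Set (E n)}

lemma abs_le_of_sq_le {x C Q N : ℝ} (hC : 0 ≤ C) (h : x ^ 2 ≤ C * Q) (hN : N = √Q) :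
    |x| ≤ √C * N := by
  rw [hN, ← Real.sqrt_mul hC, ← Real.sqrt_sq_eq_abs]
  exact Real.sqrt_le_sqrt h

lemma abs_gram_le (hφ : φ ∈ atlas (E n) M) (h : SmoothMetric n M) (S : Tensor2 n M) {z : E n}
    (hz : z ∈ φ.target) (i j : Fin n) : |gram φ S z i j|
      ≤ √(gram φ h.inner z i i * gram φ h.inner z j j) * norm2 h.inner S (φ.symm z) := by
  have hH := posDef_gram (isMetric_smooth h) hφ hz
  exact abs_le_of_sq_le (mul_pos hH.diag_pos hH.diag_pos).le
    (sq_apply_le_of_posDef₂ hH (gram φ S z) i j)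
    ((chartInvariant_norm2 (isMetric_smooth h) S).atPoint_eq hφ hz)

lemma abs_comp3_le (hφ : φ ∈ atlas (E n) M) (h : SmoothMetric n M) (T : Tensor3 n M) {z : E n}
    (hz : z ∈ φ.target) (k i j : Fin n) : |comp3 φ T z k i j|
      ≤ √(gram φ h.inner z k k * (gram φ h.inner z i i * gram φ h.inner z j j))
        * norm3 h.inner T (φ.symm z) := by
  have hH := posDef_gram (isMetric_smooth h) hφ hz
  exact abs_le_of_sq_le (mul_pos hH.diag_pos (mul_pos hH.diag_pos hH.diag_pos)).le
    (sq_apply_le_of_posDef₃ hH (comp3 φ T z) k i j)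
    ((chartInvariant_norm3 (isMetric_smooth h) T).atPoint_eq hφ hz)

lemma abs_pd_le (hφ : φ ∈ atlas (E n) M) (h : SmoothMetric n M) {u : M → ℝ}
    (hu : ContMDiff (𝓡 n) 𝓘(ℝ, ℝ) ∞ u) {z : E n} (hz : z ∈ φ.target) (k : Fin n) :
    |pd k (u ∘ φ.symm) z| ≤ √(gram φ h.inner z k k) * normGrad h.inner u (φ.symm z) := by
  have hH := posDef_gram (isMetric_smooth h) hφ hz
  exact abs_le_of_sq_le hH.diag_pos.le
    (sq_apply_le_of_posDef hH (fun i => pd i (u ∘ φ.symm) z) k)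
    ((chartInvariant_normGrad (isMetric_smooth h) hu).atPoint_eq hφ hz)

lemma exists_bound_of_continuousOn_nonneg (hc : IsCompact K) {f : E n → ℝ}
    (hf : ContinuousOn f K) : ∃ C : ℝ, 0 < C ∧ ∀ z ∈ K, f z ≤ C := by
  obtain ⟨C, hC⟩ := hc.exists_bound_of_continuousOn hf
  exact ⟨max C 1, by positivity, fun z hz => (le_abs_self _).trans ((hC z hz).trans
    (le_max_left _ _))⟩

variable [CompactSpace M] [MeasurableSpace M] [BorelSpace M]

/-- Norms over a compact part of a chart are controlled by norms over the manifold. -/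
lemma exists_eLpNorm_symm_le (hφ : φ ∈ atlas (E n) M) (h : SmoothMetric n M)
    (hK : K ⊆ φ.target) (hc : IsCompact K) {p : ℝ≥0∞} (hp0 : p ≠ 0) (hp : p ≠ ⊤) :
    ∃ C : ℝ≥0∞, C ≠ ⊤ ∧ ∀ N : M → ℝ,
      eLpNorm (fun z => N (φ.symm z)) p (volume.restrict K) ≤ C * eLpNorm N p (vol h.inner) := by
  obtain ⟨c, hc0, hcK⟩ := exists_bound_of_continuousOn_nonneg hc
    (((contDiffOn_dens hφ h).continuousOn.mono hK).inv₀ fun z hz => (dens_pos hφ h (hK hz)).ne')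
  set ν := (volume.restrict K).withDensity fun z => ENNReal.ofReal (dens φ h.inner z) with hν
  -- The density of `h` is bounded below on `K`, so Lebesgue measure on `K` is at most a constant
  -- times the Riemannian volume.
  have hle : volume.restrict K ≤ ENNReal.ofReal c • ν := by
    rw [hν, ← withDensity_smul' _ _ ENNReal.ofReal_ne_top]
    conv_lhs => rw [← withDensity_one (μ := volume.restrict K)]
    refine withDensity_mono ((ae_restrict_mem hc.measurableSet).mono fun z hz => ?_)
    simp only [Pi.one_apply, Pi.smul_apply, smul_eq_mul]
    rw [← ENNReal.ofReal_mul hc0.le, ENNReal.one_le_ofReal]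
    have h1 := dens_pos hφ h (hK hz)
    have h2 := mul_le_mul_of_nonneg_right (hcK z hz) h1.le
    rwa [Pi.inv_apply, inv_mul_cancel₀ h1.ne'] at h2
  have hL : φ.symm '' K ⊆ φ.source := by
    rintro _ ⟨z, hz, rfl⟩
    exact φ.map_target (hK hz)
  have hLm := measurableSet_symm_image hK hc
  refine ⟨ENNReal.ofReal c ^ (1 / p).toReal,
    (ENNReal.rpow_lt_top_of_nonneg ENNReal.toReal_nonneg ENNReal.ofReal_ne_top).ne, fun N => ?_⟩
  refine (eLpNorm_mono_measure _ hle).trans ((eLpNorm_smul_measure_le _ _ _ _).trans ?_)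
  rw [smul_eq_mul]
  gcongr
  refine le_trans ?_ (eLpNorm_mono_measure _ (Measure.restrict_le_self (s := φ.symm '' K)))
  rw [hν, ← map_vol_restrict_image hφ h.inner hK hc,
    eLpNorm_eq_lintegral_rpow_enorm_toReal hp0 hp, eLpNorm_eq_lintegral_rpow_enorm_toReal hp0 hp]
  gcongr ?_ ^ _
  refine (lintegral_map_le _ _).trans (lintegral_mono_ae ?_)
  filter_upwards [ae_restrict_mem hLm] with x hx
  rw [φ.left_inv (hL hx)]

/-- A pointwise bound by a function on the manifold gives a bound of norms. -/
lemma exists_eLpNorm_le_of_abs_le (hφ : φ ∈ atlas (E n) M) (h : SmoothMetric n M)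
    (hK : K ⊆ φ.target) (hc : IsCompact K) {p : ℝ≥0∞} (hp0 : p ≠ 0) (hp : p ≠ ⊤)
    {c : E n → ℝ} (hcont : ContinuousOn c K) :
    ∃ C : ℝ≥0∞, C ≠ ⊤ ∧ ∀ (f : E n → ℝ) (N : M → ℝ), (∀ x, 0 ≤ N x) →
      (∀ z ∈ K, |f z| ≤ c z * N (φ.symm z)) →
        eLpNorm f p (volume.restrict K) ≤ C * eLpNorm N p (vol h.inner) := by
  obtain ⟨C, hC, H⟩ := exists_eLpNorm_symm_le hφ h hK hc hp0 hp
  obtain ⟨B, hB0, hB⟩ := exists_bound_of_continuousOn_nonneg hc hcont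
  refine ⟨ENNReal.ofReal B * C, ENNReal.mul_ne_top ENNReal.ofReal_ne_top hC, fun f N hN hf => ?_⟩
  rw [mul_assoc]
  refine le_trans (eLpNorm_le_mul_eLpNorm_of_ae_le_mul (g := fun z => N (φ.symm z)) ?_ p)
    (mul_le_mul_right (H N) _)
  filter_upwards [ae_restrict_mem hc.measurableSet] with z hz
  rw [Real.norm_eq_abs, Real.norm_eq_abs, abs_of_nonneg (hN _)]
  exact (hf z hz).trans (mul_le_mul_of_nonneg_right (hB z hz) (hN _))

end NormBounds

/-! ### From C⁰ and `W^{1,n}` convergence to convergence in charts. -/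

section Hypotheses

variable {n : ℕ} {M : Type*} [TopologicalSpace M] [ChartedSpace (E n) M]
  {φ : OpenPartialHomeomorph M (E n)} {K : Set (E n)}

lemma norm2_nonneg (h S : Tensor2 n M) (x : M) : 0 ≤ norm2 h S x := Real.sqrt_nonneg _

lemma norm3_nonneg (h : Tensor2 n M) (T : Tensor3 n M) (x : M) : 0 ≤ norm3 h T x :=
  Real.sqrt_nonneg _

lemma normGrad_nonneg (h : Tensor2 n M) (u : M → ℝ) (x : M) : 0 ≤ normGrad h u x :=
  Real.sqrt_nonneg _

lemma norm2_lt_of_distC0_lt {h S S' : Tensor2 n M} {ε : ℝ}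
    (hd : distC0 h S S' < ENNReal.ofReal ε) (x : M) : norm2 h (S - S') x < ε := by
  have h1 : ENNReal.ofReal (norm2 h (S - S') x) < ENNReal.ofReal ε :=
    (le_iSup (fun x => ENNReal.ofReal (norm2 h (S - S') x)) x).trans_lt hd
  exact (ENNReal.ofReal_lt_ofReal_iff' .. |>.1 h1).1

variable [IsManifold (𝓡 n) ∞ M]

lemma contConv_gram (hφ : φ ∈ atlas (E n) M) (hK : K ⊆ φ.target) (hc : IsCompact K)
    {h : SmoothMetric n M} {g : ContMetric n M} {gδ : ℝ → SmoothMetric n M}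
    (hC0 : Tendsto (fun δ => distC0 h.inner (gδ δ).inner g.inner) (𝓝[>] 0) (𝓝 0))
    (i j : Fin n) :
    ContConv K (fun δ z => gram φ (gδ δ).inner z i j) fun z => gram φ g.inner z i j := by
  have hcont : ContinuousOn
      (fun z => √(gram φ h.inner z i i * gram φ h.inner z j j)) K :=
    (((contDiffOn_gram_apply hφ h i i).continuousOn.mul
      (contDiffOn_gram_apply hφ h j j).continuousOn).sqrt).mono hK
  obtain ⟨C, hC, hCK⟩ := exists_bound_of_continuousOn_nonneg hc hcont
  refine ContConv.of_uniform ((continuousOn_gram_apply hφ g i j).mono hK)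
    (fun δ _ => (contDiffOn_gram_apply hφ (gδ δ) i j).continuousOn.mono hK) fun ε hε => ?_
  have h1 : (0 : ℝ≥0∞) < ENNReal.ofReal (ε / C) := ENNReal.ofReal_pos.2 (div_pos hε hC)
  filter_upwards [hC0.eventually_lt_const h1] with δ hδ z hz
  have h2 := norm2_lt_of_distC0_lt hδ (φ.symm z)
  calc |gram φ (gδ δ).inner z i j - gram φ g.inner z i j|
      = |gram φ ((gδ δ).inner - g.inner : Tensor2 n M) z i j| := rfl
    _ ≤ _ * norm2 h.inner ((gδ δ).inner - g.inner : Tensor2 n M) (φ.symm z) :=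
        abs_gram_le hφ h _ (hK hz) i j
    _ ≤ C * norm2 h.inner ((gδ δ).inner - g.inner : Tensor2 n M) (φ.symm z) :=
        mul_le_mul_of_nonneg_right (hCK z hz) (norm2_nonneg _ _ _)
    _ < C * (ε / C) := mul_lt_mul_of_pos_left h2 hC
    _ = ε := mul_div_cancel₀ _ hC.ne'

/-- The tensor chosen as weak derivative carries no measurability of its own. Its components are a
weak partial derivative, locally integrable by definition, minus continuous Christoffel terms. -/
lemma aestronglyMeasurable_wcd (hφ : φ ∈ atlas (E n) M) (hK : K ⊆ φ.target) (hc : IsCompact K)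
    (h : SmoothMetric n M) {g : ContMetric n M} (hg : ∃ T, HasWeakCovDeriv h.inner g.inner T)
    (k i j : Fin n) :
    AEStronglyMeasurable (fun z => wcd φ h.inner g.inner z k i j) (volume.restrict K) := by
  have h1 := ((locallyIntegrableOn_iff φ.open_target.isLocallyClosed).1
    (weakCovDeriv_spec hg φ hφ k i j).2.1 K hK hc).1
  have hΓ := fun a b c => (contDiffOn_christoffel hφ h a b c).continuousOn.mono hK
  have hG := fun a b => (continuousOn_gram_apply hφ g a b).mono hK
  have h2 : ContinuousOn (fun z => ∑ l, christoffel φ h.inner l k i z * gram φ g.inner z l j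
      + ∑ l, christoffel φ h.inner l k j z * gram φ g.inner z i l) K :=
    (continuousOn_finsetSum _ fun l _ => (hΓ _ _ _).mul (hG _ _)).add
      (continuousOn_finsetSum _ fun l _ => (hΓ _ _ _).mul (hG _ _))
  refine (h1.sub (h2.aestronglyMeasurable hc.measurableSet)).congr
    (Eventually.of_forall fun z => ?_)
  simp only [Pi.sub_apply, wcd]
  ring

variable [CompactSpace M] [MeasurableSpace M] [BorelSpace M]

lemma lpConv_wcd (hn : 1 ≤ n) (hφ : φ ∈ atlas (E n) M) (hK : K ⊆ φ.target) (hc : IsCompact K)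
    {h : SmoothMetric n M} {g : ContMetric n M} (hg : MemW1 h.inner n g.inner)
    {gδ : ℝ → SmoothMetric n M}
    (hW1 : Tendsto (fun δ => distW1 h.inner n (gδ δ).inner g.inner) (𝓝[>] 0) (𝓝 0))
    (k i j : Fin n) :
    LpConv (volume.restrict K) n (fun δ z => wcd φ h.inner (gδ δ).inner z k i j)
      fun z => wcd φ h.inner g.inner z k i j := by
  have hcont : ContinuousOn (fun z => √(gram φ h.inner z k k
      * (gram φ h.inner z i i * gram φ h.inner z j j))) K :=
    (((contDiffOn_gram_apply hφ h k k).continuousOn.mul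
      ((contDiffOn_gram_apply hφ h i i).continuousOn.mul
      (contDiffOn_gram_apply hφ h j j).continuousOn)).sqrt).mono hK
  obtain ⟨C, hC, H⟩ := exists_eLpNorm_le_of_abs_le hφ h hK hc (p := n)
    (by exact_mod_cast (by omega : n ≠ 0)) (by simp) hcont
  have hb : ∀ T : Tensor3 n M, eLpNorm (fun z => comp3 φ T z k i j) n (volume.restrict K)
      ≤ C * eLpNorm (norm3 h.inner T) n (vol h.inner) := fun T =>
    H _ _ (norm3_nonneg _ _) fun z hz => abs_comp3_le hφ h T (hK hz) k i j
  refine ⟨⟨aestronglyMeasurable_wcd hφ hK hc h hg.1 k i j, (hb _).trans_lt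
    (ENNReal.mul_lt_top hC.lt_top hg.2.2.2)⟩, Eventually.of_forall fun δ =>
    ((Approx.const h (gδ δ)).tConv φ hφ K hK hc k i j).memLp.1, ?_⟩
  have h0 := ENNReal.Tendsto.const_mul (a := C) hW1 (Or.inr hC)
  rw [mul_zero] at h0
  refine tendsto_of_tendsto_of_tendsto_of_le_of_le tendsto_const_nhds h0
    (fun _ => zero_le) fun δ => ?_
  -- Components are linear in the tensor, so the norm bound applies to the difference of the
  -- derivatives, whose norm is the second summand of `distW1`.
  refine (hb (weakCovDeriv h.inner (gδ δ).inner - weakCovDeriv h.inner g.inner)).trans ?_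
  exact mul_le_mul_right le_add_self _

lemma approx_of_tendsto (hn : 1 ≤ n) {h : SmoothMetric n M} {g : ContMetric n M}
    (hg : MemW1 h.inner n g.inner) {gδ : ℝ → SmoothMetric n M}
    (hC0 : Tendsto (fun δ => distC0 h.inner (gδ δ).inner g.inner) (𝓝[>] 0) (𝓝 0))
    (hW1 : Tendsto (fun δ => distW1 h.inner n (gδ δ).inner g.inner) (𝓝[>] 0) (𝓝 0)) :
    Approx h g.inner gδ where
  metric := isMetric_cont g
  exT := hg.1
  gramConv _ hφ _ hK hc i j := contConv_gram hφ hK hc hC0 i j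
  tConv _ hφ _ hK hc k i j := lpConv_wcd hn hφ hK hc hg hW1 k i j

end Hypotheses

/-! ### Hölder duality for converging coefficients. -/

section Holder

variable {X : Type*} [MeasurableSpace X] {μ : Measure X} {p q : ℝ≥0∞}
  {f : ℝ → X → ℝ} {F : X → ℝ}

lemma LpConv.tendsto_toReal (hf : LpConv μ q f F) :
    Tendsto (fun δ => (eLpNorm (f δ - F) q μ).toReal) (𝓝[>] (0 : ℝ)) (𝓝 0) := by
  have h : Tendsto _ _ (𝓝 (0 : ℝ≥0∞).toReal) :=
    (ENNReal.tendsto_toReal ENNReal.zero_ne_top).comp hf.tendsto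
  rwa [ENNReal.toReal_zero] at h

lemma abs_integral_mul_le [hpq : ENNReal.HolderTriple q p 1] {f G : X → ℝ} (hf : MemLp f q μ)
    (hG : MemLp G p μ) :
    |∫ x, f x * G x ∂μ| ≤ (eLpNorm f q μ).toReal * (eLpNorm G p μ).toReal := by
  rw [← ENNReal.toReal_mul, ← Real.norm_eq_abs, ← toReal_enorm]
  refine ENNReal.toReal_mono (ENNReal.mul_ne_top hf.2.ne hG.2.ne) ?_
  refine (enorm_integral_le_lintegral_enorm _).trans ?_
  rw [← eLpNorm_one_eq_lintegral_enorm]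
  have h : eLpNorm (f • G) 1 μ ≤ eLpNorm f q μ * eLpNorm G p μ :=
    eLpNorm_smul_le_mul_eLpNorm hG.1 hf.1
  exact h

/-- The pairing with `f δ` converges to the pairing with `F`, uniformly on bounded sets. -/
lemma LpConv.pairing_le [hpq : ENNReal.HolderTriple q p 1] (hf : LpConv μ q f F) :
    ∀ᶠ δ in 𝓝[>] (0 : ℝ), ∀ G : X → ℝ, MemLp G p μ →
      Integrable (fun x => (f δ x - F x) * G x) μ ∧
      |∫ x, (f δ x - F x) * G x ∂μ| ≤ (eLpNorm (f δ - F) q μ).toReal * (eLpNorm G p μ).toReal := by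
  filter_upwards [hf.memLp_sub] with δ h G hG
  exact ⟨memLp_one_iff_integrable.1 (hG.mul h), abs_integral_mul_le h hG⟩

end Holder

/-! ### Dual exponents and the Sobolev inequality. -/

section Sobolev

variable {n : ℕ} {K : Set (E n)} {w : E n → ℝ}

/-- The exponent `n/(n-1)`. -/
abbrev conjExp (n : ℕ) : ℝ≥0∞ := ENNReal.ofReal ((n : ℝ) / ((n : ℝ) - 1))

lemma one_le_conjExp (hn : 2 ≤ n) : 1 ≤ conjExp n := by
  have h2 : (2 : ℝ) ≤ n := by exact_mod_cast hn
  rw [conjExp, ENNReal.one_le_ofReal, le_div_iff₀ (by linarith)]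
  linarith

lemma holderTriple_conjExp (hn : 2 ≤ n) : ENNReal.HolderTriple n (conjExp n) 1 := by
  have h2 : (2 : ℝ) ≤ n := by exact_mod_cast hn
  refine ⟨?_⟩
  rw [← ENNReal.ofReal_natCast, conjExp, ← ENNReal.ofReal_inv_of_pos (by linarith),
    ← ENNReal.ofReal_inv_of_pos (by apply div_pos <;> linarith),
    ← ENNReal.ofReal_add (by positivity) (inv_nonneg.2 (by apply div_nonneg <;> linarith)),
    inv_one, ENNReal.ofReal_eq_one]
  have : (n : ℝ) - 1 ≠ 0 := by linarith
  field_simp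
  ring

/-- `2/n + (n-2)/n = 1`. The exponent `n/(n-2)` is finite only from dimension three on, which is why
dimension two needs a separate argument. -/
lemma holderTriple_sobolev (hn : 3 ≤ n) :
    ENNReal.HolderTriple ((n : ℝ≥0∞) / 2) (ENNReal.ofReal ((n : ℝ) / ((n : ℝ) - 2))) 1 := by
  have h2 : (3 : ℝ) ≤ n := by exact_mod_cast hn
  have e : (n : ℝ≥0∞) / 2 = ENNReal.ofReal ((n : ℝ) / 2) := by
    rw [ENNReal.ofReal_div_of_pos two_pos, ENNReal.ofReal_natCast]
    simp
  refine ⟨?_⟩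
  rw [e, ← ENNReal.ofReal_inv_of_pos (by linarith),
    ← ENNReal.ofReal_inv_of_pos (by apply div_pos <;> linarith),
    ← ENNReal.ofReal_add (by positivity) (inv_nonneg.2 (by apply div_nonneg <;> linarith)),
    inv_one, ENNReal.ofReal_eq_one]
  have : (n : ℝ) - 2 ≠ 0 := by linarith
  field_simp
  ring

lemma norm_fderiv_le_sum (z : E n) : ‖fderiv ℝ w z‖ ≤ ∑ k, ‖pd k w z‖ := by
  refine ContinuousLinearMap.opNorm_le_bound _ (by positivity) fun v => ?_
  rw [map_eq_sum_single (fderiv ℝ w z) v, Finset.sum_mul]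
  refine (norm_sum_le _ _).trans (Finset.sum_le_sum fun k _ => ?_)
  rw [norm_smul, mul_comm]
  exact mul_le_mul_of_nonneg_left (PiLp.norm_apply_le v k) (norm_nonneg _)

lemma eLpNorm_fderiv_le_sum {p : ℝ≥0∞} (hp : 1 ≤ p) (hw : ContDiff ℝ ∞ w) :
    eLpNorm (fderiv ℝ w) p volume ≤ ∑ k, eLpNorm (pd k w) p volume := by
  calc eLpNorm (fderiv ℝ w) p volume
      ≤ eLpNorm (∑ k, fun z => ‖pd k w z‖) p volume :=
        eLpNorm_mono_real fun z => by simpa using norm_fderiv_le_sum z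
    _ ≤ ∑ k, eLpNorm (fun z => ‖pd k w z‖) p volume :=
        eLpNorm_sum_le (fun k _ => (contDiff_pd hw).continuous.norm.aestronglyMeasurable) hp
    _ = _ := Finset.sum_congr rfl fun k _ => eLpNorm_norm _

lemma memLp_of_tsupport_subset (hc : IsCompact K) {f : E n → ℝ} (hf : Continuous f)
    (hK : tsupport f ⊆ K) (p : ℝ≥0∞) : MemLp f p volume :=
  hf.memLp_of_hasCompactSupport (hc.of_isClosed_subset (isClosed_tsupport f) hK)

lemma eLpNorm_restrict_of_tsupport {f : E n → ℝ} (hK : tsupport f ⊆ K) (p : ℝ≥0∞) :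
    eLpNorm f p (volume.restrict K) = eLpNorm f p volume :=
  eLpNorm_restrict_eq_of_support_subset ((subset_tsupport f).trans hK)

/-- The sum of the norms of the partial derivatives. -/
def gradNorm (p : ℝ≥0∞) (w : E n → ℝ) : ℝ := ∑ k, (eLpNorm (pd k w) p volume).toReal

/-- The Sobolev inequality for functions with compact support. -/
lemma exists_sobolev_le (hn : 3 ≤ n) : ∃ C : ℝ, 0 ≤ C ∧ ∀ w : E n → ℝ, ContDiff ℝ ∞ w →
    HasCompactSupport w →
      (eLpNorm w (ENNReal.ofReal ((n : ℝ) / ((n : ℝ) - 2))) volume).toReal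
        ≤ C * gradNorm (conjExp n) w := by
  have h3 : (3 : ℝ) ≤ n := by exact_mod_cast hn
  refine ⟨SNormLESNormFDerivOfEqConst ℝ (volume : Measure (E n))
    (((n : ℝ) / ((n : ℝ) - 1)).toNNReal : ℝ), NNReal.coe_nonneg _,
    fun w hw hc => ?_⟩
  -- Gagliardo–Nirenberg–Sobolev with `1/p' = 1/p - 1/n`, here `(n-2)/n = (n-1)/n - 1/n`.
  have h1 := eLpNorm_le_eLpNorm_fderiv_of_eq (volume : Measure (E n))
    (p := ((n : ℝ) / ((n : ℝ) - 1)).toNNReal) (p' := ((n : ℝ) / ((n : ℝ) - 2)).toNNReal)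
    (hw.of_le (by simp)) hc
    (by
      rw [Real.one_le_toNNReal, le_div_iff₀ (by linarith)]
      linarith)
    (by simp; omega)
    (by
      rw [Real.coe_toNNReal _ (by apply div_nonneg <;> linarith),
        NNReal.coe_inv, Real.coe_toNNReal _ (by apply div_nonneg <;> linarith)]
      simp only [finrank_euclideanSpace, Fintype.card_fin]
      have a1 : (n : ℝ) - 1 ≠ 0 := by linarith
      have a2 : (n : ℝ) - 2 ≠ 0 := by linarith
      field_simp
      ring)
  have hfin : ∀ k, eLpNorm (pd k w) (conjExp n) volume ≠ ⊤ := fun k =>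
    (memLp_of_tsupport_subset hc (contDiff_pd hw).continuous (tsupport_pd_subset w) _).2.ne
  have h2 := h1.trans (mul_le_mul_right
    (eLpNorm_fderiv_le_sum (one_le_conjExp (by omega)) hw) _)
  have h4 := ENNReal.toReal_mono (ENNReal.mul_ne_top ENNReal.coe_ne_top
    (ENNReal.sum_ne_top.2 fun k _ => hfin k)) h2
  rw [ENNReal.toReal_mul, ENNReal.toReal_sum fun k _ => hfin k] at h4
  exact h4

end Sobolev

/-! ### The local estimate in dimension at least three. -/

section LocalEstimate

variable {n : ℕ} {M : Type*} [TopologicalSpace M] [ChartedSpace (E n) M]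
  [IsManifold (𝓡 n) ∞ M] {φ : OpenPartialHomeomorph M (E n)} {K : Set (E n)}
  {h : SmoothMetric n M} {g : Tensor2 n M} {gδ : ℝ → SmoothMetric n M}

/-- The difference of the pairings of `gδ` and `g`, for functions supported in `K`, is small. -/
def LocalEstimate (φ : OpenPartialHomeomorph M (E n)) (K : Set (E n)) (h : SmoothMetric n M)
    (g : Tensor2 n M) (gδ : ℝ → SmoothMetric n M) : Prop :=
  ∃ e : ℝ → ℝ, Tendsto e (𝓝[>] 0) (𝓝 0) ∧ ∀ᶠ δ in 𝓝[>] (0 : ℝ), ∀ w : E n → ℝ,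
    ContDiff ℝ ∞ w → tsupport w ⊆ K →
      |(∫ z in K, dens φ h.inner z * localIntegrand φ h.inner (gδ δ).inner w z)
        - ∫ z in K, dens φ h.inner z * localIntegrand φ h.inner g w z|
        ≤ e δ * gradNorm (conjExp n) w

/-- The first order part pairs `L^n` with `L^{n/(n-1)}`; the zeroth order part pairs `L^{n/2}` with
`L^{n/(n-2)}`, and there the Sobolev inequality replaces `w` by its gradient. -/
lemma Approx.localEstimate_of_three_le (H : Approx h g gδ) (hn : 3 ≤ n) (hφ : φ ∈ atlas (E n) M)
    (hK : K ⊆ φ.target) (hc : IsCompact K) : LocalEstimate φ K h g gδ := by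
  have hn2 : 2 ≤ n := by omega
  have hn1 : 1 ≤ (n : ℝ≥0∞) := by exact_mod_cast (by omega : 1 ≤ n)
  have := holderTriple_conjExp hn2
  have := holderTriple_sobolev hn
  have hd := dens_top hφ h hK hc
  have hA := fun k => hd.mul hn1 (H.coefAConv hn1 hφ hK hc k)
  have hB := hd.mul (one_le_half hn2) (H.coefBConv hn2 hφ hK hc)
  obtain ⟨C, hC0, hC⟩ := exists_sobolev_le hn
  refine ⟨_, ((tendsto_finsetSum Finset.univ fun k _ => (hA k).tendsto_toReal).add
    (hB.tendsto_toReal.mul_const C)).trans (by simp), ?_⟩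
  have hA' := eventually_all.2 fun k => (hA k).pairing_le (p := conjExp n)
  filter_upwards [hA', hB.pairing_le (p := ENNReal.ofReal ((n : ℝ) / ((n : ℝ) - 2))),
    self_mem_nhdsWithin] with δ h1 h2 hδ w hw hs
  have hpd : ∀ k, tsupport (pd k w) ⊆ K := fun k => (tsupport_pd_subset w).trans hs
  have m1 := fun k => memLp_of_tsupport_subset hc (contDiff_pd (k := k) hw).continuous (hpd k)
    (conjExp n)
  have m2 := memLp_of_tsupport_subset hc hw.continuous hs
    (ENNReal.ofReal ((n : ℝ) / ((n : ℝ) - 2)))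
  have b1 := fun k => h1 k (pd k w) ((m1 k).restrict K)
  have b2 := h2 w (m2.restrict K)
  simp only [eLpNorm_restrict_of_tsupport (hpd _)] at b1
  rw [eLpNorm_restrict_of_tsupport hs] at b2
  have i1 := memLp_one_iff_integrable.1 (H.localConv hn2 hφ hK hc hw.contDiffOn).memLp
  have i2 := memLp_one_iff_integrable.1
    ((Approx.const h (gδ δ)).localConv hn2 hφ hK hc hw.contDiffOn).memLp
  rw [← integral_sub i2 i1]
  have e : ∀ z, dens φ h.inner z * localIntegrand φ h.inner (gδ δ).inner w z
      - dens φ h.inner z * localIntegrand φ h.inner g w z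
      = ∑ k, (dens φ h.inner z * coefA φ h.inner (gδ δ).inner k z
          - dens φ h.inner z * coefA φ h.inner g k z) * pd k w z
        + (dens φ h.inner z * coefB φ h.inner (gδ δ).inner z
          - dens φ h.inner z * coefB φ h.inner g z) * w z := fun z => by
    simp only [localIntegrand, sub_mul, Finset.sum_sub_distrib, mul_add, Finset.mul_sum, mul_assoc]
    ring
  simp only [e]
  rw [integral_add (integrable_finsetSum _ fun k _ => (b1 k).1) b2.1,
    integral_finsetSum _ fun k _ => (b1 k).1, add_mul, mul_assoc]
  refine (abs_add_le _ _).trans (add_le_add ((Finset.abs_sum_le_sum_abs _ _).trans ?_) (b2.2.trans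
    (mul_le_mul_of_nonneg_left (hC w hw (hc.of_isClosed_subset (isClosed_tsupport w) hs))
      ENNReal.toReal_nonneg)))
  rw [Finset.sum_mul]
  refine Finset.sum_le_sum fun k _ => (b1 k).2.trans (mul_le_mul_of_nonneg_left ?_
    ENNReal.toReal_nonneg)
  exact Finset.single_le_sum (f := fun k => (eLpNorm (pd k w) (conjExp n) volume).toReal)
    (fun _ _ => ENNReal.toReal_nonneg) (Finset.mem_univ k)

end LocalEstimate

/-! ### Dimension two: curvature as a divergence. -/

/-- The scalar curvature in dimension two, up to a quadratic term in the Christoffel symbols `G` of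
the metric, is a divergence: the algebraic part of the statement. Here `C` are the Christoffel
symbols of the background metric, `dC` their derivatives, and `P` is the inverse metric. -/
lemma two_dim_curvature_identity (P : Fin 2 → Fin 2 → ℝ) (C G : Fin 2 → Fin 2 → Fin 2 → ℝ)
    (dC : Fin 2 → Fin 2 → Fin 2 → Fin 2 → ℝ) (hP : ∀ i j, P i j = P j i)
    (hC : ∀ k i j, C k i j = C k j i) (hG : ∀ k i j, G k i j = G k j i)
    (hdC : ∀ m k i j, dC m k i j = dC m k j i) (Γ : Fin 2 → Fin 2 → Fin 2 → ℝ)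
    (hΓ : ∀ k i j, Γ k i j = G k i j - C k i j) (D : Fin 2 → Fin 2 → Fin 2 → ℝ)
    (hD : ∀ k i j, D k i j = -∑ l, Γ i k l * P l j - ∑ l, Γ j k l * P i l) :
    (∑ i, ∑ j, P i j * (∑ k, dC k k i j - ∑ k, dC j k i k
          + ∑ k, ∑ l, (C k k l * C l i j - C k j l * C l i k))
        - ∑ k, ∑ i, ∑ j, D k i j * Γ k i j + ∑ k, ∑ i, ∑ j, D k i k * Γ j j i
        + ∑ i, ∑ j, P i j * ∑ k, ∑ l, (Γ k k l * Γ l i j - Γ k j l * Γ l i k))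
      - ∑ k, (∑ i, ∑ j, P i j * Γ k i j - ∑ i, ∑ j, P i k * Γ j j i) * ∑ l, Γ l k l
    = ∑ k, ((∑ i, ∑ j, (((∑ l, G l k l) * P i j - ∑ l, G i k l * P l j - ∑ l, G j k l * P i l)
          * C k i j + P i j * dC k k i j))
        - ∑ i, ∑ j, (((∑ l, G l k l) * P i k - ∑ l, G i k l * P l k - ∑ l, G k k l * P i l)
          * C j j i + P i k * dC k j j i))
      - ∑ i, ∑ j, P i j * ∑ k, ∑ l, (G k k l * G l i j - G k j l * G l i k) := by
  -- The symmetry rewrites put every index pair in the order `0 1`, so that each independent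
  -- component is a single variable and a polynomial identity remains.
  simp only [Fin.sum_univ_two, hD, hΓ, hP 1 0, hC _ 1 0, hG _ 1 0, hdC _ _ 1 0]
  ring

section DifferenceTensor

variable {n : ℕ} {M : Type*} [TopologicalSpace M] [ChartedSpace (E n) M]
  {φ : OpenPartialHomeomorph M (E n)}

/-- The difference of the Christoffel symbols of two metrics. -/
def diffChr (φ : OpenPartialHomeomorph M (E n)) (h S : Tensor2 n M) (k i j : Fin n) (z : E n) : ℝ :=
  christoffel φ S k i j z - christoffel φ h k i j z

lemma diffChr_symm {h S : Tensor2 n M} (hh : IsMetric h) (hS : IsMetric S) (k i j : Fin n)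
    (z : E n) : diffChr φ h S k i j z = diffChr φ h S k j i z := by
  rw [diffChr, diffChr, christoffel_symm hh, christoffel_symm hS]

variable [IsManifold (𝓡 n) ∞ M]

lemma covD_single_self (hφ : φ ∈ atlas (E n) M) (S : SmoothMetric n M) {z : E n}
    (hz : z ∈ φ.target) (k i j : Fin n) :
    covD φ S.inner S.inner z (EuclideanSpace.single k 1) (EuclideanSpace.single i 1)
      (EuclideanSpace.single j 1) = 0 :=
  congrFun (congrFun (covMat_self hφ S hz k) i) j

lemma pd_gram_self (hφ : φ ∈ atlas (E n) M) (S : SmoothMetric n M) {z : E n}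
    (hz : z ∈ φ.target) (k i j : Fin n) : pd k (fun w => gram φ S.inner w i j) z
      = ∑ l, christoffel φ S.inner l k i z * gram φ S.inner z l j
        + ∑ l, christoffel φ S.inner l k j z * gram φ S.inner z i l := by
  have h1 := covD_single hφ S.inner S hz k i j
  rw [covD_single_self hφ S hz] at h1
  linarith

/-- Since `S` is parallel for its own connection, `∂_k S` consists of Christoffel terms of `S`;
subtracting those of `h` leaves the difference tensor. -/
lemma covD_single_eq (hφ : φ ∈ atlas (E n) M) (h S : SmoothMetric n M) {z : E n}
    (hz : z ∈ φ.target) (k i j : Fin n) :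
    covD φ h.inner S.inner z (EuclideanSpace.single k 1) (EuclideanSpace.single i 1)
      (EuclideanSpace.single j 1) = ∑ l, diffChr φ h.inner S.inner l k i z * gram φ S.inner z l j
        + ∑ l, diffChr φ h.inner S.inner l k j z * gram φ S.inner z i l := by
  rw [covD_single hφ h.inner S hz, pd_gram_self hφ S hz]
  simp only [diffChr, sub_mul, Finset.sum_sub_distrib]
  ring

lemma pd_gram_inv_self (hφ : φ ∈ atlas (E n) M) (S : SmoothMetric n M) {z : E n}
    (hz : z ∈ φ.target) (k i j : Fin n) : pd k (fun w => (gram φ S.inner w)⁻¹ i j) z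
      = -∑ l, christoffel φ S.inner i k l z * (gram φ S.inner z)⁻¹ l j
        - ∑ l, christoffel φ S.inner j k l z * (gram φ S.inner z)⁻¹ i l := by
  rw [pd_gram_inv hφ S.inner S hz]
  simp [covD_single_self hφ S hz]

lemma sum_inv_mul_gram {S : Tensor2 n M} (hS : IsMetric S) (hφ : φ ∈ atlas (E n) M) {z : E n}
    (hz : z ∈ φ.target) (i j : Fin n) :
    ∑ l, (gram φ S z)⁻¹ i l * gram φ S z l j = if i = j then 1 else 0 := by
  have := congrFun (congrFun (Matrix.nonsing_inv_mul _
    (isUnit_iff_ne_zero.2 (det_gram_pos hS hφ hz).ne')) i) j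
  rwa [Matrix.mul_apply, Matrix.one_apply] at this

variable {h S : SmoothMetric n M} {z : E n}

/-- The weak covariant derivative of a smooth metric has its classical components at `z`. -/
def IsClassicalAt (φ : OpenPartialHomeomorph M (E n)) (h S : SmoothMetric n M) (z : E n) : Prop :=
  ∀ k i j, wcd φ h.inner S.inner z k i j = covD φ h.inner S.inner z
    (EuclideanSpace.single k 1) (EuclideanSpace.single i 1) (EuclideanSpace.single j 1)

lemma ae_isClassicalAt (hφ : φ ∈ atlas (E n) M) (h S : SmoothMetric n M) :
    ∀ᵐ z ∂volume.restrict φ.target, IsClassicalAt φ h S z :=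
  ae_all_iff.2 fun k => ae_all_iff.2 fun i => ae_all_iff.2 fun j =>
    comp3_weakCovDeriv_ae hφ h S k i j

namespace IsClassicalAt

lemma wcd_eq (H : IsClassicalAt φ h S z) (hφ : φ ∈ atlas (E n) M) (hz : z ∈ φ.target)
    (k i j : Fin n) : wcd φ h.inner S.inner z k i j
      = ∑ l, diffChr φ h.inner S.inner l k i z * gram φ S.inner z l j
        + ∑ l, diffChr φ h.inner S.inner l k j z * gram φ S.inner z i l := by
  rw [H, covD_single_eq hφ h S hz]

/-- In the Koszul combination of the three derivatives, written through the symmetric difference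
tensor, four terms cancel and two coincide; the inverse metric then undoes the lowering of the
index. -/
lemma Gam_eq (H : IsClassicalAt φ h S z) (hφ : φ ∈ atlas (E n) M) (hz : z ∈ φ.target)
    (k i j : Fin n) : Gam φ h.inner S.inner k i j z = diffChr φ h.inner S.inner k i j z := by
  have hS := isMetric_smooth S
  have hh := isMetric_smooth h
  have e : ∀ l, comp3 φ (weakCovDeriv h.inner S.inner) z i j l
      + comp3 φ (weakCovDeriv h.inner S.inner) z j i l
      - comp3 φ (weakCovDeriv h.inner S.inner) z l i j
      = 2 * ∑ m, gram φ S.inner z l m * diffChr φ h.inner S.inner m i j z := fun l => by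
    have e1 := H.wcd_eq hφ hz i j l
    have e2 := H.wcd_eq hφ hz j i l
    have e3 := H.wcd_eq hφ hz l i j
    simp only [wcd] at e1 e2 e3
    rw [e1, e2, e3]
    simp only [diffChr_symm hh hS _ j i, diffChr_symm hh hS _ l i, diffChr_symm hh hS _ l j,
      gram_symm hS z i, gram_symm hS z l, mul_comm (gram φ S.inner z _ _)]
    have e4 : ∀ m, gram φ S.inner z j m = gram φ S.inner z m j := fun m => gram_symm hS z j m
    simp only [e4]
    ring
  have hI := sum_inv_mul_gram hS hφ hz k
  simp only [Gam, e]
  have : ∀ l, (gram φ S.inner z)⁻¹ k l * (2 * ∑ m, gram φ S.inner z l m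
      * diffChr φ h.inner S.inner m i j z) = 2 * ∑ m, (gram φ S.inner z)⁻¹ k l
      * gram φ S.inner z l m * diffChr φ h.inner S.inner m i j z := fun l => by
    simp only [Finset.mul_sum]
    exact Finset.sum_congr rfl fun m _ => by ring
  simp only [this]
  rw [← Finset.mul_sum, Finset.sum_comm]
  simp only [← Finset.sum_mul, hI]
  simp

lemma invD_eq (H : IsClassicalAt φ h S z) (hφ : φ ∈ atlas (E n) M) (hz : z ∈ φ.target)
    (k i j : Fin n) : invD φ h.inner S.inner z k i j
      = -∑ l, diffChr φ h.inner S.inner i k l z * (gram φ S.inner z)⁻¹ l j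
        - ∑ l, diffChr φ h.inner S.inner j k l z * (gram φ S.inner z)⁻¹ i l := by
  have h1 := pd_gram_inv hφ h.inner S hz k i j
  have h2 := pd_gram_inv_self hφ S hz k i j
  simp only [invD, H k]
  simp only [diffChr, sub_mul, Finset.sum_sub_distrib]
  linarith

lemma trT_eq (H : IsClassicalAt φ h S z) (hφ : φ ∈ atlas (E n) M) (hz : z ∈ φ.target)
    (k : Fin n) :
    trT φ h.inner S.inner k z = 2 * ∑ l, diffChr φ h.inner S.inner l k l z := by
  have hS := isMetric_smooth S
  have hI := sum_inv_mul_gram hS hφ hz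
  have e1 : ∀ i, ∑ j, (gram φ S.inner z)⁻¹ i j * ∑ l, diffChr φ h.inner S.inner l k i z
      * gram φ S.inner z l j = diffChr φ h.inner S.inner i k i z := fun i => by
    simp only [Finset.mul_sum]
    rw [Finset.sum_comm]
    have : ∀ l j, (gram φ S.inner z)⁻¹ i j * (diffChr φ h.inner S.inner l k i z
        * gram φ S.inner z l j) = diffChr φ h.inner S.inner l k i z
        * ((gram φ S.inner z)⁻¹ i j * gram φ S.inner z j l) := fun l j => by
      rw [gram_symm hS z l j]; ring
    simp only [this, ← Finset.mul_sum, hI]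
    simp
  have e2 : ∀ j, ∑ i, (gram φ S.inner z)⁻¹ i j * ∑ l, diffChr φ h.inner S.inner l k j z
      * gram φ S.inner z i l = diffChr φ h.inner S.inner j k j z := fun j => by
    rw [← e1 j]
    exact Finset.sum_congr rfl fun i _ => by
      rw [gram_inv_symm hS z i j]
      simp only [gram_symm hS z i]
  simp only [trT, H.wcd_eq hφ hz, mul_add, Finset.sum_add_distrib]
  rw [Finset.sum_comm (f := fun i j => (gram φ S.inner z)⁻¹ i j
    * ∑ l, diffChr φ h.inner S.inner l k j z * gram φ S.inner z i l)]
  simp only [e1, e2]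
  ring

end IsClassicalAt

/-- Jacobi's formula with a parallel metric: the trace of `g⁻¹ ∂_k g` is twice the trace of the
Christoffel symbols, and the square root halves it. -/
lemma pd_dens_self (hφ : φ ∈ atlas (E n) M) (S : SmoothMetric n M) (hz : z ∈ φ.target)
    (k : Fin n) : pd k (dens φ S.inner) z
      = dens φ S.inner z * ∑ l, christoffel φ S.inner l k l z := by
  have hS := isMetric_smooth S
  have hd := det_gram_pos hS hφ hz
  have hI := sum_inv_mul_gram hS hφ hz
  have h1 := pd_det (k := k) (differentiableAt_gram_apply hφ S hz) hd.ne'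
  have h2 : ((gram φ S.inner z)⁻¹ * pdMat k (gram φ S.inner) z).trace
      = 2 * ∑ l, christoffel φ S.inner l k l z := by
    have hu := isUnit_iff_ne_zero.2 hd.ne'
    rw [pdMat_gram hφ S.inner S hz, covMat_self hφ S hz, zero_add, Matrix.mul_add,
      Matrix.trace_add, Matrix.trace_mul_comm _ (_ * gram φ S.inner z), Matrix.mul_assoc,
      Matrix.mul_nonsing_inv _ hu, Matrix.mul_one, Matrix.trace_transpose, ← Matrix.mul_assoc,
      Matrix.nonsing_inv_mul _ hu, Matrix.one_mul]
    simp only [Matrix.trace, Matrix.diag, chrMat, Matrix.of_apply]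
    ring
  have h3 := pd_sqrt_div (k := k) (differentiableAt_det_gram hφ S hz)
    (differentiableAt_const (1 : ℝ)) hd one_pos h1 (b := 0) (by simp [pd])
  simp only [div_one, h2] at h3
  rw [show dens φ S.inner = fun w => √(gram φ S.inner w).det from rfl, h3]
  ring

end DifferenceTensor

lemma pd_pd_comm {n : ℕ} {Ω : Set (E n)} (hΩ : IsOpen Ω) {f : E n → ℝ} (hf : ContDiffOn ℝ ∞ f Ω)
    {z : E n} (hz : z ∈ Ω) (k l : Fin n) : pd k (pd l f) z = pd l (pd k f) z := by
  have h1 := hf.contDiffAt (hΩ.mem_nhds hz)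
  have hd : DifferentiableAt ℝ (fderiv ℝ f) z :=
    (h1.fderiv_right (m := ∞) (by simp)).differentiableAt (by simp)
  have e : ∀ k l : Fin n, pd k (pd l f) z = fderiv ℝ (fderiv ℝ f) z
      (EuclideanSpace.single k 1) (EuclideanSpace.single l 1) := fun k l => by
    have h2 := hd.hasFDerivAt.clm_apply (hasFDerivAt_const (EuclideanSpace.single l (1 : ℝ)) z)
    have h3 : pd l f = fun y => fderiv ℝ f y (EuclideanSpace.single l 1) := rfl
    rw [pd, h3, h2.fderiv]
    simp
  rw [e, e, (h1.isSymmSndFDerivAt minSmoothness_two_le).eq]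

/-- In dimension two the quadratic term in the Christoffel symbols `G` of the metric `g` is a
Jacobian determinant: that of the functions `g₀₀ / √det g` and `g₀₁ / g₀₀`. -/
lemma two_dim_jacobian (g P : Fin 2 → Fin 2 → ℝ) (G : Fin 2 → Fin 2 → Fin 2 → ℝ) (s : ℝ)
    (hs : s ≠ 0) (h0 : g 0 0 ≠ 0) (hdet : s ^ 2 = g 0 0 * g 1 1 - g 0 1 * g 1 0)
    (hg : ∀ i j, g i j = g j i) (hG : ∀ k i j, G k i j = G k j i)
    (hP00 : P 0 0 = g 1 1 / s ^ 2) (hP01 : P 0 1 = -g 0 1 / s ^ 2) (hP10 : P 1 0 = -g 1 0 / s ^ 2)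
    (hP11 : P 1 1 = g 0 0 / s ^ 2) (d : Fin 2 → Fin 2 → Fin 2 → ℝ)
    (hd : ∀ k i j, d k i j = ∑ l, G l k i * g l j + ∑ l, G l k j * g i l) :
    s * ∑ i, ∑ j, P i j * ∑ k, ∑ l, (G k k l * G l i j - G k j l * G l i k)
      = (d 0 0 0 * s - g 0 0 * (s * ∑ l, G l 0 l)) / s ^ 2
          * ((d 1 0 1 * g 0 0 - g 0 1 * d 1 0 0) / g 0 0 ^ 2)
        - (d 1 0 0 * s - g 0 0 * (s * ∑ l, G l 1 l)) / s ^ 2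
          * ((d 0 0 1 * g 0 0 - g 0 1 * d 0 0 0) / g 0 0 ^ 2) := by
  -- The determinant relation eliminates `g 1 1`, leaving an identity of rational functions in `g 0
  -- 0`, `g 0 1`, `s` and the Christoffel symbols.
  have h11 : g 1 1 = (s ^ 2 + g 0 1 ^ 2) / g 0 0 := by
    rw [hg 1 0] at hdet
    field_simp
    linarith
  simp only [Fin.sum_univ_two, hd, hP00, hP01, hP10, hP11, hg 1 0, hG _ 1 0, h11]
  field_simp
  ring

/-! ### Quotient rule and the divergence of the background field. -/

section Derivatives

variable {n : ℕ} {k : Fin n} {z : E n}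

lemma pd_sub {f g : E n → ℝ} (hf : DifferentiableAt ℝ f z) (hg : DifferentiableAt ℝ g z) :
    pd k (fun w => f w - g w) z = pd k f z - pd k g z := by
  simp only [pd]
  rw [fderiv_fun_sub hf hg]
  simp

lemma pd_div {f g : E n → ℝ} (hf : DifferentiableAt ℝ f z) (hg : DifferentiableAt ℝ g z)
    (hz : g z ≠ 0) :
    pd k (fun w => f w / g w) z = (pd k f z * g z - f z * pd k g z) / g z ^ 2 := by
  have h1 : (fun w => f w / g w * g w) =ᶠ[𝓝 z] f := by
    filter_upwards [hg.continuousAt.eventually_ne hz] with w hw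
    exact div_mul_cancel₀ _ hw
  have h0 : DifferentiableAt ℝ (fun w => f w / g w) z := by
    simpa only [div_eq_mul_inv] using hf.fun_mul (hg.fun_inv hz)
  have h2 := pd_mul (k := k) h0 hg
  rw [pd, h1.fderiv_eq] at h2
  rw [eq_div_iff (pow_ne_zero 2 hz)]
  have h3 : pd k f z * g z = (pd k (fun w => f w / g w) z * g z + f z / g z * pd k g z) * g z := by
    rw [← h2]
    rfl
  have h4 : f z / g z * pd k g z * g z = f z * pd k g z := by field_simp
  linear_combination -h3 - h4

end Derivatives

section Divergence

variable {n : ℕ} {M : Type*} [TopologicalSpace M] [ChartedSpace (E n) M]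
  {φ : OpenPartialHomeomorph M (E n)}

/-- The vector density `√(det g) (g^{ij} Γ̃^k_ij - g^{ik} Γ̃^j_ji)`. -/
def bgField (φ : OpenPartialHomeomorph M (E n)) (h g : Tensor2 n M) (k : Fin n) (z : E n) : ℝ :=
  dens φ g z * (∑ i, ∑ j, (gram φ g z)⁻¹ i j * christoffel φ h k i j z
    - ∑ i, ∑ j, (gram φ g z)⁻¹ i k * christoffel φ h j j i z)

/-- The partial derivatives of the metric, computed from its weak covariant derivative. -/
def pdGram (φ : OpenPartialHomeomorph M (E n)) (h g : Tensor2 n M) (z : E n) (k i j : Fin n) : ℝ :=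
  wcd φ h g z k i j + ∑ l, christoffel φ h l k i z * gram φ g z l j
    + ∑ l, christoffel φ h l k j z * gram φ g z i l

variable [IsManifold (𝓡 n) ∞ M] {h S : SmoothMetric n M} {z : E n}

lemma contDiffOn_bgField (hφ : φ ∈ atlas (E n) M) (h S : SmoothMetric n M) (k : Fin n) :
    ContDiffOn ℝ ∞ (bgField φ h.inner S.inner k) φ.target :=
  (contDiffOn_dens hφ S).mul ((ContDiffOn.sum fun i _ => ContDiffOn.sum fun j _ =>
    (contDiffOn_gram_inv hφ S i j).mul (contDiffOn_christoffel hφ h k i j)).sub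
    (ContDiffOn.sum fun i _ => ContDiffOn.sum fun j _ =>
    (contDiffOn_gram_inv hφ S i k).mul (contDiffOn_christoffel hφ h j j i)))

lemma IsClassicalAt.pdGram_eq (H : IsClassicalAt φ h S z) (hφ : φ ∈ atlas (E n) M)
    (hz : z ∈ φ.target) (k i j : Fin n) :
    pdGram φ h.inner S.inner z k i j = pd k (fun w => gram φ S.inner w i j) z := by
  rw [pdGram, H, covD_single hφ h.inner S hz]
  ring

/-- Product rule with `∂_k √det g = √det g Γ^l_kl`; the shape matches the divergence side of
`two_dim_curvature_identity`. -/
lemma pd_bgField (hφ : φ ∈ atlas (E n) M) (h S : SmoothMetric n M) (hz : z ∈ φ.target)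
    (k : Fin n) : pd k (bgField φ h.inner S.inner k) z
      = dens φ S.inner z * ((∑ l, christoffel φ S.inner l k l z)
          * (∑ i, ∑ j, (gram φ S.inner z)⁻¹ i j * christoffel φ h.inner k i j z
            - ∑ i, ∑ j, (gram φ S.inner z)⁻¹ i k * christoffel φ h.inner j j i z)
        + (∑ i, ∑ j, (pd k (fun w => (gram φ S.inner w)⁻¹ i j) z * christoffel φ h.inner k i j z
            + (gram φ S.inner z)⁻¹ i j * pd k (christoffel φ h.inner k i j) z)
          - ∑ i, ∑ j, (pd k (fun w => (gram φ S.inner w)⁻¹ i k) z * christoffel φ h.inner j j i z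
            + (gram φ S.inner z)⁻¹ i k * pd k (christoffel φ h.inner j j i) z))) := by
  have hP := fun i j => differentiableAt_gram_inv_apply hφ S hz i j
  have hC : ∀ k i j, DifferentiableAt ℝ (christoffel φ h.inner k i j) z := fun k i j =>
    ((contDiffOn_christoffel hφ h k i j).contDiffAt (φ.open_target.mem_nhds hz)).differentiableAt
      (by simp)
  have hd : DifferentiableAt ℝ (dens φ S.inner) z :=
    ((contDiffOn_dens hφ S).contDiffAt (φ.open_target.mem_nhds hz)).differentiableAt (by simp)
  have d1 : ∀ i j k, DifferentiableAt ℝ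
      (fun w => (gram φ S.inner w)⁻¹ i j * christoffel φ h.inner k i j w) z :=
    fun i j k => (hP i j).fun_mul (hC k i j)
  have d2 : ∀ i j k, DifferentiableAt ℝ
      (fun w => (gram φ S.inner w)⁻¹ i k * christoffel φ h.inner j j i w) z :=
    fun i j k => (hP i k).fun_mul (hC j j i)
  have s1 : ∀ i k, DifferentiableAt ℝ
      (fun w => ∑ j, (gram φ S.inner w)⁻¹ i j * christoffel φ h.inner k i j w) z :=
    fun i k => DifferentiableAt.fun_sum fun j _ => d1 i j k
  have s2 : ∀ i k, DifferentiableAt ℝ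
      (fun w => ∑ j, (gram φ S.inner w)⁻¹ i k * christoffel φ h.inner j j i w) z :=
    fun i k => DifferentiableAt.fun_sum fun j _ => d2 i j k
  have e1 := pd_sum_univ (fun i => s1 i k) k
  have e2 := pd_sum_univ (fun i => s2 i k) k
  have e : bgField φ h.inner S.inner k = fun w => dens φ S.inner w
      * ((∑ i, ∑ j, (gram φ S.inner w)⁻¹ i j * christoffel φ h.inner k i j w)
        - ∑ i, ∑ j, (gram φ S.inner w)⁻¹ i k * christoffel φ h.inner j j i w) := rfl
  rw [e, pd_mul hd ((DifferentiableAt.fun_sum fun i _ => s1 i k).fun_sub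
    (DifferentiableAt.fun_sum fun i _ => s2 i k)), pd_dens_self hφ S hz,
    pd_sub (DifferentiableAt.fun_sum fun i _ => s1 i k)
    (DifferentiableAt.fun_sum fun i _ => s2 i k), e1, e2]
  simp only [pd_sum_univ (fun j => d1 _ j k), pd_sum_univ (fun j => d2 _ j k),
    pd_mul (hP _ _) (hC _ _ _)]
  ring

end Divergence

/-! ### The Jacobian structure of the quadratic curvature term. -/

section Surfaces

variable {M : Type*} [TopologicalSpace M] [ChartedSpace (E 2) M]
  {φ : OpenPartialHomeomorph M (E 2)}

/-- The function `g₀₀ / √(det g)`. -/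
def gaugeA (φ : OpenPartialHomeomorph M (E 2)) (g : Tensor2 2 M) (z : E 2) : ℝ :=
  gram φ g z 0 0 / dens φ g z

/-- The function `g₀₁ / g₀₀`. -/
def gaugeR (φ : OpenPartialHomeomorph M (E 2)) (g : Tensor2 2 M) (z : E 2) : ℝ :=
  gram φ g z 0 1 / gram φ g z 0 0

/-- The product of `gaugeA` and the partial derivative of `gaugeR`. -/
def rotField (φ : OpenPartialHomeomorph M (E 2)) (h g : Tensor2 2 M) (k : Fin 2) (z : E 2) : ℝ :=
  gaugeA φ g z * ((pdGram φ h g z k 0 1 * gram φ g z 0 0 - gram φ g z 0 1 * pdGram φ h g z k 0 0)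
    / gram φ g z 0 0 ^ 2)

variable [IsManifold (𝓡 2) ∞ M]

lemma gram_zero_zero_pos {g : Tensor2 2 M} (hg : IsMetric g) (hφ : φ ∈ atlas (E 2) M) {z : E 2}
    (hz : z ∈ φ.target) : 0 < gram φ g z 0 0 := (posDef_gram hg hφ hz).diag_pos

variable {h S : SmoothMetric 2 M} {z : E 2}

lemma contDiffOn_gaugeA (hφ : φ ∈ atlas (E 2) M) (S : SmoothMetric 2 M) :
    ContDiffOn ℝ ∞ (gaugeA φ S.inner) φ.target :=
  (contDiffOn_gram_apply hφ S 0 0).div (contDiffOn_dens hφ S)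
    fun _ hz => (dens_pos hφ S hz).ne'

lemma contDiffOn_gaugeR (hφ : φ ∈ atlas (E 2) M) (S : SmoothMetric 2 M) :
    ContDiffOn ℝ ∞ (gaugeR φ S.inner) φ.target :=
  (contDiffOn_gram_apply hφ S 0 1).div (contDiffOn_gram_apply hφ S 0 0)
    fun _ hz => (gram_zero_zero_pos (isMetric_smooth S) hφ hz).ne'

lemma pd_gaugeR (hφ : φ ∈ atlas (E 2) M) (S : SmoothMetric 2 M) (hz : z ∈ φ.target)
    (k : Fin 2) : pd k (gaugeR φ S.inner) z
      = (pd k (fun w => gram φ S.inner w 0 1) z * gram φ S.inner z 0 0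
        - gram φ S.inner z 0 1 * pd k (fun w => gram φ S.inner w 0 0) z)
        / gram φ S.inner z 0 0 ^ 2 :=
  pd_div (differentiableAt_gram_apply hφ S hz 0 1) (differentiableAt_gram_apply hφ S hz 0 0)
    (gram_zero_zero_pos (isMetric_smooth S) hφ hz).ne'

lemma IsClassicalAt.rotField_eq (H : IsClassicalAt φ h S z) (hφ : φ ∈ atlas (E 2) M)
    (hz : z ∈ φ.target) (k : Fin 2) : rotField φ h.inner S.inner k z
      = gaugeA φ S.inner z * pd k (gaugeR φ S.inner) z := by
  rw [rotField, H.pdGram_eq hφ hz, H.pdGram_eq hφ hz, pd_gaugeR hφ S hz]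

/-- The quadratic term in the Christoffel symbols is a Jacobian determinant. -/
lemma dens_mul_quadratic (hφ : φ ∈ atlas (E 2) M) (S : SmoothMetric 2 M) (hz : z ∈ φ.target) :
    dens φ S.inner z * ∑ i, ∑ j, (gram φ S.inner z)⁻¹ i j * ∑ k, ∑ l,
        (christoffel φ S.inner k k l z * christoffel φ S.inner l i j z
          - christoffel φ S.inner k j l z * christoffel φ S.inner l i k z)
      = pd 0 (fun w => gaugeA φ S.inner w * pd 1 (gaugeR φ S.inner) w) z
        - pd 1 (fun w => gaugeA φ S.inner w * pd 0 (gaugeR φ S.inner) w) z := by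
  have hS := isMetric_smooth S
  have hs := dens_pos hφ S hz
  have h0 := gram_zero_zero_pos hS hφ hz
  have hsq : dens φ S.inner z ^ 2 = (gram φ S.inner z).det :=
    Real.sq_sqrt (det_gram_pos hS hφ hz).le
  have hmem := φ.open_target.mem_nhds hz
  have dA := ((contDiffOn_gaugeA hφ S).contDiffAt hmem).differentiableAt (by simp)
  have dR : ∀ k, DifferentiableAt ℝ (pd k (gaugeR φ S.inner)) z := fun k =>
    ((contDiffOn_pd φ.open_target (contDiffOn_gaugeR hφ S) k).contDiffAt hmem).differentiableAt
      (by simp)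
  have dD := ((contDiffOn_dens hφ S).contDiffAt hmem).differentiableAt (by simp)
  have hA : ∀ k, pd k (gaugeA φ S.inner) z = (pd k (fun w => gram φ S.inner w 0 0) z
      * dens φ S.inner z - gram φ S.inner z 0 0 * (dens φ S.inner z
        * ∑ l, christoffel φ S.inner l k l z)) / dens φ S.inner z ^ 2 := fun k => by
    rw [← pd_dens_self hφ S hz]
    exact pd_div (differentiableAt_gram_apply hφ S hz 0 0) dD hs.ne'
  -- The mixed second derivatives of `gaugeR` cancel, so this difference of derivatives is the
  -- Jacobian determinant of `gaugeA` and `gaugeR`.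
  rw [pd_mul dA (dR 1), pd_mul dA (dR 0), pd_pd_comm φ.open_target (contDiffOn_gaugeR hφ S) hz 1 0]
  have hinv : (gram φ S.inner z)⁻¹ = (dens φ S.inner z ^ 2)⁻¹
      • !![gram φ S.inner z 1 1, -gram φ S.inner z 0 1; -gram φ S.inner z 1 0,
        gram φ S.inner z 0 0] := by
    rw [hsq, Matrix.inv_def, Ring.inverse_eq_inv', Matrix.adjugate_fin_two]
  have key := two_dim_jacobian (fun i j => gram φ S.inner z i j)
    (fun i j => (gram φ S.inner z)⁻¹ i j) (fun k i j => christoffel φ S.inner k i j z)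
    (dens φ S.inner z) hs.ne' h0.ne' (by rw [hsq, Matrix.det_fin_two])
    (gram_symm hS z) (christoffel_symm hS z)
    (by simp [hinv]; ring) (by simp [hinv]; ring) (by simp [hinv]; ring) (by simp [hinv]; ring)
    (fun k i j => pd k (fun w => gram φ S.inner w i j) z) (pd_gram_self hφ S hz)
  rw [key, hA, hA, pd_gaugeR hφ S hz, pd_gaugeR hφ S hz]
  ring

lemma dens_mul_rho (hφ : φ ∈ atlas (E 2) M) (h S : SmoothMetric 2 M) (hz : z ∈ φ.target) :
    dens φ h.inner z * rho φ h.inner S.inner z = dens φ S.inner z := by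
  have hh := det_gram_pos (isMetric_smooth h) hφ hz
  rw [dens, rho, dens, ← Real.sqrt_mul hh.le, mul_div_cancel₀ _ hh.ne']

/-- The zeroth order coefficient of the pairing is a divergence. -/
lemma IsClassicalAt.dens_mul_coefB (H : IsClassicalAt φ h S z) (hφ : φ ∈ atlas (E 2) M)
    (hz : z ∈ φ.target) (hF : F φ h.inner S.inner z = invF φ h.inner S.inner z) :
    dens φ h.inner z * coefB φ h.inner S.inner z
      = ∑ k, pd k (bgField φ h.inner S.inner k) z
        - (pd 0 (fun w => gaugeA φ S.inner w * pd 1 (gaugeR φ S.inner) w) z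
        - pd 1 (fun w => gaugeA φ S.inner w * pd 0 (gaugeR φ S.inner) w) z) := by
  have hS := isMetric_smooth S
  have hh := isMetric_smooth h
  have hdC : ∀ m k i j, pd m (christoffel φ h.inner k i j) z
      = pd m (christoffel φ h.inner k j i) z := fun m k i j => by
    rw [show christoffel φ h.inner k i j = christoffel φ h.inner k j i from
      funext fun w => christoffel_symm hh w k i j]
  have key := two_dim_curvature_identity (fun i j => (gram φ S.inner z)⁻¹ i j)
    (fun k i j => christoffel φ h.inner k i j z) (fun k i j => christoffel φ S.inner k i j z)
    (fun m k i j => pd m (christoffel φ h.inner k i j) z) (gram_inv_symm hS z)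
    (christoffel_symm hh z) (christoffel_symm hS z) hdC
    (fun k i j => diffChr φ h.inner S.inner k i j z) (fun _ _ _ => rfl)
    (fun k i j => invD φ h.inner S.inner z k i j) (H.invD_eq hφ hz)
  -- The factor `½ tr_g ∇̃_k g` is the trace of the difference tensor, and the density of `h` times
  -- the volume ratio is the density of the metric itself.
  have e1 : dens φ h.inner z * coefB φ h.inner S.inner z = dens φ S.inner z
      * (invF φ h.inner S.inner z
        - ∑ k, V φ h.inner S.inner k z * ∑ l, diffChr φ h.inner S.inner l k l z) := by
    rw [← dens_mul_rho hφ h S hz, coefB, hF, mul_assoc, mul_sub, mul_sub, mul_sub, Finset.mul_sum,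
      Finset.mul_sum, Finset.mul_sum]
    congr 1
    · ring
    · refine Finset.sum_congr rfl fun k _ => ?_
      rw [H.trT_eq hφ hz]
      ring
  simp only [invF, V, H.Gam_eq hφ hz, ricci] at e1
  rw [e1, key, mul_sub, dens_mul_quadratic hφ S hz]
  congr 1
  simp only [pd_bgField hφ h S hz, pd_gram_inv_self hφ S hz, Fin.sum_univ_two]
  ring

end Surfaces

/-! ### Integration by parts and convergence of the fields. -/

section IntegrationByParts

variable {n : ℕ} {Ω K : Set (E n)} {k : Fin n}

lemma integral_pd_mul_add (hΩ : IsOpen Ω) (hK : K ⊆ Ω) (hc : IsCompact K) {Y w : E n → ℝ}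
    (hY : ContDiffOn ℝ ∞ Y Ω) (hw : ContDiff ℝ ∞ w) (hs : tsupport w ⊆ K) :
    IntegrableOn (fun z => pd k Y z * w z + Y z * pd k w z) K ∧
      ∫ z in K, (pd k Y z * w z + Y z * pd k w z) = 0 := by
  have hwc : HasCompactSupport w := hc.of_isClosed_subset (isClosed_tsupport w) hs
  have hs' := (tsupport_pd_subset (k := k) w).trans hs
  have i1 : IntegrableOn (fun z => pd k Y z * w z) K :=
    (((contDiffOn_pd hΩ hY k).continuousOn.mono hK).mul hw.continuous.continuousOn)
      |>.integrableOn_compact hc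
  have i2 : IntegrableOn (fun z => Y z * pd k w z) K :=
    ((hY.continuousOn.mono hK).mul (contDiff_pd hw).continuous.continuousOn)
      |>.integrableOn_compact hc
  refine ⟨i1.add i2, ?_⟩
  have h1 := (hasWeakPartial_of_contDiffOn (k := k) hΩ hY).2.2 w hw hwc (hs.trans hK)
  rw [setIntegral_mul_test_eq (hs'.trans hK), setIntegral_mul_test_eq (hs.trans hK)] at h1
  rw [integral_add i1 i2, setIntegral_mul_test_eq hs, setIntegral_mul_test_eq hs', h1]
  ring

end IntegrationByParts

section Fields

variable {n : ℕ} {M : Type*} [TopologicalSpace M] [ChartedSpace (E n) M]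
  [IsManifold (𝓡 n) ∞ M] {φ : OpenPartialHomeomorph M (E n)} {K : Set (E n)}
  {h : SmoothMetric n M} {g : Tensor2 n M} {gδ : ℝ → SmoothMetric n M}

namespace Approx

/-- The field obtained by integration by parts contains the density of the varying metric, not only
that of the background. -/
lemma densConv (H : Approx h g gδ) (hφ : φ ∈ atlas (E n) M) (hK : K ⊆ φ.target)
    (hc : IsCompact K) : ContConv K (fun δ => dens φ (gδ δ).inner) (dens φ g) :=
  (ContConv.matrix (H.gramConv φ hφ K hK hc)).det.comp (Φ := Real.sqrt)
    (fun _ _ => Real.continuous_sqrt.continuousAt)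
    fun _ _ _ _ => Real.continuous_sqrt.continuousAt

lemma gram_top (H : Approx h g gδ) (hφ : φ ∈ atlas (E n) M) (hK : K ⊆ φ.target)
    (hc : IsCompact K) (i j : Fin n) : LpConv (volume.restrict K) ⊤
      (fun δ z => gram φ (gδ δ).inner z i j) fun z => gram φ g z i j :=
  (H.gramConv φ hφ K hK hc i j).lpConv_top hc hc.measurableSet

lemma bgFieldConv (H : Approx h g gδ) (hφ : φ ∈ atlas (E n) M) (hK : K ⊆ φ.target)
    (hc : IsCompact K) (k : Fin n) : LpConv (volume.restrict K) ⊤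
      (fun δ => bgField φ h.inner (gδ δ).inner k) (bgField φ h.inner g k) := by
  have hΓ := fun a b c => lpConv_const_of_continuousOn hc
    ((contDiffOn_christoffel hφ h a b c).continuousOn.mono hK)
  exact ((H.densConv hφ hK hc).lpConv_top hc hc.measurableSet).mul le_top
    ((LpConv.sum _ le_top fun i => LpConv.sum _ le_top fun j =>
      (H.inv_top hφ hK hc i j).mul le_top (hΓ k i j)).sub le_top
    (LpConv.sum _ le_top fun i => LpConv.sum _ le_top fun j =>
      (H.inv_top hφ hK hc i k).mul le_top (hΓ j j i)))

lemma pdGramConv (H : Approx h g gδ) (hn : 1 ≤ (n : ℝ≥0∞)) (hφ : φ ∈ atlas (E n) M)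
    (hK : K ⊆ φ.target) (hc : IsCompact K) (k i j : Fin n) : LpConv (volume.restrict K) n
      (fun δ z => pdGram φ h.inner (gδ δ).inner z k i j)
      fun z => pdGram φ h.inner g z k i j := by
  have := isFiniteMeasure_restrict (μ := (volume : Measure (E n))) hc
  have hΓ := fun a b c => lpConv_const_of_continuousOn hc
    ((contDiffOn_christoffel hφ h a b c).continuousOn.mono hK)
  exact ((H.tConv φ hφ K hK hc k i j).add hn (LpConv.sum _ hn fun l =>
    ((hΓ l k i).mul (r := ⊤) le_top (H.gram_top hφ hK hc l j)).mono le_top)).add hn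
    (LpConv.sum _ hn fun l =>
    ((hΓ l k j).mul (r := ⊤) le_top (H.gram_top hφ hK hc i l)).mono le_top)

end Approx

end Fields

/-! ### The local estimate in dimension two. -/

section Surfaces

variable {M : Type*} [TopologicalSpace M] [ChartedSpace (E 2) M]
  {φ : OpenPartialHomeomorph M (E 2)} {K : Set (E 2)}

/-- The vector density whose divergence is minus the scalar curvature of `g`. -/
def curvField (φ : OpenPartialHomeomorph M (E 2)) (h g : Tensor2 2 M) (k : Fin 2) (z : E 2) : ℝ :=
  dens φ h z * coefA φ h g k z - bgField φ h g k z
    + ![rotField φ h g 1 z, -rotField φ h g 0 z] k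

variable [IsManifold (𝓡 2) ∞ M] {h : SmoothMetric 2 M} {g : Tensor2 2 M}
  {gδ : ℝ → SmoothMetric 2 M}

lemma one_le_two_cast : (1 : ℝ≥0∞) ≤ ((2 : ℕ) : ℝ≥0∞) := by norm_num

/-- For a smooth metric the zeroth order coefficient is a divergence almost everywhere. Adding the
four vanishing integrals of total derivatives moves all derivatives to `w`. -/
lemma integral_localIntegrand_smooth (hφ : φ ∈ atlas (E 2) M) (hK : K ⊆ φ.target)
    (hc : IsCompact K) (h S : SmoothMetric 2 M) {w : E 2 → ℝ} (hw : ContDiff ℝ ∞ w)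
    (hs : tsupport w ⊆ K) :
    ∫ z in K, dens φ h.inner z * localIntegrand φ h.inner S.inner w z
      = ∫ z in K, ∑ k, curvField φ h.inner S.inner k z * pd k w z := by
  have i0 := memLp_one_iff_integrable.1
    ((Approx.const h S).localConv le_rfl hφ hK hc hw.contDiffOn).memLp
  have b := fun k => integral_pd_mul_add (k := k) φ.open_target hK hc
    (contDiffOn_bgField hφ h S k) hw hs
  have hR := fun k => (contDiffOn_gaugeA hφ S).mul
    (contDiffOn_pd φ.open_target (contDiffOn_gaugeR hφ S) k)
  have r0 := integral_pd_mul_add (k := 1) φ.open_target hK hc (hR 0) hw hs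
  have r1 := integral_pd_mul_add (k := 0) φ.open_target hK hc (hR 1) hw hs
  have e : (fun z => ∑ k, curvField φ h.inner S.inner k z * pd k w z)
      =ᵐ[volume.restrict K] fun z => (((dens φ h.inner z * localIntegrand φ h.inner S.inner w z
        - (pd 0 (bgField φ h.inner S.inner 0) z * w z + bgField φ h.inner S.inner 0 z * pd 0 w z))
        - (pd 1 (bgField φ h.inner S.inner 1) z * w z + bgField φ h.inner S.inner 1 z * pd 1 w z))
        + (pd 0 (fun z => gaugeA φ S.inner z * pd 1 (gaugeR φ S.inner) z) z * w z
          + gaugeA φ S.inner z * pd 1 (gaugeR φ S.inner) z * pd 0 w z))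
        - (pd 1 (fun z => gaugeA φ S.inner z * pd 0 (gaugeR φ S.inner) z) z * w z
          + gaugeA φ S.inner z * pd 0 (gaugeR φ S.inner) z * pd 1 w z) := by
    filter_upwards [ae_restrict_of_ae_restrict_of_subset hK (ae_isClassicalAt hφ h S),
      ae_restrict_of_ae_restrict_of_subset hK ((Approx.const h S).F_ae one_le_two_cast hφ),
      ae_restrict_mem hc.measurableSet] with z hz hF hzK
    have e1 := hz.dens_mul_coefB hφ (hK hzK) hF
    simp only [localIntegrand, curvField, hz.rotField_eq hφ (hK hzK), Fin.sum_univ_two,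
      Matrix.cons_val_zero, Matrix.cons_val_one] at e1 ⊢
    linear_combination -(w z) * e1
  have j0 := Integrable.sub' i0 (b 0).1
  have j1 := Integrable.sub' j0 (b 1).1
  rw [integral_congr_ae e, integral_sub (j1.fun_add r1.1) r0.1, integral_add j1 r1.1,
    integral_sub j0 (b 1).1, integral_sub i0 (b 0).1, (b 0).2, (b 1).2, r0.2, r1.2]
  ring

namespace Approx

/-- A uniformly convergent factor times first derivatives of the metric, which converge in `L²`; the
denominators are handled by continuous convergence. -/
lemma rotFieldConv (H : Approx h g gδ) (hφ : φ ∈ atlas (E 2) M) (hK : K ⊆ φ.target)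
    (hc : IsCompact K) (k : Fin 2) : LpConv (volume.restrict K) (2 : ℕ)
      (fun δ => rotField φ h.inner (gδ δ).inner k) (rotField φ h.inner g k) := by
  have h00 := H.gramConv φ hφ K hK hc 0 0
  have hi : ContConv K (fun δ z => (gram φ (gδ δ).inner z 0 0 ^ 2)⁻¹)
      fun z => (gram φ g z 0 0 ^ 2)⁻¹ :=
    h00.comp (Φ := fun x => (x ^ 2)⁻¹)
      (fun z hz => (continuousAt_id.pow 2).inv₀
        (pow_ne_zero 2 (gram_zero_zero_pos H.metric hφ (hK hz)).ne'))
      fun δ _ z hz => (continuousAt_id.pow 2).inv₀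
        (pow_ne_zero 2 (gram_zero_zero_pos (isMetric_smooth (gδ δ)) hφ (hK hz)).ne')
  have hd : ContConv K (fun δ z => (dens φ (gδ δ).inner z)⁻¹) fun z => (dens φ g z)⁻¹ :=
    (H.densConv hφ hK hc).comp (Φ := fun x => x⁻¹)
      (fun z hz => continuousAt_inv₀ (Real.sqrt_pos.2 (det_gram_pos H.metric hφ (hK hz))).ne')
      fun δ _ z hz => continuousAt_inv₀ (dens_pos hφ (gδ δ) (hK hz)).ne'
  have hA := (h00.mul hd).lpConv_top (μ := volume) hc hc.measurableSet
  have hp := fun i j => H.pdGramConv one_le_two_cast hφ hK hc k i j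
  have hg := fun i j => H.gram_top hφ hK hc i j
  exact hA.mul one_le_two_cast ((((hp 0 1).mul one_le_two_cast (hg 0 0)).sub one_le_two_cast
    ((hg 0 1).mul one_le_two_cast (hp 0 0))).mul one_le_two_cast
    (hi.lpConv_top hc hc.measurableSet))

lemma curvFieldConv (H : Approx h g gδ) (hφ : φ ∈ atlas (E 2) M) (hK : K ⊆ φ.target)
    (hc : IsCompact K) (k : Fin 2) : LpConv (volume.restrict K) (2 : ℕ)
      (fun δ => curvField φ h.inner (gδ δ).inner k) (curvField φ h.inner g k) := by
  have := isFiniteMeasure_restrict (μ := (volume : Measure (E 2))) hc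
  have h1 := ((dens_top hφ h hK hc).mul one_le_two_cast
    (H.coefAConv one_le_two_cast hφ hK hc k)).sub one_le_two_cast
    ((H.bgFieldConv hφ hK hc k).mono le_top)
  fin_cases k
  · exact h1.add one_le_two_cast (H.rotFieldConv hφ hK hc 1)
  · exact h1.add one_le_two_cast (H.rotFieldConv hφ hK hc 0).neg

/-- The divergence formula cannot be differentiated directly for a merely `W^{1,2}` metric, but its
integrated form is a limit of the smooth one for each fixed test function. -/
lemma integral_localIntegrand (H : Approx h g gδ) (hφ : φ ∈ atlas (E 2) M) (hK : K ⊆ φ.target)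
    (hc : IsCompact K) {w : E 2 → ℝ} (hw : ContDiff ℝ ∞ w) (hs : tsupport w ⊆ K) :
    ∫ z in K, dens φ h.inner z * localIntegrand φ h.inner g w z
      = ∫ z in K, ∑ k, curvField φ h.inner g k z * pd k w z := by
  have := isFiniteMeasure_restrict (μ := (volume : Measure (E 2))) hc
  have t1 := (H.localConv le_rfl hφ hK hc hw.contDiffOn).tendsto_integral
  have t2 : LpConv (volume.restrict K) 1
      (fun δ z => ∑ k, curvField φ h.inner (gδ δ).inner k z * pd k w z)
      fun z => ∑ k, curvField φ h.inner g k z * pd k w z :=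
    LpConv.sum _ le_rfl fun k => ((H.curvFieldConv hφ hK hc k).mono one_le_two_cast).mul le_rfl
      (lpConv_const_of_continuousOn hc (contDiff_pd hw).continuous.continuousOn)
  refine tendsto_nhds_unique t1 (t2.tendsto_integral.congr fun δ => ?_)
  exact (integral_localIntegrand_smooth hφ hK hc h (gδ δ) hw hs).symm

/-- After integration by parts only `∂w` occurs, paired in `L²` with a field converging in `L²`, so
no bound on `w` itself is required. -/
lemma localEstimate_two (H : Approx h g gδ) (hφ : φ ∈ atlas (E 2) M) (hK : K ⊆ φ.target)
    (hc : IsCompact K) : LocalEstimate φ K h g gδ := by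
  have := holderTriple_conjExp (n := 2) le_rfl
  have hX := fun k => H.curvFieldConv hφ hK hc k
  refine ⟨_, (tendsto_finsetSum Finset.univ fun k _ => (hX k).tendsto_toReal).trans (by simp), ?_⟩
  filter_upwards [eventually_all.2 fun k => (hX k).pairing_le (p := conjExp 2), eventually_all.2
    fun k => (hX k).memLp_eventually] with δ h1 hm w hw hs
  have hpd : ∀ k, tsupport (pd k w) ⊆ K := fun k => (tsupport_pd_subset w).trans hs
  have m1 := fun k => memLp_of_tsupport_subset hc (contDiff_pd (k := k) hw).continuous (hpd k)
    (conjExp 2)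
  have b1 := fun k => h1 k (pd k w) ((m1 k).restrict K)
  simp only [eLpNorm_restrict_of_tsupport (hpd _)] at b1
  have hi : ∀ X : Fin 2 → E 2 → ℝ, (∀ k, MemLp (X k) (2 : ℕ) (volume.restrict K)) →
      Integrable (fun z => ∑ k, X k z * pd k w z) (volume.restrict K) := fun X hX =>
    integrable_finsetSum _ fun k _ => memLp_one_iff_integrable.1
      (((m1 k).restrict K).mul (hX k))
  rw [integral_localIntegrand_smooth hφ hK hc h (gδ δ) hw hs,
    H.integral_localIntegrand hφ hK hc hw hs,
    ← integral_sub (hi _ hm) (hi _ fun k => (hX k).memLp)]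
  have e : ∀ z, (∑ k, curvField φ h.inner (gδ δ).inner k z * pd k w z)
      - ∑ k, curvField φ h.inner g k z * pd k w z
      = ∑ k, (curvField φ h.inner (gδ δ).inner k z - curvField φ h.inner g k z) * pd k w z :=
    fun z => by simp only [sub_mul, Finset.sum_sub_distrib]
  simp only [e]
  rw [integral_finsetSum _ fun k _ => (b1 k).1]
  refine (Finset.abs_sum_le_sum_abs _ _).trans ?_
  rw [Finset.sum_mul]
  refine Finset.sum_le_sum fun k _ => (b1 k).2.trans (mul_le_mul_of_nonneg_left ?_
    ENNReal.toReal_nonneg)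
  exact Finset.single_le_sum (f := fun k => (eLpNorm (pd k w) (conjExp 2) volume).toReal)
    (fun _ _ => ENNReal.toReal_nonneg) (Finset.mem_univ k)

end Approx

end Surfaces

lemma Approx.localEstimate {n : ℕ} (hn : 2 ≤ n) {M : Type*} [TopologicalSpace M]
    [ChartedSpace (E n) M] [IsManifold (𝓡 n) ∞ M] {φ : OpenPartialHomeomorph M (E n)}
    {K : Set (E n)} {h : SmoothMetric n M} {g : Tensor2 n M} {gδ : ℝ → SmoothMetric n M}
    (H : Approx h g gδ) (hφ : φ ∈ atlas (E n) M) (hK : K ⊆ φ.target) (hc : IsCompact K) :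
    LocalEstimate φ K h g gδ := by
  rcases hn.eq_or_lt with rfl | h3
  · exact H.localEstimate_two hφ hK hc
  · exact H.localEstimate_of_three_le h3 hφ hK hc

/-! ### Localized functions extended to ℝⁿ. -/

section Extension

variable {n : ℕ} {M : Type*} [TopologicalSpace M] {φ : OpenPartialHomeomorph M (E n)}
  {K : Set (E n)}

open Classical in
/-- The function `w` in the chart `φ`, extended by zero. -/
def extendZero (φ : OpenPartialHomeomorph M (E n)) (w : M → ℝ) (z : E n) : ℝ :=
  if z ∈ φ.target then w (φ.symm z) else 0

lemma extendZero_eventuallyEq (w : M → ℝ) {z : E n} (hz : z ∈ φ.target) :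
    extendZero φ w =ᶠ[𝓝 z] w ∘ φ.symm := by
  filter_upwards [φ.open_target.mem_nhds hz] with y hy
  simp [extendZero, hy]

lemma pd_extendZero (w : M → ℝ) {z : E n} (hz : z ∈ φ.target) (k : Fin n) :
    pd k (extendZero φ w) z = pd k (w ∘ φ.symm) z := by
  rw [pd, (extendZero_eventuallyEq w hz).fderiv_eq]
  rfl

lemma tsupport_extendZero_subset (hc : IsCompact K) {w : M → ℝ}
    (hw : tsupport w ⊆ φ.symm '' K) (hK : K ⊆ φ.target) : tsupport (extendZero φ w) ⊆ K := by
  refine closure_minimal (fun z hz => ?_) hc.isClosed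
  have hzt : z ∈ φ.target := by
    by_contra h
    exact hz (by simp [extendZero, h])
  have h1 : w (φ.symm z) ≠ 0 := by simpa [extendZero, hzt] using hz
  obtain ⟨y, hy, hyz⟩ := hw (subset_tsupport w h1)
  rwa [← φ.symm.injOn (hK hy) hzt hyz]

variable [ChartedSpace (E n) M] [IsManifold (𝓡 n) ∞ M]

lemma contDiff_extendZero (hφ : φ ∈ atlas (E n) M) (hc : IsCompact K) (hK : K ⊆ φ.target)
    {w : M → ℝ} (hw : ContMDiff (𝓡 n) 𝓘(ℝ, ℝ) ∞ w) (hs : tsupport w ⊆ φ.symm '' K) :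
    ContDiff ℝ ∞ (extendZero φ w) := by
  refine contDiff_iff_contDiffAt.2 fun z => ?_
  by_cases hz : z ∈ φ.target
  · exact ((contDiffOn_comp_symm hφ hw).contDiffAt (φ.open_target.mem_nhds hz)).congr_of_eventuallyEq
      (extendZero_eventuallyEq w hz)
  · have h1 : extendZero φ w =ᶠ[𝓝 z] fun _ => 0 := notMem_tsupport_iff_eventuallyEq.1 fun h =>
      hz (hK (tsupport_extendZero_subset hc hs hK h))
    exact contDiffAt_const.congr_of_eventuallyEq h1

lemma exists_normGrad_le (hφ : φ ∈ atlas (E n) M) (h : SmoothMetric n M) (hc : IsCompact K)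
    (hK : K ⊆ φ.target) {u : M → ℝ} (hu : ContMDiff (𝓡 n) 𝓘(ℝ, ℝ) ∞ u) :
    ∃ C : ℝ, 0 < C ∧ ∀ x ∈ φ.symm '' K, normGrad h.inner u x ≤ C := by
  have hpd := fun k => (contDiffOn_pd φ.open_target (contDiffOn_comp_symm hφ hu) k).continuousOn
  have hcont : ContinuousOn (fun z => √(∑ i, ∑ j, (gram φ h.inner z)⁻¹ i j
      * pd i (u ∘ φ.symm) z * pd j (u ∘ φ.symm) z)) K :=
    (continuousOn_finsetSum _ fun i _ => continuousOn_finsetSum _ fun j _ =>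
      ((contDiffOn_gram_inv hφ h i j).continuousOn.mul (hpd i)).mul (hpd j)).sqrt.mono hK
  obtain ⟨C, hC, H⟩ := exists_bound_of_continuousOn_nonneg hc hcont
  refine ⟨C, hC, ?_⟩
  rintro _ ⟨z, hz, rfl⟩
  exact ((chartInvariant_normGrad (isMetric_smooth h) hu).atPoint_eq hφ (hK hz)).trans_le (H z hz)

variable [CompactSpace M] [MeasurableSpace M] [BorelSpace M]
  {h : SmoothMetric n M} {g : Tensor2 n M} {gδ : ℝ → SmoothMetric n M}

/-- The integrand vanishes almost everywhere off the image of `K`, so the integral over `M` reduces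
to the compact part of one chart. -/
lemma Approx.scalPairing_eq (H : Approx h g gδ) (hn : 2 ≤ n) (hφ : φ ∈ atlas (E n) M)
    (hc : IsCompact K) (hK : K ⊆ φ.target) {w : M → ℝ} (hw : ContMDiff (𝓡 n) 𝓘(ℝ, ℝ) ∞ w)
    (hs : tsupport w ⊆ φ.symm '' K) :
    Integrable (scalIntegrand h.inner g w) (vol h.inner) ∧
      scalPairing h.inner g w
        = ∫ z in K, dens φ h.inner z * localIntegrand φ h.inner g (extendZero φ w) z := by
  have hn1 : 1 ≤ (n : ℝ≥0∞) := by exact_mod_cast (by omega : 1 ≤ n)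
  have hW := contDiff_extendZero hφ hc hK hw hs
  have hae : (fun z => scalIntegrand h.inner g w (φ.symm z)) =ᵐ[volume.restrict K]
      localIntegrand φ h.inner g (extendZero φ w) := by
    filter_upwards [ae_restrict_of_ae_restrict_of_subset hK (H.scalIntegrand_ae hn1 hφ hw),
      ae_restrict_mem hc.measurableSet] with z hz hzK
    rw [hz, localIntegrand]
    simp only [pd_extendZero w (hK hzK)]
    simp [extendZero, hK hzK]
  have h1 := integral_vol_image hφ h hK hc hae (memLp_one_iff_integrable.1
    (H.localConv hn hφ hK hc hW.contDiffOn).memLp)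
  have h2 : ∀ᵐ x ∂vol h.inner, x ∉ φ.symm '' K → scalIntegrand h.inner g w x = 0 := by
    filter_upwards [H.scalIntegrand_off hn1 hw] with x hx hxK
    exact hx fun h' => hxK (hs h')
  exact ⟨h1.1.integrable_of_ae_notMem_eq_zero h2,
    (setIntegral_eq_integral_of_ae_compl_eq_zero h2).symm.trans h1.2⟩

lemma vol_symm_image_lt_top (hφ : φ ∈ atlas (E n) M) (h : SmoothMetric n M) (hc : IsCompact K)
    (hK : K ⊆ φ.target) : vol h.inner (φ.symm '' K) < ⊤ := by
  have h1 := congrArg (fun μ : Measure (E n) => μ univ) (map_vol_restrict_image hφ h.inner hK hc)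
  simp only [Measure.map_apply_of_aemeasurable (aemeasurable_chart_image hK h.inner)
    MeasurableSet.univ, preimage_univ, Measure.restrict_apply_univ, withDensity_apply _
    MeasurableSet.univ, Measure.restrict_univ] at h1
  rw [h1]
  exact (((contDiffOn_dens hφ h).continuousOn.mono hK).integrableOn_compact hc).lintegral_lt_top

/-- The norm of the gradient of a localized function is controlled by Sobolev norms. -/
lemma exists_eLpNorm_pd_extendZero_le (hn : 2 ≤ n) (hφ : φ ∈ atlas (E n) M) (h : SmoothMetric n M)
    (hc : IsCompact K) (hK : K ⊆ φ.target) {χ : M → ℝ} (hχ : ContMDiff (𝓡 n) 𝓘(ℝ, ℝ) ∞ χ)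
    (hs : tsupport χ ⊆ φ.symm '' K) (k : Fin n) :
    ∃ C : ℝ≥0∞, C ≠ ⊤ ∧ ∀ u : M → ℝ, ContMDiff (𝓡 n) 𝓘(ℝ, ℝ) ∞ u →
      eLpNorm (pd k (extendZero φ fun x => χ x * u x)) (conjExp n) volume
        ≤ C * (eLpNorm u (conjExp n) (vol h.inner)
          + eLpNorm (normGrad h.inner u) (conjExp n) (vol h.inner)) := by
  have hp1 := one_le_conjExp hn
  have hp0 : conjExp n ≠ 0 := (zero_lt_one.trans_le hp1).ne'
  have hχ' := contDiffOn_comp_symm hφ hχ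
  have hpχ := (contDiffOn_pd φ.open_target hχ' k).continuousOn
  have hgk := ((contDiffOn_gram_apply hφ h k k).continuousOn.sqrt)
  obtain ⟨C₁, hC₁, H₁⟩ := exists_eLpNorm_le_of_abs_le hφ h hK hc hp0 ENNReal.ofReal_ne_top
    (hpχ.abs.mono hK)
  obtain ⟨C₂, hC₂, H₂⟩ := exists_eLpNorm_le_of_abs_le hφ h hK hc hp0 ENNReal.ofReal_ne_top
    ((hχ'.continuousOn.abs.mul hgk).mono hK)
  refine ⟨max C₁ C₂, (max_lt hC₁.lt_top hC₂.lt_top).ne, fun u hu => ?_⟩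
  have hu' := contDiffOn_comp_symm hφ hu
  have hpu := (contDiffOn_pd φ.open_target hu' k).continuousOn
  have hsu : tsupport (fun x => χ x * u x) ⊆ φ.symm '' K := tsupport_mul_subset_left.trans hs
  have hsupp := (tsupport_pd_subset (k := k) _).trans (tsupport_extendZero_subset hc hsu hK)
  have e : pd k (extendZero φ fun x => χ x * u x) =ᵐ[volume.restrict K]
      (fun z => pd k (χ ∘ φ.symm) z * u (φ.symm z))
        + fun z => (χ ∘ φ.symm) z * pd k (u ∘ φ.symm) z := by
    filter_upwards [ae_restrict_mem hc.measurableSet] with z hz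
    have hm := φ.open_target.mem_nhds (hK hz)
    rw [pd_extendZero _ (hK hz)]
    exact pd_mul ((hχ'.contDiffAt hm).differentiableAt (by simp))
      ((hu'.contDiffAt hm).differentiableAt (by simp))
  rw [← eLpNorm_restrict_of_tsupport hsupp, eLpNorm_congr_ae e]
  refine (eLpNorm_add_le
    (((hpχ.mul hu'.continuousOn).mono hK).aestronglyMeasurable hc.measurableSet)
    (((hχ'.continuousOn.mul hpu).mono hK).aestronglyMeasurable hc.measurableSet) hp1).trans ?_
  rw [mul_add]
  refine add_le_add ?_ ?_
  · refine (H₁ _ (fun x => ‖u x‖) (fun _ => norm_nonneg _) fun z _ => (abs_mul _ _).le).trans ?_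
    · rw [eLpNorm_norm]
      exact mul_le_mul_left (le_max_left _ _) _
  · refine (H₂ _ (normGrad h.inner u) (normGrad_nonneg _ _) fun z hz => ?_).trans
      (mul_le_mul_left (le_max_right _ _) _)
    have := mul_le_mul_of_nonneg_left (abs_pd_le hφ h hu (hK hz) k)
      (abs_nonneg ((χ ∘ φ.symm) z))
    simpa only [Pi.mul_apply, abs_mul, mul_assoc] using this

end Extension

/-! ### Partition of unity and the global estimate. -/

section Global

variable {n : ℕ} {M : Type*} [TopologicalSpace M] [ChartedSpace (E n) M]
  [IsManifold (𝓡 n) ∞ M] [CompactSpace M]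

/-- A finite smooth partition of unity, subordinate to compact parts of charts. -/
structure ChartPartition (n : ℕ) (M : Type*) [TopologicalSpace M] [ChartedSpace (E n) M]
    (ι : Type*) [Fintype ι] where
  chart : ι → OpenPartialHomeomorph M (E n)
  mem_atlas : ∀ i, chart i ∈ atlas (E n) M
  K : ι → Set (E n)
  compact : ∀ i, IsCompact (K i)
  subset : ∀ i, K i ⊆ (chart i).target
  χ : ι → M → ℝ
  smooth : ∀ i, ContMDiff (𝓡 n) 𝓘(ℝ, ℝ) ∞ (χ i)
  tsupport_subset : ∀ i, tsupport (χ i) ⊆ (chart i).symm '' K i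
  sum_eq : ∀ x, ∑ i, χ i x = 1

/-- The compact sets are the chart images of the closed supports of a subordinate partition, compact
because `M` is. -/
lemma exists_chartPartition (n : ℕ) (M : Type*) [TopologicalSpace M] [ChartedSpace (E n) M]
    [IsManifold (𝓡 n) ∞ M] [CompactSpace M] [T2Space M] :
    ∃ t : Finset M, Nonempty (ChartPartition n M t) := by
  obtain ⟨t, ht⟩ := CompactSpace.elim_nhds_subcover (fun x : M => (chartAt (E n) x).source)
    fun x => chart_source_mem_nhds _ x
  obtain ⟨f, hf⟩ := SmoothPartitionOfUnity.exists_isSubordinate (𝓡 n) (s := (univ : Set M))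
    isClosed_univ (fun i : t => (chartAt (E n) (i : M)).source)
    (fun i => (chartAt (E n) (i : M)).open_source) (fun x _ => by
      have : x ∈ ⋃ y ∈ t, (chartAt (E n) y).source := ht ▸ mem_univ x
      simpa using this)
  refine ⟨t, ⟨fun i => chartAt (E n) (i : M), fun i => chart_mem_atlas _ _,
    fun i => chartAt (E n) (i : M) '' tsupport (f i), fun i => ?_, fun i => ?_, fun i => f i,
    fun i => (f i).contMDiff, fun i x hx => ?_, fun x => ?_⟩⟩
  · exact (isClosed_tsupport _).isCompact.image_of_continuousOn
      ((chartAt (E n) (i : M)).continuousOn.mono (hf i))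
  · rintro _ ⟨x, hx, rfl⟩
    exact (chartAt (E n) (i : M)).map_source (hf i hx)
  · exact ⟨_, mem_image_of_mem _ hx, (chartAt (E n) (i : M)).left_inv (hf i hx)⟩
  · have := f.sum_eq_one (mem_univ x)
    rwa [finsum_eq_sum_of_fintype] at this

end Global

section Global

variable {n : ℕ} {M : Type*} [TopologicalSpace M] [ChartedSpace (E n) M]
  {ι : Type*} [Fintype ι]

lemma ChartPartition.exists_mem (p : ChartPartition n M ι) (x : M) :
    ∃ i, x ∈ (p.chart i).symm '' p.K i := by
  by_contra! h
  have h1 : ∑ i, p.χ i x = 0 := Finset.sum_eq_zero fun i _ =>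
    image_eq_zero_of_notMem_tsupport fun hx => h i (p.tsupport_subset i hx)
  exact zero_ne_one (h1.symm.trans (p.sum_eq x))

variable [IsManifold (𝓡 n) ∞ M]

lemma ChartPartition.exists_normGrad_le (p : ChartPartition n M ι) (h : SmoothMetric n M)
    {u : M → ℝ} (hu : ContMDiff (𝓡 n) 𝓘(ℝ, ℝ) ∞ u) :
    ∃ C : ℝ, ∀ x, normGrad h.inner u x ≤ C := by
  choose C hC H using fun i =>
    WeakScalar.exists_normGrad_le (p.mem_atlas i) h (p.compact i) (p.subset i) hu
  refine ⟨∑ i, C i, fun x => ?_⟩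
  obtain ⟨i, hi⟩ := p.exists_mem x
  exact (H i x hi).trans (Finset.single_le_sum (fun j _ => (hC j).le) (Finset.mem_univ i))

variable [CompactSpace M] [MeasurableSpace M] [BorelSpace M]
  {h : SmoothMetric n M} {g : Tensor2 n M} {gδ : ℝ → SmoothMetric n M}

lemma ChartPartition.isFiniteMeasure_vol (p : ChartPartition n M ι) (h : SmoothMetric n M) :
    IsFiniteMeasure (vol h.inner) := by
  refine ⟨?_⟩
  have : (univ : Set M) = ⋃ i, (p.chart i).symm '' p.K i :=
    (eq_univ_of_forall fun x => mem_iUnion.2 (p.exists_mem x)).symm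
  rw [this]
  exact (measure_iUnion_fintype_le _ _).trans_lt (ENNReal.sum_lt_top.2 fun i _ =>
    vol_symm_image_lt_top (p.mem_atlas i) h (p.compact i) (p.subset i))

/-- `normW1` is a `toReal`, which would send an infinite norm to zero; finiteness allows extended
inequalities to become real ones. -/
lemma ChartPartition.sobolev_lt_top (p : ChartPartition n M ι) (h : SmoothMetric n M) (q : ℝ≥0∞)
    {u : M → ℝ} (hu : ContMDiff (𝓡 n) 𝓘(ℝ, ℝ) ∞ u) :
    eLpNorm u q (vol h.inner) + eLpNorm (normGrad h.inner u) q (vol h.inner) < ⊤ := by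
  have := p.isFiniteMeasure_vol h
  have key : ∀ {f : M → ℝ} {C : ℝ}, (∀ x, ‖f x‖ ≤ C) → eLpNorm f q (vol h.inner) < ⊤ := fun hf =>
    (eLpNorm_le_of_ae_bound (ae_of_all _ hf)).trans_lt
      (ENNReal.mul_lt_top (ENNReal.rpow_lt_top_of_nonneg (by positivity) (measure_ne_top _ _))
        ENNReal.ofReal_lt_top)
  obtain ⟨C, hC⟩ := isCompact_univ.exists_bound_of_continuousOn hu.continuous.continuousOn
  obtain ⟨D, hD⟩ := p.exists_normGrad_le h hu
  refine ENNReal.add_lt_top.2 ⟨key fun x => hC x (mem_univ x), key (C := D) fun x => ?_⟩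
  rw [Real.norm_of_nonneg (normGrad_nonneg _ _ _)]
  exact hD x

lemma ChartPartition.exists_gradNorm_le (p : ChartPartition n M ι) (hn : 2 ≤ n)
    (h : SmoothMetric n M) (i : ι) :
    ∃ C : ℝ, ∀ u : M → ℝ, ContMDiff (𝓡 n) 𝓘(ℝ, ℝ) ∞ u →
      gradNorm (conjExp n) (extendZero (p.chart i) fun x => p.χ i x * u x)
        ≤ C * normW1 h.inner (conjExp n) u := by
  choose C hC H using fun k => exists_eLpNorm_pd_extendZero_le hn (p.mem_atlas i) h (p.compact i)
    (p.subset i) (p.smooth i) (p.tsupport_subset i) k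
  refine ⟨∑ k, (C k).toReal, fun u hu => ?_⟩
  rw [gradNorm, Finset.sum_mul]
  refine Finset.sum_le_sum fun k _ => ?_
  rw [normW1, ← ENNReal.toReal_mul]
  exact ENNReal.toReal_mono (ENNReal.mul_ne_top (hC k) (p.sobolev_lt_top h _ hu).ne) (H k u hu)

lemma Approx.scalPairing_eq_sum (H : Approx h g gδ) (hn : 2 ≤ n) (p : ChartPartition n M ι)
    {u : M → ℝ} (hu : ContMDiff (𝓡 n) 𝓘(ℝ, ℝ) ∞ u) :
    Integrable (scalIntegrand h.inner g u) (vol h.inner) ∧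
      scalPairing h.inner g u = ∑ i, ∫ z in p.K i, dens (p.chart i) h.inner z
        * localIntegrand (p.chart i) h.inner g
          (extendZero (p.chart i) fun x => p.χ i x * u x) z := by
  have hn1 : 1 ≤ (n : ℝ≥0∞) := by exact_mod_cast (by omega : 1 ≤ n)
  have hs : ∀ i, ContMDiff (𝓡 n) 𝓘(ℝ, ℝ) ∞ fun x => p.χ i x * u x := fun i =>
    (p.smooth i).mul hu
  have hi := fun i => H.scalPairing_eq hn (p.mem_atlas i) (p.compact i) (p.subset i) (hs i)
    (tsupport_mul_subset_left.trans (p.tsupport_subset i))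
  have hsum : (fun x => ∑ i, p.χ i x * u x) = u := by
    funext x
    rw [← Finset.sum_mul, p.sum_eq, one_mul]
  have hae := H.scalIntegrand_sum hn1 hs
  rw [hsum] at hae
  refine ⟨(integrable_finsetSum _ fun i _ => (hi i).1).congr hae.symm, ?_⟩
  rw [scalPairing, integral_congr_ae hae, integral_finsetSum _ fun i _ => (hi i).1]
  exact Finset.sum_congr rfl fun i _ => (hi i).2

lemma Approx.pairingDefined (H : Approx h g gδ) (hn : 2 ≤ n) (p : ChartPartition n M ι)
    {u : M → ℝ} (hu : ContMDiff (𝓡 n) 𝓘(ℝ, ℝ) ∞ u) : PairingDefined h.inner g u := by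
  have hn1 : 1 ≤ (n : ℝ≥0∞) := by exact_mod_cast (by omega : 1 ≤ n)
  obtain ⟨P, hP, -⟩ := H.exP hn1
  exact ⟨H.exT, ⟨P, hP⟩, H.exDiff hn1 hu, (H.scalPairing_eq_sum hn p hu).1⟩

/-- Sum the local estimates for `χ_i u`; the gradient of each is bounded by the Sobolev norm of `u`
with a constant depending only on the partition and `h`. -/
lemma Approx.exists_scalPairing_sub_le (H : Approx h g gδ) (hn : 2 ≤ n)
    (p : ChartPartition n M ι) :
    ∃ e : ℝ → ℝ, Tendsto e (𝓝[>] 0) (𝓝 0) ∧ ∀ᶠ δ in 𝓝[>] (0 : ℝ), ∀ u : M → ℝ,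
      ContMDiff (𝓡 n) 𝓘(ℝ, ℝ) ∞ u →
        |scalPairing h.inner (gδ δ).inner u - scalPairing h.inner g u|
          ≤ e δ * normW1 h.inner (conjExp n) u := by
  choose C hC using fun i => p.exists_gradNorm_le hn h i
  choose e he hev using fun i => H.localEstimate hn (p.mem_atlas i) (p.subset i) (p.compact i)
  refine ⟨fun δ => ∑ i, |e i δ| * C i, ?_, ?_⟩
  · refine (tendsto_finsetSum Finset.univ fun i _ => ((he i).abs.mul_const (C i))).trans ?_
    simp
  · filter_upwards [eventually_all.2 hev] with δ hδ u hu
    rw [((Approx.const h (gδ δ)).scalPairing_eq_sum hn p hu).2, (H.scalPairing_eq_sum hn p hu).2,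
      ← Finset.sum_sub_distrib, Finset.sum_mul]
    refine (Finset.abs_sum_le_sum_abs _ _).trans (Finset.sum_le_sum fun i _ => ?_)
    have hs : ContMDiff (𝓡 n) 𝓘(ℝ, ℝ) ∞ fun x => p.χ i x * u x := (p.smooth i).mul hu
    have ht : tsupport (fun x => p.χ i x * u x) ⊆ (p.chart i).symm '' p.K i :=
      tsupport_mul_subset_left.trans (p.tsupport_subset i)
    have h0 : 0 ≤ gradNorm (conjExp n) (extendZero (p.chart i) fun x => p.χ i x * u x) :=
      Finset.sum_nonneg fun _ _ => ENNReal.toReal_nonneg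
    calc _ ≤ e i δ * gradNorm (conjExp n) (extendZero (p.chart i) fun x => p.χ i x * u x) :=
          hδ i _ (contDiff_extendZero (p.mem_atlas i) (p.compact i) (p.subset i) hs ht)
            (tsupport_extendZero_subset (p.compact i) ht (p.subset i))
      _ ≤ |e i δ| * (C i * normW1 h.inner (conjExp n) u) :=
          mul_le_mul (le_abs_self _) (hC i u hu) h0 (abs_nonneg _)
      _ = _ := (mul_assoc _ _ _).symm

end Global

end WeakScalar

end

theorem mainTheorem8 {n : ℕ} (hn : 2 ≤ n) {M : Type*} [TopologicalSpace M] [T2Space M]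
    [CompactSpace M] [ChartedSpace (WeakScalar.E n) M] [IsManifold (𝓡 n) ∞ M]
    [MeasurableSpace M] [BorelSpace M]
    (h : WeakScalar.SmoothMetric n M)
    (g : WeakScalar.ContMetric n M) (hg : WeakScalar.MemW1 h.inner n g.inner)
    (gδ : ℝ → WeakScalar.SmoothMetric n M)
    (hC0 : Tendsto (fun δ => WeakScalar.distC0 h.inner (gδ δ).inner g.inner) (𝓝[>] 0) (𝓝 0))
    (hW1 : Tendsto (fun δ => WeakScalar.distW1 h.inner n (gδ δ).inner g.inner) (𝓝[>] 0) (𝓝 0)) :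
    (∀ u : M → ℝ, ContMDiff (𝓡 n) 𝓘(ℝ, ℝ) ∞ u →
      WeakScalar.PairingDefined h.inner g.inner u ∧
        ∀ δ > (0 : ℝ), WeakScalar.PairingDefined h.inner (gδ δ).inner u) ∧
    ∀ ε > (0 : ℝ), ∃ δ₀ > (0 : ℝ), ∀ u : M → ℝ, ContMDiff (𝓡 n) 𝓘(ℝ, ℝ) ∞ u → ∀ δ ∈ Ioo 0 δ₀,
      |WeakScalar.scalPairing h.inner (gδ δ).inner u - WeakScalar.scalPairing h.inner g.inner u|
        ≤ ε * WeakScalar.normW1 h.inner (ENNReal.ofReal ((n : ℝ) / ((n : ℝ) - 1))) u := by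
  obtain ⟨t, ⟨p⟩⟩ := WeakScalar.exists_chartPartition n M
  have H := WeakScalar.approx_of_tendsto (by omega) hg hC0 hW1
  refine ⟨fun u hu => ⟨H.pairingDefined hn p hu, fun δ _ =>
    (WeakScalar.Approx.const h (gδ δ)).pairingDefined hn p hu⟩, fun ε hε => ?_⟩
  obtain ⟨e, he, hev⟩ := H.exists_scalPairing_sub_le hn p
  -- The error factor is independent of `u`, so one interval on which it is below `ε` serves all
  -- test functions.
  obtain ⟨δ₀, hδ₀, hsub⟩ := mem_nhdsGT_iff_exists_Ioo_subset.1
    (hev.and (he.eventually_lt_const hε))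
  exact ⟨δ₀, hδ₀, fun u hu δ hδ => ((hsub hδ).1 u hu).trans
    (mul_le_mul_of_nonneg_right (hsub hδ).2.le ENNReal.toReal_nonneg)⟩
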